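/- A function $f:[0,1]\to\{0,1\}$ is a \emph{union of $d$ intervals} if there are at most $d$ non-overlapping closed intervals $[\ell_i,u_i]$ such that $f(x)=1$ iff $\ell_i\le x\le u_i$ for some $i$; let $\mathcal P_d$ be the class of these functions. For a probability distribution $D$ on $[0,1]$ and a measurable $f:[0,1]\to\{0,1\}$ put $\mathrm{dist}_D(f,\mathcal P_d)=\inf_{g\in\mathcal P_d}\Pr_{x\sim D}[f(x)\neq g(x)]$. An \emph{$s$-sample, $q$-query $\epsilon$-tester} for $\mathcal P_d$ over $D$ is a randomized algorithm that draws $s$ independent unlabeled points from $D$, queries (possibly adaptively) the values of an unknown measurable $f$ at $q$ of these points, and then accepts with probability at least $2/3$ if $f\in\mathcal P_d$ and rejects with probability at least $2/3$ if $\mathrm{dist}_D(f,\mathcal P_d)\ge\epsilon$. A \emph{$q$-query passive $\epsilon$-tester} is a randomized algorithm with the same guarantees that draws $q$ independent points from $D$ and sees the value of $f$ at all of them. \textbf{Theorem.} There are a universal constant $C>0$ and a polynomial $p$ in two variables such that for all integers $d\ge1$ and all $\epsilon>0$: \begin{enumerate} \item There are $s\le p(d,1/\epsilon)$, $q\le C/\epsilon^{4}$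 and a single algorithm that is an $s$-sample, $q$-query $\epsilon$-tester for $\mathcal P_d$ over every probability distribution $D$ on $[0,1]$ (so the tester need not know $D$). \item For the uniform distribution on $[0,1]$ there is an $s$-sample, $q$-query $\epsilon$-tester for $\mathcal P_d$ with $q\le C/\epsilon^{4}$ and $s\le C\sqrt d/\epsilon^{5}$. \item For the uniform distribution on $[0,1]$ there is a $q$-query passive $\epsilon$-tester for $\mathcal P_d$ with $q\le C\sqrt d/\epsilon^{5}$. \end{enumerate} Moreover, item 3 is tight in $d$: there are universal constants $c,\epsilon_0>0$ such that for all $d\ge1$ and $0<\epsilon\le\epsilon_0$, every $q$-query passive $\epsilon$-tester for $\mathcal P_d$ over the uniform distribution on $[0,1]$ satisfies $q\ge c\sqrt d$. -/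

import Mathlib

open MeasureTheory
open scoped ENNReal unitInterval

/-- The distance `dist_D(f, P) = inf_{g ∈ P} Pr_{x ∼ D}[f x ≠ g x]` of a Boolean function `f` to a
property (a set of Boolean functions) `P`, with respect to the distribution `D`. -/
noncomputable def distToProperty {X : Type*} [MeasurableSpace X] (D : Measure X)
    (P : Set (X → Bool)) (f : X → Bool) : ℝ≥0∞ :=
  ⨅ g ∈ P, D {x | f x ≠ g x}

/-- A randomized algorithm that receives `s` unlabeled sample points of `X` and makes `q` (possibly
adaptive) label queries, each to one of the sample points, and then accepts (`true`) or rejects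
(`false`). The space `Ω` with the probability measure `ν` is its internal randomness. The `i`-th
query is the index of a sample point; it may depend on the internal randomness, on the
whole unlabeled sample, and on the list of the answers received so far. -/
structure ActiveTester (X : Type*) [MeasurableSpace X] (s q : ℕ) where
  Ω : Type
  [measurableSpace : MeasurableSpace Ω]
  ν : Measure Ω
  [isProbabilityMeasure : IsProbabilityMeasure ν]
  query : Fin q → Ω → (Fin s → X) → List Bool → Fin s
  decision : Ω → (Fin s → X) → List Bool → Bool
  measurable_query : ∀ (i : Fin q) (ans : List Bool),
    Measurable fun p : Ω × (Fin s → X) => query i p.1 p.2 ans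
  measurable_decision : ∀ ans : List Bool,
    Measurable fun p : Ω × (Fin s → X) => decision p.1 p.2 ans

attribute [instance] ActiveTester.measurableSpace ActiveTester.isProbabilityMeasure

namespace ActiveTester

/-- The list of the answers to the `q` queries, in order, when the labels are given by `f`. -/
def answers {X : Type*} [MeasurableSpace X] {s q : ℕ} (A : ActiveTester X s q) (f : X → Bool)
    (ω : A.Ω) (x : Fin s → X) : List Bool :=
  (List.finRange q).foldl (fun ans i => ans ++ [f (x (A.query i ω x ans))]) []

/-- The decision of the algorithm on the function `f`. -/
def run {X : Type*} [MeasurableSpace X] {s q : ℕ} (A : ActiveTester X s q) (f : X → Bool)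
    (ω : A.Ω) (x : Fin s → X) : Bool :=
  A.decision ω x (A.answers f ω x)

/-- `A` is an `s`-sample, `q`-query `ε`-tester for `P` over `D`: on a sample of `s` independent
draws from `D` it accepts with probability at least `2/3` when `f ∈ P`, and rejects with
probability at least `2/3` when `dist_D(f, P) ≥ ε`. -/
def IsTester {X : Type*} [MeasurableSpace X] {s q : ℕ} (A : ActiveTester X s q)
    (P : Set (X → Bool)) (D : Measure X) (ε : ℝ) : Prop :=
  ∀ f : X → Bool, Measurable f →
    (f ∈ P →
      2 / 3 ≤ (A.ν.prod (Measure.pi fun _ : Fin s => D)) {p | A.run f p.1 p.2 = true}) ∧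
    (ENNReal.ofReal ε ≤ distToProperty D P f →
      2 / 3 ≤ (A.ν.prod (Measure.pi fun _ : Fin s => D)) {p | A.run f p.1 p.2 = false})

end ActiveTester

/-- A randomized algorithm that receives `q` sample points of `X` together with their labels, and
then accepts (`true`) or rejects (`false`). -/
structure PassiveTester (X : Type*) [MeasurableSpace X] (q : ℕ) where
  Ω : Type
  [measurableSpace : MeasurableSpace Ω]
  ν : Measure Ω
  [isProbabilityMeasure : IsProbabilityMeasure ν]
  decision : Ω → (Fin q → X) → (Fin q → Bool) → Bool
  measurable_decision : ∀ labels : Fin q → Bool,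
    Measurable fun p : Ω × (Fin q → X) => decision p.1 p.2 labels

attribute [instance] PassiveTester.measurableSpace PassiveTester.isProbabilityMeasure

namespace PassiveTester

/-- The decision of the algorithm on the function `f`. -/
def run {X : Type*} [MeasurableSpace X] {q : ℕ} (A : PassiveTester X q) (f : X → Bool)
    (ω : A.Ω) (x : Fin q → X) : Bool :=
  A.decision ω x fun i => f (x i)

/-- `A` is a `q`-query passive `ε`-tester for `P` over `D`. -/
def IsTester {X : Type*} [MeasurableSpace X] {q : ℕ} (A : PassiveTester X q)
    (P : Set (X → Bool)) (D : Measure X) (ε : ℝ) : Prop :=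
  ∀ f : X → Bool, Measurable f →
    (f ∈ P →
      2 / 3 ≤ (A.ν.prod (Measure.pi fun _ : Fin q => D)) {p | A.run f p.1 p.2 = true}) ∧
    (ENNReal.ofReal ε ≤ distToProperty D P f →
      2 / 3 ≤ (A.ν.prod (Measure.pi fun _ : Fin q => D)) {p | A.run f p.1 p.2 = false})

end PassiveTester

/-- The unions of `d` intervals: the functions `f : [0,1] → {0,1}` for which there are at most `d`
non-overlapping intervals `[ℓ i, u i]` such that `f x = 1` iff `ℓ i ≤ x ≤ u i` for some `i`. -/
def unionsOfIntervals (d : ℕ) : Set (I → Bool) :=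
  {f | ∃ k ≤ d, ∃ ℓ u : Fin k → I, (∀ i, ℓ i ≤ u i) ∧
    (Pairwise fun i j => Disjoint (Set.Icc (ℓ i) (u i)) (Set.Icc (ℓ j) (u j))) ∧
    ∀ x, f x = true ↔ ∃ i, ℓ i ≤ x ∧ x ≤ u i}

/-! For a subset `S` of the line and a step `t`, the ascents are the points of `S` whose translate
by `-t` is outside `S`. If `S` is a union of `d` intervals they have measure at most `d * t`, so
their integral over `0 < t ≤ δ` is at most `d * δ ^ 2 / 2`. The converse is robust
(`exists_close_of_upSteps_le`): if the integral is only slightly larger, averaging over the mesh and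
offset of a grid yields a grid on which `S` has few ascents and rounding changes `S` little. The
rounded set consists of slightly more than `d` intervals, and dropping light ones is cheap. With `δ
= ε ^ 2 / (64 * d)`, functions at distance `ε` exceed the bound by a factor `1 + ε / 4`
(`le_ascentRate_of_far`).

The integral is the mean of a kernel on pairs of uniform points that vanishes unless the points are
close. It is estimated from bipartite batches with sides of size `b` of order `√d / ε`. A batch has
boundedly many close pairs on average, so order `1 / ε ^ 4` batches suffice for Chebyshev's
inequality, and only end points of close pairs need labels (`exists_isReliable`). The passive tester
is the same rule with all labels revealed.

For an unknown distribution, the uniform tester is run on `f` composed with the quantile function of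
a large sample. Its queries are then labels of sample points. Monotone composition preserves unions
of `d` intervals, though not closedness, and uniform convergence on initial segments shows that
distance `ε` stays at least `ε / 2` (`far_comp_sampleQuantile`).

For the lower bound, random unions of block middles are compared with finely alternating patterns in
the same middles. The two look alike unless two samples hit the same middle, which needs order `√d`
samples (`sqrt_le_of_passive_isTester`). -/

section Preliminaries

/-! ### Basic facts on unions of intervals, measurability and independent coordinates. -/

theorem mem_unionsOfIntervals_of_fintype {d : ℕ} {ι : Type*} [Fintype ι]
    (hι : Fintype.card ι ≤ d) (ℓ u : ι → I) (hle : ∀ i, ℓ i ≤ u i)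
    (hdisj : Pairwise fun i j => Disjoint (Set.Icc (ℓ i) (u i)) (Set.Icc (ℓ j) (u j)))
    {f : I → Bool} (hf : ∀ x, f x = true ↔ ∃ i, ℓ i ≤ x ∧ x ≤ u i) :
    f ∈ unionsOfIntervals d := by
  let e := (Fintype.equivFin ι).symm
  refine ⟨Fintype.card ι, hι, ℓ ∘ e, u ∘ e, fun i => hle _, fun i j hij =>
    hdisj (e.injective.ne hij), fun x => ?_⟩
  rw [hf, ← e.exists_congr_right]
  rfl

/-- Measurability may be checked with a discrete parameter frozen; this serves labels and indices
that themselves depend on the sample. -/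
theorem measurable_of_finite_param {α β T : Type*} [MeasurableSpace α] [MeasurableSpace β]
    [MeasurableSpace T] [Countable T] [MeasurableSingletonClass T] {g : α → T} {F : T → α → β}
    (hg : Measurable g) (hF : ∀ t, Measurable (F t)) : Measurable fun a => F (g a) a := by
  have : Measurable fun p : α × T => F p.2 p.1 :=
    measurable_from_prod_countable_left fun t => hF t
  exact this.comp (measurable_id.prodMk hg)

theorem measurePreserving_eval_pair {ι X : Type*} [Fintype ι] [MeasurableSpace X]
    (D : Measure X) [IsProbabilityMeasure D] {i j : ι} (hij : i ≠ j) :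
    MeasurePreserving (fun x : ι → X => (x i, x j)) (Measure.pi fun _ => D) (D.prod D) := by
  have h := ProbabilityTheory.iIndepFun_pi (μ := fun _ : ι => D) (X := fun _ x => x)
    fun i => aemeasurable_id
  have h2 := (ProbabilityTheory.indepFun_iff_map_prod_eq_prod_map_map
    (measurable_pi_apply i).aemeasurable (measurable_pi_apply j).aemeasurable).1 (h.indepFun hij)
  refine ⟨by fun_prop, ?_⟩
  have e : ∀ i, Measure.map (fun x : ι → X => x i) (Measure.pi fun _ => D) = D :=
    fun i => (measurePreserving_eval (fun _ : ι => D) i).map_eq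
  rw [e, e] at h2
  exact h2

theorem PassiveTester.measurable_run {X : Type*} [MeasurableSpace X] {q : ℕ}
    (A : PassiveTester X q) {f : X → Bool} (hf : Measurable f) :
    Measurable fun p : A.Ω × (Fin q → X) => A.run f p.1 p.2 := by
  refine measurable_of_finite_param (g := fun p : A.Ω × (Fin q → X) => fun i => f (p.2 i))
    (F := fun l p => A.decision p.1 p.2 l) (by fun_prop) fun l => A.measurable_decision l

theorem measurable_of_mem_unionsOfIntervals {d : ℕ} {g : I → Bool} (hg : g ∈ unionsOfIntervals d) :
    Measurable g := by
  obtain ⟨k, -, ℓ, u, -, -, hg⟩ := hg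
  refine measurable_to_bool ?_
  have : g ⁻¹' {true} = ⋃ i : Fin k, Set.Icc (ℓ i) (u i) := by
    ext x; simp [hg]
  rw [this]
  exact MeasurableSet.iUnion fun i => measurableSet_Icc

end Preliminaries

/-! ### The lower bound for passive testers. -/

section LowerBound

/-- The closed middle half of the `k`-th of `d` equal blocks of the unit interval. -/
def middle (d k : ℕ) : Set I := {x | 16 * k + 4 ≤ 16 * d * (x : ℝ) ∧ 16 * d * (x : ℝ) ≤ 16 * k + 12}

open Classical in
/-- The middle halves of the blocks selected by `y`. -/
noncomputable def selectedMiddles {d : ℕ} (y : Fin d → Bool) (x : I) : Bool :=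
  decide (∃ k : Fin d, x ∈ middle d k ∧ y k = true)

/-- The parity of the index of the cell that contains `x`, for `16 * d` equal cells. -/
noncomputable def cellParity (d : ℕ) (x : I) : Bool := decide (⌊16 * d * (x : ℝ)⌋₊ % 2 = 1)

open Classical in
/-- In the middle half of each block, the cells whose parity differs from that selected by `z`. -/
noncomputable def alternatingMiddles {d : ℕ} (z : Fin d → Bool) (x : I) : Bool :=
  decide (∃ k : Fin d, x ∈ middle d k ∧ xor (z k) (cellParity d x) = true)

theorem measurableSet_middle (d k : ℕ) : MeasurableSet (middle d k) := by
  unfold middle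
  measurability

theorem middle_inj {d k l : ℕ} {x : I} (hk : x ∈ middle d k) (hl : x ∈ middle d l) : k = l := by
  obtain ⟨h1, h2⟩ := hk
  obtain ⟨h3, h4⟩ := hl
  have h5 : (k : ℝ) < l + 1 := by linarith
  have h6 : (l : ℝ) < k + 1 := by linarith
  norm_cast at h5 h6
  omega

theorem measurable_cellParity (d : ℕ) : Measurable (cellParity d) := by
  have h : Measurable fun x : I => ⌊16 * d * (x : ℝ)⌋₊ := by fun_prop
  exact (measurable_of_countable fun n : ℕ => decide (n % 2 = 1)).comp h

theorem measurable_selectedMiddles {d : ℕ} (y : Fin d → Bool) : Measurable (selectedMiddles y) := by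
  refine measurable_to_bool ?_
  have : selectedMiddles y ⁻¹' {true} = ⋃ k : Fin d, middle d k ∩ {_x | y k = true} := by
    ext x; simp [selectedMiddles]
  rw [this]
  exact MeasurableSet.iUnion fun k => (measurableSet_middle d k).inter (by simp)

theorem measurable_alternatingMiddles {d : ℕ} (z : Fin d → Bool) :
    Measurable (alternatingMiddles z) := by
  refine measurable_to_bool ?_
  have : alternatingMiddles z ⁻¹' {true} =
      ⋃ k : Fin d, middle d k ∩ {x | xor (z k) (cellParity d x) = true} := by
    ext x; simp [alternatingMiddles]
  rw [this]
  refine MeasurableSet.iUnion fun k => (measurableSet_middle d k).inter ?_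
  exact (measurable_of_countable fun b : Bool => xor (z k) b).comp (measurable_cellParity d)
    (measurableSet_singleton true)

theorem volume_setOf_mul_mem_Icc {c a b : ℝ} (hc : 0 < c) (ha : 0 ≤ a) (hb : b ≤ c) :
    volume {x : I | a ≤ c * x ∧ c * x ≤ b} = ENNReal.ofReal ((b - a) / c) := by
  have : Subtype.val '' {x : I | a ≤ c * x ∧ c * x ≤ b} = Set.Icc (a / c) (b / c) := by
    ext x
    simp only [Set.mem_image, Set.mem_ofPred_eq, Set.mem_Icc, div_le_iff₀ hc, le_div_iff₀ hc]
    constructor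
    · rintro ⟨x, ⟨h1, h2⟩, rfl⟩
      constructor <;> linarith
    · rintro ⟨h1, h2⟩
      refine ⟨⟨x, ?_, ?_⟩, ⟨?_, ?_⟩, rfl⟩ <;> first | linarith | nlinarith
  rw [unitInterval.volume_apply, this, Real.volume_Icc, sub_div]

theorem volume_setOf_mul_mem_Ico {c a b : ℝ} (hc : 0 < c) (ha : 0 ≤ a) (hb : b ≤ c) :
    volume {x : I | a ≤ c * x ∧ c * x < b} = ENNReal.ofReal ((b - a) / c) := by
  have : Subtype.val '' {x : I | a ≤ c * x ∧ c * x < b} = Set.Ico (a / c) (b / c) := by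
    ext x
    simp only [Set.mem_image, Set.mem_ofPred_eq, Set.mem_Ico, div_le_iff₀ hc, lt_div_iff₀ hc]
    constructor
    · rintro ⟨x, ⟨h1, h2⟩, rfl⟩
      constructor <;> linarith
    · rintro ⟨h1, h2⟩
      refine ⟨⟨x, ?_, ?_⟩, ⟨?_, ?_⟩, rfl⟩ <;> first | linarith | nlinarith
  rw [unitInterval.volume_apply, this, Real.volume_Ico, sub_div]

theorem volume_middle {d k : ℕ} (hk : k < d) : volume (middle d k) = ENNReal.ofReal (1 / (2 * d)) := by
  have hd : (0 : ℝ) < d := by exact_mod_cast (by omega : 0 < d)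
  have hkd : (k : ℝ) + 1 ≤ d := by exact_mod_cast hk
  unfold middle
  rw [volume_setOf_mul_mem_Icc (by positivity) (by positivity) (by linarith)]
  congr 1
  field_simp
  ring

theorem selectedMiddles_mem {d : ℕ} (y : Fin d → Bool) :
    selectedMiddles y ∈ unionsOfIntervals d := by
  have key : ∀ k : Fin d, (0:ℝ) < d ∧ (k : ℝ) + 1 ≤ d := fun k => by
    have h : ((k : ℕ) : ℝ) + 1 ≤ d := by exact_mod_cast k.2
    exact ⟨by have : (0:ℝ) ≤ ((k : ℕ) : ℝ) := by positivity
              linarith, h⟩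
  let ℓ : {k : Fin d // y k = true} → I := fun k => ⟨(16 * (k : Fin d) + 4) / (16 * d), by
    have := key k
    constructor
    · positivity
    · rw [div_le_one (by linarith)]; linarith⟩
  let u : {k : Fin d // y k = true} → I := fun k => ⟨(16 * (k : Fin d) + 12) / (16 * d), by
    have := key k
    constructor
    · positivity
    · rw [div_le_one (by linarith)]; linarith⟩
  have hmid : ∀ k : {k : Fin d // y k = true}, ∀ x, ℓ k ≤ x ∧ x ≤ u k ↔ x ∈ middle d (k : Fin d) := by
    intro k x
    have := key k
    simp only [ℓ, u, ← Subtype.coe_le_coe, middle, Set.mem_ofPred_eq]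
    rw [div_le_iff₀ (by linarith), le_div_iff₀ (by linarith), mul_comm (x : ℝ)]
  refine mem_unionsOfIntervals_of_fintype (ι := {k : Fin d // y k = true})
    ((Fintype.card_subtype_le _).trans (by simp)) ℓ u ?_ ?_ ?_
  · intro k
    have := key k
    simp only [ℓ, u, ← Subtype.coe_le_coe]
    gcongr
    norm_num
  · intro i j hij
    rw [Set.disjoint_left]
    intro x hi hj
    exact hij (Subtype.ext (Fin.ext (middle_inj ((hmid i x).1 hi) ((hmid j x).1 hj))))
  · intro x
    simp only [hmid, selectedMiddles, decide_eq_true_eq, Subtype.exists, exists_prop]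
    exact exists_congr fun k => and_comm

-- The middle halves split into `4 * d` regions of two neighbouring cells. At most `2 * d` regions
-- contain an end point of the competitor `g`. On any other region `g` is constant while the
-- alternating function takes both values, which costs a cell of measure `1 / (16 * d)`.
set_option maxHeartbeats 1000000 in
theorem alternatingMiddles_far {d : ℕ} (hd : 1 ≤ d) (z : Fin d → Bool) :
    ENNReal.ofReal (1 / 8) ≤ distToProperty volume (unionsOfIntervals d) (alternatingMiddles z) := by
  refine le_iInf₂ fun g hg => ?_
  have hgP := hg
  obtain ⟨k, hk, ℓ, u, hle, -, hg⟩ := hg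
  have hd0 : (0 : ℝ) < d := by exact_mod_cast hd
  let base : Fin d × Fin 4 → ℕ := fun j => 16 * j.1 + 4 + 2 * j.2
  let cell : I → ℕ := fun x => ⌊16 * d * (x : ℝ)⌋₊
  have hcell : ∀ (x : I) (n : ℕ), cell x = n ↔ (n : ℝ) ≤ 16 * d * (x : ℝ) ∧ 16 * d * (x : ℝ) < n + 1 :=
    fun x n => Nat.floor_eq_iff (by have := x.2.1; positivity)
  let region : Fin d × Fin 4 → Set I := fun j => {x | cell x = base j ∨ cell x = base j + 1}
  have hreg : ∀ i j x, x ∈ region i → x ∈ region j → i = j := by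
    rintro ⟨i1, i2⟩ ⟨j1, j2⟩ x hi hj
    simp only [region, base, Set.mem_ofPred_eq] at hi hj
    have := i2.2
    have := j2.2
    ext <;> simp only [] <;> omega
  let E : Fin k ⊕ Fin k → I := Sum.elim ℓ u
  classical
  let hit : Finset (Fin d × Fin 4) := Finset.univ.filter fun j => ∃ e, E e ∈ region j
  have hhit : hit.card ≤ 2 * d := by
    have : ∀ j ∈ hit, ∃ e, E e ∈ region j := fun j hj => by simpa [hit] using hj
    choose φ hφ using this
    have := Fintype.card_le_of_injective (fun j : hit => φ j.1 j.2) (by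
      intro i j hij
      have h1 := hφ i.1 i.2
      have h2 := hφ j.1 j.2
      simp only [] at hij
      rw [← hij] at h2
      exact Subtype.ext (hreg _ _ _ h1 h2))
    simp only [Fintype.card_coe, Fintype.card_sum, Fintype.card_fin] at this
    omega
  have hmeas_f := measurable_alternatingMiddles z
  have hcellmeas : Measurable cell := by
    show Measurable fun x : I => ⌊16 * d * (x : ℝ)⌋₊
    fun_prop
  have hgm : Measurable g := measurable_of_mem_unionsOfIntervals hgP
  have hSm : MeasurableSet {x | alternatingMiddles z x ≠ g x} :=
    (measurableSet_eq_fun hmeas_f hgm).compl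
  have hvol : ∀ j, ∀ n, (n = base j ∨ n = base j + 1) →
      volume {x : I | cell x = n} = ENNReal.ofReal (1 / (16 * d)) := by
    intro j n hn
    have h1 : n + 1 ≤ 16 * d := by
      have := j.1.2
      have := j.2.2
      simp only [base] at hn
      omega
    simp only [hcell]
    rw [volume_setOf_mul_mem_Ico (by positivity) (by positivity) (by exact_mod_cast h1)]
    congr 1
    ring
  have hmid : ∀ j x, x ∈ region j → x ∈ middle d j.1 := by
    intro j x hx
    have h2 := j.2.2
    have hc : 16 * (j.1 : ℕ) + 4 ≤ cell x ∧ cell x + 1 ≤ 16 * (j.1 : ℕ) + 12 := by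
      simp only [region, base, Set.mem_ofPred_eq] at hx
      omega
    have h3 := (hcell x _).1 rfl
    have h4 : (16 * (j.1 : ℕ) + 4 : ℝ) ≤ cell x := by exact_mod_cast hc.1
    have h5 : (cell x : ℝ) + 1 ≤ (16 * (j.1 : ℕ) + 12 : ℝ) := by exact_mod_cast hc.2
    exact ⟨by linarith, by linarith⟩
  have hf : ∀ j x, x ∈ region j → alternatingMiddles z x = xor (z j.1) (decide (cell x % 2 = 1)) := by
    intro j x hx
    have hm := hmid j x hx
    have : (∃ k : Fin d, x ∈ middle d k ∧ xor (z k) (cellParity d x) = true) ↔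
        xor (z j.1) (cellParity d x) = true := by
      constructor
      · rintro ⟨k, h1, h2⟩
        rwa [Fin.ext (middle_inj h1 hm)] at h2
      · exact fun h => ⟨_, hm, h⟩
    simp only [alternatingMiddles, this, Bool.decide_eq_true]
    rfl
  have hconst : ∀ j ∉ hit, ∃ b, ∀ x ∈ region j, g x = b := by
    intro j hj
    simp only [hit, Finset.mem_filter, Finset.mem_univ, true_and, not_exists] at hj
    have hmono : Monotone cell := fun x y hxy => Nat.floor_mono (by
      have : (x : ℝ) ≤ y := hxy
      gcongr)
    have hsub : ∀ x ∈ region j, ∀ y ∈ region j, x ≤ y → g x = g y := by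
      intro x hx y hy hxy
      have hbetween : ∀ w, x ≤ w → w ≤ y → w ∈ region j := by
        intro w h1 h2
        have := hmono h1
        have := hmono h2
        simp only [region, Set.mem_ofPred_eq] at *
        omega
      rw [Bool.eq_iff_iff, hg, hg]
      refine exists_congr fun i => ?_
      have e1 := hj (Sum.inl i)
      have e2 := hj (Sum.inr i)
      simp only [E, Sum.elim_inl, Sum.elim_inr] at e1 e2
      constructor
      · rintro ⟨h1, h2⟩
        refine ⟨h1.trans hxy, ?_⟩
        by_contra! h3
        exact e2 (hbetween _ h2 h3.le)
      · rintro ⟨h1, h2⟩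
        refine ⟨?_, hxy.trans h2⟩
        by_contra! h3
        exact e1 (hbetween _ h3.le h1)
    by_cases hne : ∃ x0, x0 ∈ region j
    · obtain ⟨x0, hx0⟩ := hne
      refine ⟨g x0, fun x hx => ?_⟩
      rcases le_total x x0 with h | h
      · exact hsub x hx x0 hx0 h
      · exact (hsub x0 hx0 x hx h).symm
    · push Not at hne
      exact ⟨true, fun x hx => absurd hx (hne x)⟩
  have hlow : ∀ j ∉ hit, ENNReal.ofReal (1 / (16 * d)) ≤
      volume ({x | alternatingMiddles z x ≠ g x} ∩ region j) := by
    intro j hj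
    obtain ⟨b, hb⟩ := hconst j hj
    have : ∃ n, (n = base j ∨ n = base j + 1) ∧ xor (z j.1) (decide (n % 2 = 1)) ≠ b := by
      have e : base j % 2 = 0 := by simp only [base]; omega
      have e' : (base j + 1) % 2 = 1 := by omega
      by_cases h : z j.1 = b
      · refine ⟨base j + 1, Or.inr rfl, ?_⟩
        simp [e', h]
      · refine ⟨base j, Or.inl rfl, ?_⟩
        simp [e, h]
    obtain ⟨n, hn, hne⟩ := this
    rw [← hvol j n hn]
    refine measure_mono fun x hx => ?_
    have hx' : cell x = n := hx
    have hr : x ∈ region j := by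
      show cell x = base j ∨ cell x = base j + 1
      rw [hx']; exact hn
    refine ⟨?_, hr⟩
    show alternatingMiddles z x ≠ g x
    rw [hf j x hr, hb x hr, hx']
    exact hne
  have hregm : ∀ j, MeasurableSet (region j) := fun j =>
    hcellmeas (t := {n | n = base j ∨ n = base j + 1}) (MeasurableSet.of_discrete)
  have hcard : 2 * d ≤ hitᶜ.card := by
    rw [Finset.card_compl, Fintype.card_prod, Fintype.card_fin, Fintype.card_fin]
    omega
  calc ENNReal.ofReal (1 / 8) = (2 * d : ℕ) * ENNReal.ofReal (1 / (16 * d)) := by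
        rw [← ENNReal.ofReal_natCast, ← ENNReal.ofReal_mul (by positivity)]
        congr 1
        push_cast
        field_simp
        norm_num
    _ ≤ ∑ j ∈ hitᶜ, ENNReal.ofReal (1 / (16 * d)) := by
        rw [Finset.sum_const, nsmul_eq_mul]
        gcongr
    _ ≤ ∑ j ∈ hitᶜ, volume ({x | alternatingMiddles z x ≠ g x} ∩ region j) :=
        Finset.sum_le_sum fun j hj => hlow j (by simpa using hj)
    _ = volume (⋃ j ∈ hitᶜ, ({x | alternatingMiddles z x ≠ g x} ∩ region j)) := by
        rw [measure_biUnion_finset]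
        · intro i _ j _ hij
          refine Set.disjoint_left.2 fun x hx hy => hij (hreg i j x hx.2 hy.2)
        · exact fun j _ => hSm.inter (hregm j)
    _ ≤ _ := measure_mono (by
        intro x hx
        simp only [Set.mem_iUnion] at hx
        obtain ⟨j, _, h, _⟩ := hx
        exact h)

/-- Without collisions each middle half shows at most one label. Adding to each selector bit the
parity of the sampled cell is an involution that matches the two families on the sample. -/
theorem exists_perm_alternatingMiddles_eq {d q : ℕ} (x : Fin q → I)
    (hx : ∀ i j, i ≠ j → ∀ k : Fin d, ¬(x i ∈ middle d k ∧ x j ∈ middle d k)) :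
    ∃ e : Equiv.Perm (Fin d → Bool), ∀ z i,
      alternatingMiddles z (x i) = selectedMiddles (e z) (x i) := by
  classical
  let P : Fin d → Bool := fun k => decide (∃ i, x i ∈ middle d k ∧ cellParity d (x i) = true)
  have hinv : Function.Involutive fun (z : Fin d → Bool) k => xor (z k) (P k) := by
    intro z
    funext k
    simp
  refine ⟨hinv.toPerm, fun z i => ?_⟩
  simp only [alternatingMiddles, selectedMiddles, Function.Involutive.coe_toPerm]
  congr 1
  refine propext (exists_congr fun k => and_congr_right fun hk => ?_)
  have : P k = cellParity d (x i) := by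
    rw [Bool.eq_iff_iff]
    simp only [P, decide_eq_true_eq]
    constructor
    · rintro ⟨j, hj, h⟩
      by_cases hij : i = j
      · rwa [hij]
      · exact absurd ⟨hk, hj⟩ (hx i j hij k)
    · exact fun h => ⟨i, hk, h⟩
  rw [this]

/-- Union bound over `q ^ 2` index pairs and `d` blocks, with probability `(1 / (2 * d)) ^ 2` each.
-/
theorem volume_collision_le {d : ℕ} (hd : 1 ≤ d) (q : ℕ) :
    (Measure.pi fun _ : Fin q => (volume : Measure I))
      {x | ∃ i j, i ≠ j ∧ ∃ k : Fin d, x i ∈ middle d k ∧ x j ∈ middle d k} ≤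
      ENNReal.ofReal (q ^ 2 / (4 * d)) := by
  have hd0 : (0 : ℝ) < d := by exact_mod_cast hd
  set M := Measure.pi fun _ : Fin q => (volume : Measure I)
  have h1 : ∀ (p : (Fin q × Fin q) × Fin d),
      M {x | p.1.1 ≠ p.1.2 ∧ x p.1.1 ∈ middle d p.2 ∧ x p.1.2 ∈ middle d p.2} ≤
        ENNReal.ofReal ((1 / (2 * d)) ^ 2) := by
    rintro ⟨⟨i, j⟩, k⟩
    by_cases hij : i = j
    · simp [hij]
    · have := (measurePreserving_eval_pair (volume : Measure I) hij).measure_preimage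
        (((measurableSet_middle d k).prod (measurableSet_middle d k)).nullMeasurableSet)
      rw [Measure.prod_prod, volume_middle k.2, ← ENNReal.ofReal_mul (by positivity), ← sq] at this
      rw [← this]
      exact measure_mono fun x hx => hx.2
  calc M {x | ∃ i j, i ≠ j ∧ ∃ k : Fin d, x i ∈ middle d k ∧ x j ∈ middle d k}
      ≤ M (⋃ p : (Fin q × Fin q) × Fin d,
        {x | p.1.1 ≠ p.1.2 ∧ x p.1.1 ∈ middle d p.2 ∧ x p.1.2 ∈ middle d p.2}) := by
        refine measure_mono ?_
        rintro x ⟨i, j, hij, k, h1, h2⟩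
        exact Set.mem_iUnion.2 ⟨((i, j), k), hij, h1, h2⟩
    _ ≤ ∑ p : (Fin q × Fin q) × Fin d, ENNReal.ofReal ((1 / (2 * d)) ^ 2) :=
        (measure_iUnion_fintype_le _ _).trans (Finset.sum_le_sum fun p _ => h1 p)
    _ = ENNReal.ofReal (q ^ 2 / (4 * d)) := by
        rw [Finset.sum_const, nsmul_eq_mul, ← ENNReal.ofReal_natCast,
          ← ENNReal.ofReal_mul (by positivity)]
        congr 1
        simp
        field_simp
        norm_num

/-- Averaged over all selectors, the acceptance probability on the first family exceeds that on the
second by at most the collision probability. The gap between `2 / 3` and `1 / 3` thus gives `1 / 3 ≤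
q ^ 2 / (4 * d)`. -/
theorem sqrt_le_of_passive_isTester {d : ℕ} (hd : 1 ≤ d) {ε : ℝ} (hε : ε ≤ 1 / 8) {q : ℕ}
    (A : PassiveTester I q) (hA : A.IsTester (unionsOfIntervals d) (volume : Measure I) ε) :
    1 / 2 * √(d : ℝ) ≤ q := by
  classical
  have hd0 : (0 : ℝ) < d := by exact_mod_cast hd
  set M := A.ν.prod (Measure.pi fun _ : Fin q => (volume : Measure I))
  let bad : Set (Fin q → I) :=
    {x | ∃ i j, i ≠ j ∧ ∃ k : Fin d, x i ∈ middle d k ∧ x j ∈ middle d k}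
  have hbadm : MeasurableSet bad := by
    have : bad = ⋃ (i) (j) (_ : i ≠ j) (k : Fin d),
        (fun x : Fin q → I => x i) ⁻¹' middle d k ∩ (fun x => x j) ⁻¹' middle d k := by
      ext x; simp [bad]
    rw [this]
    refine MeasurableSet.iUnion fun i => MeasurableSet.iUnion fun j => MeasurableSet.iUnion fun _ =>
      MeasurableSet.iUnion fun k => ?_
    exact (measurable_pi_apply i (measurableSet_middle d k)).inter
      (measurable_pi_apply j (measurableSet_middle d k))
  let acc : (I → Bool) → Set (A.Ω × (Fin q → I)) := fun f => {p | A.run f p.1 p.2 = true}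
  have haccm : ∀ f, Measurable f → MeasurableSet (acc f) := fun f hf =>
    A.measurable_run hf (measurableSet_singleton true)
  have hyes : ∀ y : Fin d → Bool, 2 / 3 ≤ M (acc (selectedMiddles y)) := fun y =>
    (hA _ (measurable_selectedMiddles y)).1 (selectedMiddles_mem y)
  have hno : ∀ z : Fin d → Bool, M (acc (alternatingMiddles z)) ≤ 1 / 3 := fun z => by
    have h := (hA _ (measurable_alternatingMiddles z)).2
      ((ENNReal.ofReal_le_ofReal hε).trans (alternatingMiddles_far hd z))
    have hc : {p : A.Ω × (Fin q → I) | A.run (alternatingMiddles z) p.1 p.2 = false} =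
        (acc (alternatingMiddles z))ᶜ := by
      ext p; simp [acc]
    rw [hc, prob_compl_eq_one_sub (haccm _ (measurable_alternatingMiddles z))] at h
    have h1 : M (acc (alternatingMiddles z)) ≤ 1 := prob_le_one
    have h2 : (2 / 3 : ℝ≥0∞) + M (acc (alternatingMiddles z)) ≤ 1 := by
      calc _ ≤ (1 - M (acc (alternatingMiddles z))) + M (acc (alternatingMiddles z)) := by gcongr
        _ = 1 := tsub_add_cancel_of_le h1
    have h3 : (1 : ℝ≥0∞) = 2 / 3 + 1 / 3 := by
      rw [ENNReal.div_add_div_same]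
      norm_num
      rw [ENNReal.div_self] <;> simp
    rw [h3] at h2
    exact (ENNReal.add_le_add_iff_left (by finiteness)).1 h2
  let B : Set (A.Ω × (Fin q → I)) := Prod.snd ⁻¹' bad
  have hBm : MeasurableSet B := measurable_snd hbadm
  have hMB : M B ≤ ENNReal.ofReal (q ^ 2 / (4 * d)) := by
    have : M B = (Measure.pi fun _ : Fin q => (volume : Measure I)) bad :=
      measurePreserving_snd.measure_preimage hbadm.nullMeasurableSet
    rw [this]
    exact volume_collision_le hd q
  -- Off the collision event the two sums agree after reindexing, by a permutation that may depend
  -- on the sample; on it, the indicator of `B` pays for every term.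
  have hpt : ∀ p, ∑ y : Fin d → Bool, (acc (selectedMiddles y)).indicator (1 : A.Ω × (Fin q → I) → ℝ≥0∞) p ≤
      ∑ z : Fin d → Bool, ((acc (alternatingMiddles z)).indicator (1 : A.Ω × (Fin q → I) → ℝ≥0∞) p +
        B.indicator 1 p) := by
    intro p
    by_cases hp : p ∈ B
    · refine Finset.sum_le_sum fun y _ => ?_
      rw [Set.indicator_of_mem hp]
      exact (Set.indicator_le_self' (by simp) p).trans (by simp)
    · simp only [Set.indicator_of_notMem hp, add_zero]
      obtain ⟨e, he⟩ := exists_perm_alternatingMiddles_eq (d := d) p.2 (by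
        intro i j hij k hk
        exact hp ⟨i, j, hij, k, hk⟩)
      rw [← Equiv.sum_comp e fun y : Fin d → Bool => (acc (selectedMiddles y)).indicator (1 : A.Ω × (Fin q → I) → ℝ≥0∞) p]
      refine Finset.sum_le_sum fun z _ => le_of_eq ?_
      have : p ∈ acc (selectedMiddles (e z)) ↔ p ∈ acc (alternatingMiddles z) := by
        simp only [acc, Set.mem_ofPred_eq, PassiveTester.run, he]
      by_cases h : p ∈ acc (alternatingMiddles z)
      · rw [Set.indicator_of_mem h, Set.indicator_of_mem (this.2 h)]
      · rw [Set.indicator_of_notMem h, Set.indicator_of_notMem (mt this.1 h)]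
  have hint := lintegral_mono (μ := M) hpt
  have hm : ∀ z : Fin d → Bool, Measurable fun p => ((acc (alternatingMiddles z)).indicator
      (1 : A.Ω × (Fin q → I) → ℝ≥0∞) p + B.indicator 1 p) := fun z =>
    (measurable_one.indicator (haccm _ (measurable_alternatingMiddles z))).add
      (measurable_one.indicator hBm)
  rw [lintegral_finsetSum _ (fun y _ =>
      measurable_one.indicator (haccm _ (measurable_selectedMiddles y))),
    lintegral_finsetSum _ (fun y _ => hm y)] at hint
  have hz : ∀ z : Fin d → Bool, ∫⁻ p, ((acc (alternatingMiddles z)).indicator (1 : A.Ω × (Fin q → I) → ℝ≥0∞) p +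
      B.indicator 1 p) ∂M ≤ 1 / 3 + ENNReal.ofReal (q ^ 2 / (4 * d)) := by
    intro z
    rw [lintegral_add_left (measurable_one.indicator (haccm _ (measurable_alternatingMiddles z))),
      lintegral_indicator_one (haccm _ (measurable_alternatingMiddles z)),
      lintegral_indicator_one hBm]
    exact add_le_add (hno z) hMB
  have hy : ∀ y : Fin d → Bool, 2 / 3 ≤ ∫⁻ p, (acc (selectedMiddles y)).indicator (1 : A.Ω × (Fin q → I) → ℝ≥0∞) p ∂M := by
    intro y
    rw [lintegral_indicator_one (haccm _ (measurable_selectedMiddles y))]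
    exact hyes y
  have h := ((Finset.sum_le_sum fun y _ => hy y).trans hint).trans
    (Finset.sum_le_sum fun z _ => hz z)
  simp only [Finset.sum_const, nsmul_eq_mul] at h
  rw [ENNReal.mul_le_mul_iff_right (by simp) (by simp)] at h
  have h' := ENNReal.toReal_mono (by finiteness) h
  rw [ENNReal.toReal_add (by finiteness) (by finiteness),
    ENNReal.toReal_ofReal (by positivity)] at h'
  norm_num at h'
  have h4 : (1 : ℝ) / 3 ≤ q ^ 2 / (4 * d) := by linarith
  rw [le_div_iff₀ (by positivity)] at h4
  have h5 : √(d : ℝ) ≤ √((2 * q) ^ 2) := Real.sqrt_le_sqrt (by nlinarith)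
  rw [Real.sqrt_sq (by positivity)] at h5
  linarith

end LowerBound

/-! ### Ascents of a set of reals, and averaging over grids. -/

section UpSteps

/-- The translates of `(0, h]` by multiples of `h` tile the line. -/
theorem lintegral_eq_setLIntegral_tsum {h : ℝ} (hh : 0 < h) {F : ℝ → ℝ≥0∞} (hF : Measurable F) :
    ∫⁻ x, F x = ∫⁻ u in Set.Ioc 0 h, ∑' k : ℤ, F (u + k * h) := by
  have h1 : ∀ k : ℤ, ∫⁻ x in Set.Ioc (k • h) ((k + 1) • h), F x =
      ∫⁻ u in Set.Ioc 0 h, F (u + k * h) := fun k => by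
    have hp := (measurePreserving_add_right (volume : Measure ℝ) (k * h))
    have := hp.setLIntegral_comp_preimage (s := Set.Ioc (k • h) ((k + 1) • h)) measurableSet_Ioc hF
    rw [← this]
    congr 2
    ext u
    simp only [Set.mem_preimage, Set.mem_Ioc, zsmul_eq_mul]
    push_cast
    constructor <;> rintro ⟨h1, h2⟩ <;> constructor <;> linarith
  rw [lintegral_tsum fun k => (by fun_prop), ← setLIntegral_univ, ← iUnion_Ioc_zsmul hh,
    lintegral_iUnion (fun k => measurableSet_Ioc) (Set.pairwise_disjoint_Ioc_zsmul h)]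
  exact tsum_congr h1

/-- The points of `S` from which a step of length `t` to the left leaves `S`. -/
def upSteps (S : Set ℝ) (t : ℝ) : Set ℝ := {y | y ∈ S ∧ y - t ∉ S}

theorem measurableSet_upSteps_prod {S : Set ℝ} (hS : MeasurableSet S) :
    MeasurableSet {p : ℝ × ℝ | p.2 ∈ upSteps S p.1} := by
  have h1 : MeasurableSet {p : ℝ × ℝ | p.2 ∈ S} := measurable_snd hS
  have h2 : MeasurableSet {p : ℝ × ℝ | p.2 - p.1 ∈ S} := (measurable_snd.sub measurable_fst) hS
  exact h1.inter h2.compl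

theorem measurableSet_upSteps {S : Set ℝ} (hS : MeasurableSet S) (t : ℝ) :
    MeasurableSet (upSteps S t) :=
  measurable_prodMk_left (measurableSet_upSteps_prod hS)

theorem measurable_volume_upSteps {S : Set ℝ} (hS : MeasurableSet S) :
    Measurable fun t => volume (upSteps S t) :=
  measurable_measure_prodMk_left (measurableSet_upSteps_prod hS)

/-- `S` and its translate have the same finite measure, hence so do their two differences. -/
theorem volume_downSteps_eq {S : Set ℝ} (hS : MeasurableSet S) (hfin : volume S ≠ ∞) (t : ℝ) :
    volume {y | y ∉ S ∧ y - t ∈ S} = volume (upSteps S t) := by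
  set S' : Set ℝ := (fun y => y - t) ⁻¹' S
  have hS' : MeasurableSet S' := (measurable_sub_const t) hS
  have hv : volume S' = volume S :=
    (measurePreserving_sub_right volume t).measure_preimage hS.nullMeasurableSet
  have h1 := measure_inter_add_sdiff (μ := volume) S hS'
  have h2 := measure_inter_add_sdiff (μ := volume) S' hS
  rw [hv, ← h1, Set.inter_comm] at h2
  have h3 := (ENNReal.add_right_inj (measure_ne_top_of_subset Set.inter_subset_left hfin)).1 h2
  have e1 : {y | y ∉ S ∧ y - t ∈ S} = S' \ S := by ext y; exact and_comm
  rw [e1, h3]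
  rfl

theorem volume_changes_eq {S : Set ℝ} (hS : MeasurableSet S) (hfin : volume S ≠ ∞) (t : ℝ) :
    volume {y | ¬(y + t ∈ S ↔ y ∈ S)} = 2 * volume (upSteps S t) := by
  set D : Set ℝ := {y | y ∉ S ∧ y - t ∈ S}
  have hD : MeasurableSet D := hS.compl.inter ((measurable_sub_const t) hS)
  have e : {y | ¬(y + t ∈ S ↔ y ∈ S)} = (fun y => y + t) ⁻¹' (upSteps S t ∪ D) := by
    ext y
    simp only [Set.mem_preimage, Set.mem_union, upSteps, D, Set.mem_ofPred_eq, add_sub_cancel_right]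
    tauto
  rw [e, (measurePreserving_add_right volume t).measure_preimage
    ((measurableSet_upSteps hS t).union hD).nullMeasurableSet, measure_union _ hD,
    volume_downSteps_eq hS hfin, two_mul]
  rw [Set.disjoint_left]
  rintro y ⟨h1, -⟩ ⟨h2, -⟩
  exact h2 h1

/-- The number of ascents into `S` along the grid `u + ℤ h`. -/
noncomputable def gridAscents (S : Set ℝ) (h u : ℝ) : ℝ≥0∞ :=
  ∑' k : ℤ, (upSteps S h).indicator 1 (u + k * h)

/-- The measure of the points where membership in `S` differs from that of the grid point of
`u + ℤ h` to the left. -/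
noncomputable def gridError (S : Set ℝ) (h u : ℝ) : ℝ≥0∞ :=
  ∫⁻ t in Set.Ioc 0 h, ∑' k : ℤ, {y | ¬(y + t ∈ S ↔ y ∈ S)}.indicator 1 (u + k * h)

theorem measurableSet_changes_prod {S : Set ℝ} (hS : MeasurableSet S) :
    MeasurableSet {p : ℝ × ℝ | ¬(p.1 + p.2 ∈ S ↔ p.1 ∈ S)} := by
  have h1 : MeasurableSet {p : ℝ × ℝ | p.1 ∈ S} := measurable_fst hS
  have h2 : MeasurableSet {p : ℝ × ℝ | p.1 + p.2 ∈ S} := (measurable_fst.add measurable_snd) hS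
  have : {p : ℝ × ℝ | ¬(p.1 + p.2 ∈ S ↔ p.1 ∈ S)} =
      symmDiff {p : ℝ × ℝ | p.1 + p.2 ∈ S} {p : ℝ × ℝ | p.1 ∈ S} := by
    ext p
    simp only [Set.mem_symmDiff, Set.mem_ofPred_eq]
    tauto
  rw [this]
  exact h2.symmDiff h1

theorem measurable_gridError_integrand {S : Set ℝ} (hS : MeasurableSet S) (h : ℝ) :
    Measurable fun p : ℝ × ℝ =>
      ∑' k : ℤ, {y | ¬(y + p.2 ∈ S ↔ y ∈ S)}.indicator (1 : ℝ → ℝ≥0∞) (p.1 + k * h) := by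
  refine Measurable.tsum fun k => ?_
  have : Measurable fun p : ℝ × ℝ => (p.1 + k * h, p.2) := by fun_prop
  have h2 : Measurable fun p : ℝ × ℝ => {p : ℝ × ℝ | ¬(p.1 + p.2 ∈ S ↔ p.1 ∈ S)}.indicator
      (1 : ℝ × ℝ → ℝ≥0∞) (p.1 + k * h, p.2) :=
    (measurable_one.indicator (measurableSet_changes_prod hS)).comp this
  exact h2

theorem measurable_gridAscents {S : Set ℝ} (hS : MeasurableSet S) (h : ℝ) :
    Measurable (gridAscents S h) := by
  refine Measurable.tsum fun k => ?_
  exact (measurable_one.indicator (measurableSet_upSteps hS h)).comp (by fun_prop)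

theorem measurable_gridError {S : Set ℝ} (hS : MeasurableSet S) (h : ℝ) :
    Measurable (gridError S h) :=
  (measurable_gridError_integrand hS h).lintegral_prod_right'

theorem setLIntegral_gridAscents {S : Set ℝ} (hS : MeasurableSet S) {h : ℝ} (hh : 0 < h) :
    ∫⁻ u in Set.Ioc 0 h, gridAscents S h u = volume (upSteps S h) := by
  rw [← lintegral_indicator_one (measurableSet_upSteps hS h), lintegral_eq_setLIntegral_tsum hh
    (measurable_one.indicator (measurableSet_upSteps hS h))]
  rfl

/-- For fixed `t`, averaging the offset turns the sum over the grid into the measure of all points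
where a shift by `t` changes membership; ascents and descents contribute equally. -/
theorem setLIntegral_gridError {S : Set ℝ} (hS : MeasurableSet S) (hfin : volume S ≠ ∞) {h : ℝ}
    (hh : 0 < h) :
    ∫⁻ u in Set.Ioc 0 h, gridError S h u = ∫⁻ t in Set.Ioc 0 h, 2 * volume (upSteps S t) := by
  unfold gridError
  rw [lintegral_lintegral_swap (measurable_gridError_integrand hS h).aemeasurable]
  refine lintegral_congr fun t => ?_
  have hm : MeasurableSet {y | ¬(y + t ∈ S ↔ y ∈ S)} :=
    measurable_prodMk_right (measurableSet_changes_prod hS)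
  rw [← lintegral_eq_setLIntegral_tsum hh (measurable_one.indicator hm),
    lintegral_indicator_one hm, volume_changes_eq hS hfin]

/-- Two averagings. If every mesh `h ≤ δ` violated the bound by `K * h`, integrating over `h` would
contradict `haK`, as `K * h` integrates to `K * δ ^ 2 / 2`. For a good mesh, the mean over offsets
is at most `K`. Bounding a weighted sum lets a single grid control both ascents and error. -/
theorem exists_grid_le {S : Set ℝ} (hS : MeasurableSet S) (hfin : volume S ≠ ∞)
    {δ l K a d : ℝ} (hδ : 0 < δ) (hl : 0 < l) (ha : 0 ≤ a) (hd : 0 < d) (hK : 0 ≤ K)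
    (hH : ∫⁻ t in Set.Ioc 0 δ, volume (upSteps S t) ≤ ENNReal.ofReal a)
    (haK : a / d + 2 * l * δ * a < K * δ ^ 2 / 2) :
    ∃ h, 0 < h ∧ ∃ u, ENNReal.ofReal (1 / d) * gridAscents S h u +
      ENNReal.ofReal l * gridError S h u ≤ ENNReal.ofReal K := by
  have step : ∃ h ∈ Set.Ioc 0 δ, ENNReal.ofReal (1 / d) * volume (upSteps S h) +
      ENNReal.ofReal (2 * l * a) ≤ ENNReal.ofReal (K * h) := by
    by_contra! hcon
    have h1 : ∫⁻ h in Set.Ioc 0 δ, ENNReal.ofReal (K * h) ≤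
        ∫⁻ h in Set.Ioc 0 δ, (ENNReal.ofReal (1 / d) * volume (upSteps S h) +
          ENNReal.ofReal (2 * l * a)) :=
      setLIntegral_mono' measurableSet_Ioc fun h hh => (hcon h hh).le
    rw [lintegral_add_right _ measurable_const, lintegral_const_mul _
      (measurable_volume_upSteps hS), setLIntegral_const, Real.volume_Ioc,
      ← ofReal_integral_eq_lintegral_ofReal] at h1
    · rw [← intervalIntegral.integral_of_le hδ.le, intervalIntegral.integral_const_mul,
        integral_id, ← ENNReal.ofReal_mul (by positivity)] at h1
      have h2 := h1.trans (add_le_add_left (mul_le_mul_right hH _) _)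
      rw [← ENNReal.ofReal_mul (by positivity), ← ENNReal.ofReal_add (by positivity) (by positivity),
        ENNReal.ofReal_le_ofReal_iff (by positivity)] at h2
      have e : 1 / d * a + 2 * l * a * (δ - 0) = a / d + 2 * l * δ * a := by ring
      rw [e] at h2
      nlinarith
    · exact (Continuous.integrableOn_Ioc (by fun_prop))
    · refine (ae_restrict_iff' measurableSet_Ioc).2 (Filter.Eventually.of_forall fun h hh => ?_)
      have := hh.1
      simp only [Pi.zero_apply]
      positivity
  obtain ⟨h, ⟨h0, hδh⟩, hle⟩ := step
  refine ⟨h, h0, ?_⟩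
  have hint : ∫⁻ u in Set.Ioc 0 h, (ENNReal.ofReal (1 / d) * gridAscents S h u +
      ENNReal.ofReal l * gridError S h u) ≤ ENNReal.ofReal (K * h) := by
    rw [lintegral_add_left ((measurable_gridAscents hS h).const_mul _),
      lintegral_const_mul _ (measurable_gridAscents hS h),
      lintegral_const_mul _ (measurable_gridError hS h), setLIntegral_gridAscents hS h0,
      setLIntegral_gridError hS hfin h0, lintegral_const_mul _ (measurable_volume_upSteps hS)]
    refine le_trans (add_le_add_right ?_ _) hle
    have e : 2 * l * a = l * (2 * a) := by ring
    rw [e, ENNReal.ofReal_mul hl.le, ENNReal.ofReal_mul (by norm_num), ENNReal.ofReal_ofNat]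
    gcongr
    exact (lintegral_mono_set (Set.Ioc_subset_Ioc_right hδh)).trans hH
  by_contra! hcon
  have h3 : ∫⁻ u in Set.Ioc 0 h, (ENNReal.ofReal (1 / d) * gridAscents S h u +
      ENNReal.ofReal l * gridError S h u) > ∫⁻ u in Set.Ioc 0 h, ENNReal.ofReal K := by
    refine setLIntegral_strict_mono measurableSet_Ioc (by simp [h0]) ?_ ?_ ?_
    · exact ((measurable_gridAscents hS h).const_mul _).add ((measurable_gridError hS h).const_mul _)
    · rw [setLIntegral_const, Real.volume_Ioc]
      finiteness
    · exact Filter.Eventually.of_forall fun u _ => hcon u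
  rw [setLIntegral_const, Real.volume_Ioc, sub_zero, ← ENNReal.ofReal_mul hK] at h3
  exact absurd hint (not_le.2 h3)

/-- All ascents of an interval lie within `t` of its infimum. -/
theorem volume_upSteps_ordConnected_le {J : Set ℝ} (hJ : J.OrdConnected) {t : ℝ} (ht : 0 ≤ t) :
    volume (upSteps J t) ≤ ENNReal.ofReal t := by
  by_cases hne : (upSteps J t).Nonempty
  · have hlt : ∀ y ∈ upSteps J t, ∀ z ∈ J, y - t < z := by
      rintro y ⟨hy, hyt⟩ z hz
      by_contra! hzy
      exact hyt (hJ.out hz hy ⟨hzy, by linarith⟩)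
    obtain ⟨y0, hy0⟩ := hne
    have hbdd : BddBelow J := ⟨y0 - t, fun z hz => (hlt y0 hy0 z hz).le⟩
    have hsub : upSteps J t ⊆ Set.Icc (sInf J) (sInf J + t) := by
      intro y hy
      refine ⟨csInf_le hbdd hy.1, ?_⟩
      have := le_csInf ⟨y, hy.1⟩ fun z hz => (hlt y hy z hz).le
      linarith
    refine (measure_mono hsub).trans ?_
    rw [Real.volume_Icc]
    simp
  · rw [Set.not_nonempty_iff_eq_empty.1 hne]
    simp

theorem volume_upSteps_iUnion_le {d : ℕ} {J : Fin d → Set ℝ} (hJ : ∀ i, (J i).OrdConnected)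
    {t : ℝ} (ht : 0 ≤ t) : volume (upSteps (⋃ i, J i) t) ≤ ENNReal.ofReal (d * t) := by
  have hsub : upSteps (⋃ i, J i) t ⊆ ⋃ i, upSteps (J i) t := by
    rintro y ⟨hy, hyt⟩
    obtain ⟨i, hi⟩ := Set.mem_iUnion.1 hy
    exact Set.mem_iUnion.2 ⟨i, hi, fun h => hyt (Set.mem_iUnion.2 ⟨i, h⟩)⟩
  calc _ ≤ ∑ i, volume (upSteps (J i) t) :=
        (measure_mono hsub).trans (measure_iUnion_fintype_le _ _)
    _ ≤ ∑ _i : Fin d, ENNReal.ofReal t :=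
        Finset.sum_le_sum fun i _ => volume_upSteps_ordConnected_le (hJ i) ht
    _ = _ := by
        rw [Finset.sum_const, nsmul_eq_mul, ENNReal.ofReal_mul (by positivity)]
        simp

theorem setLIntegral_volume_upSteps_iUnion_le {d : ℕ} {J : Fin d → Set ℝ}
    (hJ : ∀ i, (J i).OrdConnected) {δ : ℝ} (hδ : 0 < δ) :
    ∫⁻ t in Set.Ioc 0 δ, volume (upSteps (⋃ i, J i) t) ≤ ENNReal.ofReal (d * δ ^ 2 / 2) := by
  refine (setLIntegral_mono' measurableSet_Ioc fun t ht =>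
    volume_upSteps_iUnion_le hJ ht.1.le).trans (le_of_eq ?_)
  rw [← ofReal_integral_eq_lintegral_ofReal]
  · rw [← intervalIntegral.integral_of_le hδ.le, intervalIntegral.integral_const_mul, integral_id]
    congr 1
    ring
  · exact Continuous.integrableOn_Ioc (by fun_prop)
  · refine (ae_restrict_iff' measurableSet_Ioc).2 (Filter.Eventually.of_forall fun h hh => ?_)
    have := hh.1
    simp only [Pi.zero_apply]
    positivity

end UpSteps

/-! ### Few ascents imply closeness to a union of `d` intervals. -/

section Soundness

/-- As long as more than `d` elements remain, some element weighs at most `1 / d`, because the total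
is at most `1`; it is discarded. -/
theorem Finset.exists_subset_card_le_sum_sdiff_le {α : Type*} [DecidableEq α] {d : ℕ} (hd : 1 ≤ d)
    (W : α → ℝ) (hW : ∀ a, 0 ≤ W a) (B : Finset α) (hB : ∑ a ∈ B, W a ≤ 1) :
    ∃ T ⊆ B, T.card ≤ d ∧ ∑ a ∈ B \ T, W a ≤ ((B.card - d : ℕ) : ℝ) / d := by
  have hd0 : (0 : ℝ) < d := by exact_mod_cast hd
  induction hn : B.card - d generalizing B with
  | zero =>
    refine ⟨B, subset_rfl, by omega, ?_⟩
    simp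
  | succ n ih =>
    have hne : B.Nonempty := Finset.card_pos.1 (by omega)
    have hcard : (d : ℝ) ≤ B.card := by exact_mod_cast (by omega : d ≤ B.card)
    obtain ⟨a, ha, hle⟩ : ∃ a ∈ B, W a ≤ 1 / d := by
      refine Finset.exists_le_of_sum_le hne (hB.trans ?_)
      rw [Finset.sum_const, nsmul_eq_mul, mul_one_div, le_div_iff₀ hd0]
      linarith
    have hc : (B.erase a).card = B.card - 1 := Finset.card_erase_of_mem ha
    have hsum := Finset.add_sum_erase B W ha
    obtain ⟨T, hT, hTd, hTs⟩ := ih (B.erase a) (by have := hW a; linarith) (by omega)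
    refine ⟨T, hT.trans (Finset.erase_subset _ _), hTd, ?_⟩
    have haT : a ∉ T := fun h => by simpa using hT h
    have e : B \ T = insert a (B.erase a \ T) := by
      ext b
      by_cases hb : b = a
      · subst hb; simp [ha, haT]
      · simp [hb]
    rw [e, Finset.sum_insert (by simp)]
    push_cast
    rw [add_div]
    linarith

/-- The union of the grid cells `(u + k h, u + (k + 1) h]` whose left end point is in `S`. -/
def gridSet (S : Set ℝ) (h u : ℝ) : Set ℝ :=
  ⋃ k ∈ {k : ℤ | u + k * h ∈ S}, Set.Ioc (u + k * h) (u + (k + 1) * h)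

theorem mem_cell_unique {h u x : ℝ} (hh : 0 < h) {k l : ℤ} (hk1 : u + k * h < x)
    (hk2 : x ≤ u + (k + 1) * h) (hl1 : u + l * h < x) (hl2 : x ≤ u + (l + 1) * h) : k = l := by
  have h1 : (k : ℝ) < l + 1 := lt_of_mul_lt_mul_right (by linarith) hh.le
  have h2 : (l : ℝ) < k + 1 := lt_of_mul_lt_mul_right (by linarith) hh.le
  norm_cast at h1 h2
  omega

theorem mem_gridSet_iff {S : Set ℝ} {h u x : ℝ} (hh : 0 < h) {k : ℤ} (h1 : u + k * h < x)
    (h2 : x ≤ u + (k + 1) * h) : x ∈ gridSet S h u ↔ u + k * h ∈ S := by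
  simp only [gridSet, Set.mem_iUnion, Set.mem_Ioc, Set.mem_ofPred_eq]
  constructor
  · rintro ⟨l, hl, h3, h4⟩
    rwa [mem_cell_unique hh h1 h2 h3 h4]
  · exact fun hk => ⟨k, hk, h1, h2⟩

theorem measurableSet_gridSet (S : Set ℝ) (h u : ℝ) : MeasurableSet (gridSet S h u) :=
  MeasurableSet.iUnion fun _ => MeasurableSet.iUnion fun _ => measurableSet_Ioc

/-- A point `u + k * h + t` with `0 < t ≤ h` is rounded to `u + k * h`; the error integral separates
into `k` and `t`. -/
theorem volume_symmDiff_gridSet {S : Set ℝ} (hS : MeasurableSet S) {h : ℝ} (hh : 0 < h) (u : ℝ) :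
    volume (symmDiff S (gridSet S h u)) = gridError S h u := by
  have hm := hS.symmDiff (measurableSet_gridSet S h u)
  rw [← lintegral_indicator_one hm, ← lintegral_add_right_eq_self _ u,
    lintegral_eq_setLIntegral_tsum hh
      (F := fun x => (symmDiff S (gridSet S h u)).indicator 1 (x + u))
      ((measurable_one.indicator hm).comp (measurable_add_const u))]
  unfold gridError
  refine setLIntegral_congr_fun measurableSet_Ioc fun t ht => tsum_congr fun k => ?_
  have h1 : t + k * h + u ∈ symmDiff S (gridSet S h u) ↔
      u + k * h ∈ {y | ¬(y + t ∈ S ↔ y ∈ S)} := by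
    have e : t + k * h + u = u + k * h + t := by ring
    rw [Set.mem_symmDiff, mem_gridSet_iff (k := k) hh (by linarith [ht.1]) (by linarith [ht.2]), e,
      Set.mem_ofPred_eq]
    tauto
  by_cases hc : u + k * h ∈ {y | ¬(y + t ∈ S ↔ y ∈ S)}
  · rw [Set.indicator_of_mem hc, Set.indicator_of_mem (h1.2 hc)]
    rfl
  · rw [Set.indicator_of_notMem hc, Set.indicator_of_notMem (mt h1.1 hc)]

/-- The set where a Boolean function on the unit interval is true, as a set of reals. -/
def trueSet (f : I → Bool) : Set ℝ := Subtype.val '' {x | f x = true}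

theorem trueSet_subset (f : I → Bool) : trueSet f ⊆ Set.Icc 0 1 := by
  rintro _ ⟨x, -, rfl⟩
  exact x.2

theorem coe_mem_trueSet {f : I → Bool} {x : I} : (x : ℝ) ∈ trueSet f ↔ f x = true :=
  Subtype.val_injective.mem_set_image

theorem measurableSet_trueSet {f : I → Bool} (hf : Measurable f) : MeasurableSet (trueSet f) :=
  measurableSet_Icc.subtype_image (hf (measurableSet_singleton true))

theorem volume_trueSet_ne_top (f : I → Bool) : volume (trueSet f) ≠ ∞ :=
  measure_ne_top_of_subset (trueSet_subset f) (by simp)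

/-- Each maximal run of grid points in the set gives one interval of the rounded set and one ascent.
At most `d` runs are kept and the others have total length at most `(r - d) / d`. Making the kept
intervals closed only changes values at grid points, a null set. -/
theorem exists_close_of_grid {f : I → Bool} {d : ℕ} (hd : 1 ≤ d) {h : ℝ} (hh : 0 < h) (u : ℝ) :
    ∃ g ∈ unionsOfIntervals d, ∃ r : ℕ, (r : ℝ≥0∞) ≤ gridAscents (trueSet f) h u ∧
      volume {x | f x ≠ g x} ≤ volume (symmDiff (trueSet f) (gridSet (trueSet f) h u)) +
        ENNReal.ofReal (((r - d : ℕ) : ℝ) / d) := by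
  classical
  set S := trueSet f with hSdef
  set p : ℤ → ℝ := fun k => u + k * h with hp
  have hpmono : StrictMono p := fun a b hab => by
    have : (a : ℝ) < b := by exact_mod_cast hab
    simp only [hp]
    nlinarith
  -- Boundedness makes every run finite and leaves finitely many ascents.
  have hbound : ∀ k, p k ∈ S → ⌈-u / h⌉ ≤ k ∧ k ≤ ⌊(1 - u) / h⌋ := by
    intro k hk
    have := trueSet_subset f hk
    simp only [hp, Set.mem_Icc] at this
    rw [Int.ceil_le, Int.le_floor, div_le_iff₀ hh, le_div_iff₀ hh]
    constructor <;> linarith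
  have hexU : ∀ a : ℤ, ∃ n : ℕ, p (a + n) ∉ S := by
    intro a
    refine ⟨(⌊(1 - u) / h⌋ + 1 - a).toNat, fun hc => ?_⟩
    have := (hbound _ hc).2
    omega
  have hexD : ∀ a : ℤ, ∃ n : ℕ, p (a - n) ∉ S := by
    intro a
    refine ⟨(a + 1 - ⌈-u / h⌉).toNat, fun hc => ?_⟩
    have := (hbound _ hc).1
    omega
  -- The first index from `a` on whose grid point is outside `S`.
  let e : ℤ → ℤ := fun a => a + Nat.find (hexU a)
  have he1 : ∀ a, p (e a) ∉ S := fun a => Nat.find_spec (hexU a)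
  have he2 : ∀ a k, a ≤ k → k < e a → p k ∈ S := by
    intro a k h1 h2
    by_contra hk
    have := Nat.find_min (hexU a) (m := (k - a).toNat) (by simp only [e] at h2; omega)
    apply this
    rwa [show a + ((k - a).toNat : ℤ) = k by omega]
  have he0 : ∀ a, a ≤ e a := fun a => by simp only [e]; omega
  let B : Finset ℤ := (Finset.Icc ⌈-u / h⌉ ⌊(1 - u) / h⌋).filter fun k => p k ∈ S ∧ p (k - 1) ∉ S
  have hB : ∀ k, k ∈ B ↔ p k ∈ S ∧ p (k - 1) ∉ S := by
    intro k
    simp only [B, Finset.mem_filter, Finset.mem_Icc, and_iff_right_iff_imp]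
    exact fun hk => hbound k hk.1
  -- The inequality is strict because the grid point just before an ascent is outside `S`; hence
  -- even the closed intervals are disjoint.
  have hsep : ∀ a ∈ B, ∀ b ∈ B, a < b → e a < b := by
    intro a _ b hb hab
    by_contra! hc
    exact ((hB b).1 hb).2 (he2 a _ (by omega) (by omega))
  have hstart : ∀ k, p k ∈ S → ∃ a ∈ B, a ≤ k ∧ k < e a := by
    intro k hk
    have hn := Nat.find_spec (hexD k)
    have hmin := fun m hm => Nat.find_min (hexD k) (m := m) hm
    set n := Nat.find (hexD k)
    have hn0 : n ≠ 0 := by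
      intro h0
      rw [h0] at hn
      simp [hk] at hn
    have hin : ∀ j, k - n < j → j ≤ k → p j ∈ S := by
      intro j h1 h2
      have := hmin (k - j).toNat (by omega)
      rw [not_not, show k - ((k - j).toNat : ℤ) = j by omega] at this
      exact this
    refine ⟨k - n + 1, (hB _).2 ⟨hin _ (by omega) (by omega), ?_⟩, by omega, ?_⟩
    · rwa [add_sub_cancel_right]
    · by_contra! hc
      have := he0 (k - n + 1)
      exact he1 (k - n + 1) (hin _ (by omega) (by omega))
  let V : ℤ → Set ℝ := fun a => Set.Ioc (p a) (p (e a)) ∩ Set.Icc 0 1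
  have hVm : ∀ a, MeasurableSet (V a) := fun a => measurableSet_Ioc.inter measurableSet_Icc
  have hVfin : ∀ a, volume (V a) ≠ ∞ := fun a =>
    measure_ne_top_of_subset Set.inter_subset_right (by simp)
  have hVsum : ∑ a ∈ B, (volume (V a)).toReal ≤ 1 := by
    rw [← ENNReal.toReal_sum fun a _ => hVfin a, ← measure_biUnion_finset _ fun a _ => hVm a]
    · refine ENNReal.toReal_le_of_le_ofReal zero_le_one ?_
      refine (measure_mono (Set.iUnion₂_subset fun a _ => Set.inter_subset_right)).trans ?_
      rw [Real.volume_Icc, sub_zero]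
    · have key : ∀ a ∈ B, ∀ b ∈ B, a < b → Disjoint (V a) (V b) := by
        intro a ha b hb hab
        refine Set.disjoint_left.2 fun x hx hy => ?_
        have := hpmono (hsep a ha b hb hab)
        linarith [hx.1.2, hy.1.1]
      intro a ha b hb hab
      rcases lt_or_gt_of_ne hab with h1 | h1
      · exact key a ha b hb h1
      · exact (key b hb a ha h1).symm
  obtain ⟨T, hTB, hTd, hTs⟩ := Finset.exists_subset_card_le_sum_sdiff_le hd
    (fun a => (volume (V a)).toReal) (fun a => ENNReal.toReal_nonneg) B hVsum
  have hpI : ∀ a ∈ B, p a ∈ Set.Icc (0 : ℝ) 1 := fun a ha => trueSet_subset f ((hB a).1 ha).1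
  let ℓ : T → I := fun a => ⟨p a, hpI a (hTB a.2)⟩
  -- The last cell of a run may stick out beyond `1`.
  let w : T → I := fun a => ⟨min 1 (p (e a)), le_min zero_le_one
    ((hpI a (hTB a.2)).1.trans (hpmono.monotone (he0 _))), min_le_left _ _⟩
  let g : I → Bool := fun x => decide (∃ a : T, ℓ a ≤ x ∧ x ≤ w a)
  have hmem : ∀ (a : T) (x : I), (ℓ a ≤ x ∧ x ≤ w a) ↔ p a ≤ x ∧ (x : ℝ) ≤ p (e a) := by
    intro a x
    simp only [ℓ, w, ← Subtype.coe_le_coe, le_min_iff]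
    exact and_congr_right fun _ => and_iff_right x.2.2
  refine ⟨g, mem_unionsOfIntervals_of_fintype (ι := T) (by simpa using hTd) ℓ w ?_ ?_
    (fun x => by simp only [g, decide_eq_true_eq]), B.card, ?_, ?_⟩
  · intro a
    rw [← Subtype.coe_le_coe]
    exact le_min (hpI a (hTB a.2)).2 (hpmono.monotone (he0 _))
  · have key : ∀ a b : T, (a : ℤ) < b → Disjoint (Set.Icc (ℓ a) (w a)) (Set.Icc (ℓ b) (w b)) := by
      intro a b hab
      refine Set.disjoint_left.2 fun x hx hy => ?_
      have h1 := (hmem a x).1 hx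
      have h2 := (hmem b x).1 hy
      have := hpmono (hsep a (hTB a.2) b (hTB b.2) hab)
      linarith [h1.2, h2.1]
    intro a b hab
    rcases lt_or_gt_of_ne (fun h => hab (Subtype.ext h) : (a : ℤ) ≠ b) with h1 | h1
    · exact key a b h1
    · exact (key b a h1).symm
  · calc (B.card : ℝ≥0∞) = ∑ k ∈ B, (upSteps S h).indicator 1 (u + k * h) := by
          rw [Finset.sum_congr rfl (g := fun _ => 1)]
          · simp
          · intro k hk
            have h1 := ((hB k).1 hk).2
            simp only [hp] at h1
            push_cast at h1
            rw [show u + (k - 1) * h = u + k * h - h by ring] at h1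
            have h2 : u + k * h ∈ upSteps S h := ⟨((hB k).1 hk).1, h1⟩
            rw [Set.indicator_of_mem h2, Pi.one_apply]
      _ ≤ _ := ENNReal.sum_le_tsum B
  · rw [unitInterval.volume_apply]
    have hsub : Subtype.val '' {x : I | f x ≠ g x} ⊆
        (symmDiff S (gridSet S h u) ∪ ⋃ a ∈ B \ T, V a) ∪ Set.range p := by
      rintro _ ⟨x, hx, rfl⟩
      rw [Set.mem_ofPred_eq] at hx
      by_contra hcon
      simp only [Set.mem_union, not_or] at hcon
      obtain ⟨⟨h1, h2⟩, h3⟩ := hcon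
      set k := ⌊((x : ℝ) - u) / h⌋
      have hk1 : p k ≤ x := by
        have := Int.floor_le (((x : ℝ) - u) / h)
        rw [le_div_iff₀ hh] at this
        simp only [hp]
        linarith
      have hk2 : (x : ℝ) < p (k + 1) := by
        have := Int.lt_floor_add_one (((x : ℝ) - u) / h)
        rw [div_lt_iff₀ hh] at this
        simp only [hp]
        push_cast
        linarith
      have hk1' : p k < x := lt_of_le_of_ne hk1 fun h => h3 ⟨k, h⟩
      have hfk : f x = true ↔ p k ∈ S := by
        have e1 := mem_gridSet_iff (S := S) hh hk1' (by simp only [hp] at hk2; push_cast at hk2; exact hk2.le)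
        rw [Set.mem_symmDiff, e1, coe_mem_trueSet] at h1
        tauto
      have hgx : g x = true ↔ ∃ a : T, p a ≤ x ∧ (x : ℝ) ≤ p (e a) := by
        simp only [g, decide_eq_true_eq, hmem]
      by_cases hk : p k ∈ S
      · obtain ⟨a, haB, hak, hka⟩ := hstart k hk
        have hax : p a < x := lt_of_le_of_lt (hpmono.monotone hak) hk1'
        have hxa : (x : ℝ) ≤ p (e a) := hk2.le.trans (hpmono.monotone (by omega))
        by_cases haT : a ∈ T
        · exact hx ((hfk.2 hk).trans (hgx.2 ⟨⟨a, haT⟩, hax.le, hxa⟩).symm)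
        · exact h2 (Set.mem_biUnion (x := a) (by simp [haB, haT]) ⟨⟨hax, hxa⟩, x.2⟩)
      · have hfx : f x = false := by
          rw [← Bool.not_eq_true]
          exact mt hfk.1 hk
        have hgx' : g x = true := by
          rw [hfx] at hx
          simpa using hx.symm
        obtain ⟨a, h4, h5⟩ := hgx.1 hgx'
        have hxe : (x : ℝ) < p (e a) := lt_of_le_of_ne h5 fun h => h3 ⟨_, h.symm⟩
        have h6 : (a : ℤ) < k + 1 := hpmono.lt_iff_lt.1 (h4.trans_lt hk2)
        have h7 : k < e a := hpmono.lt_iff_lt.1 (hk1.trans_lt hxe)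
        exact hk (he2 a k (by omega) h7)
    have hnull : volume (Set.range p) = 0 := (Set.countable_range p).measure_zero _
    calc volume (Subtype.val '' {x : I | f x ≠ g x})
        ≤ volume (symmDiff S (gridSet S h u)) + volume (⋃ a ∈ B \ T, V a) + volume (Set.range p) :=
          (measure_mono hsub).trans ((measure_union_le _ _).trans
            (add_le_add_left (measure_union_le _ _) _))
      _ ≤ volume (symmDiff S (gridSet S h u)) + ∑ a ∈ B \ T, volume (V a) := by
          rw [hnull, add_zero]
          gcongr
          exact measure_biUnion_finset_le _ _
      _ ≤ _ := by
          gcongr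
          rw [← ENNReal.ofReal_toReal (ENNReal.sum_ne_top.2 fun a _ => hVfin a),
            ENNReal.toReal_sum fun a _ => hVfin a]
          exact ENNReal.ofReal_le_ofReal hTs

/-- The weighted bound gives rounding error at most `K / l` and at most `K * d` ascents; the surplus
intervals cost at most `K - 1`. -/
theorem exists_close_of_upSteps_le {f : I → Bool} (hf : Measurable f) {d : ℕ} (hd : 1 ≤ d)
    {δ l K a : ℝ} (hδ : 0 < δ) (hl : 0 < l) (ha : 0 ≤ a) (hK : 1 ≤ K)
    (hH : ∫⁻ t in Set.Ioc 0 δ, volume (upSteps (trueSet f) t) ≤ ENNReal.ofReal a)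
    (haK : a / d + 2 * l * δ * a < K * δ ^ 2 / 2) :
    ∃ g ∈ unionsOfIntervals d, volume {x | f x ≠ g x} ≤ ENNReal.ofReal (K / l + (K - 1)) := by
  have hd0 : (0 : ℝ) < d := by exact_mod_cast hd
  have hSm := measurableSet_trueSet hf
  obtain ⟨h, hh, u, hu⟩ := exists_grid_le hSm (volume_trueSet_ne_top f)
    hδ hl ha hd0 (zero_le_one.trans hK) hH haK
  obtain ⟨g, hg, r, hr, hv⟩ := exists_close_of_grid (f := f) hd hh u
  refine ⟨g, hg, hv.trans ?_⟩
  rw [volume_symmDiff_gridSet hSm hh]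
  rw [ENNReal.ofReal_add (by positivity) (by linarith)]
  gcongr ?_ + ENNReal.ofReal ?_
  · rw [ENNReal.ofReal_div_of_pos hl, ENNReal.le_div_iff_mul_le (by simp [hl]) (by simp), mul_comm]
    exact le_add_self.trans hu
  · have h1 : ENNReal.ofReal (1 / d) * r ≤ ENNReal.ofReal K :=
      (mul_le_mul_right hr _).trans (le_self_add.trans hu)
    rw [← ENNReal.ofReal_natCast, ← ENNReal.ofReal_mul (by positivity),
      ENNReal.ofReal_le_ofReal_iff (by linarith)] at h1
    rcases le_total d r with hdr | hdr
    · rw [Nat.cast_sub hdr, sub_div, div_self hd0.ne']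
      have : (1 : ℝ) / d * r = r / d := by ring
      linarith
    · rw [Nat.sub_eq_zero_of_le hdr]
      simpa using hK

end Soundness

/-! ### Variance of pair statistics with a sparse kernel. -/

section PairStatistic

theorem measurePreserving_eval_triple {ι X : Type*} [Fintype ι] [MeasurableSpace X]
    (D : Measure X) [IsProbabilityMeasure D] {i j k : ι} (hij : i ≠ j) (hik : i ≠ k)
    (hjk : j ≠ k) :
    MeasurePreserving (fun x : ι → X => ((x i, x j), x k)) (Measure.pi fun _ => D)
      ((D.prod D).prod D) := by
  have h := ProbabilityTheory.iIndepFun_pi (μ := fun _ : ι => D) (X := fun _ x => x)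
    fun i => aemeasurable_id
  have h2 := (ProbabilityTheory.indepFun_iff_map_prod_eq_prod_map_map
    (by fun_prop) (measurable_pi_apply k).aemeasurable).1
    (h.indepFun_prodMk (fun i => measurable_pi_apply i) i j k hik hjk)
  refine ⟨by fun_prop, ?_⟩
  have e : Measure.map (fun x : ι → X => x k) (Measure.pi fun _ => D) = D :=
    (measurePreserving_eval (fun _ : ι => D) k).map_eq
  rw [e, (measurePreserving_eval_pair D hij).map_eq] at h2
  exact h2

/-- By Fubini, integrating out the third point first contributes a factor of at most `p`. This
controls the mixed moments of two pairs with a common point. -/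
theorem integral_kernel_mul_indicator_le {X : Type*} [MeasurableSpace X] (D : Measure X)
    [IsProbabilityMeasure D] {κ : X × X → ℝ} (hκ : Measurable κ) (hκ0 : ∀ z, 0 ≤ κ z)
    {b : ℝ} (hκb : ∀ z, κ z ≤ b) {A : Set ((X × X) × X)} (hA : MeasurableSet A) {p : ℝ}
    (hp : ∀ z, D.real {w | (z, w) ∈ A} ≤ p) :
    ∫ q, κ q.1 * A.indicator 1 q ∂((D.prod D).prod D) ≤ p * ∫ z, κ z ∂(D.prod D) := by
  have hint : Integrable (fun q : (X × X) × X => κ q.1 * A.indicator (1 : (X × X) × X → ℝ) q)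
      ((D.prod D).prod D) := by
    refine Integrable.of_bound (C := b) ?_ (Filter.Eventually.of_forall fun q => ?_)
    · exact ((hκ.comp measurable_fst).mul (measurable_one.indicator hA)).aestronglyMeasurable
    · by_cases hq : q ∈ A
      · rw [Set.indicator_of_mem hq, Pi.one_apply, mul_one, Real.norm_of_nonneg (hκ0 _)]
        exact hκb _
      · rw [Set.indicator_of_notMem hq, mul_zero, norm_zero]
        exact (hκ0 q.1).trans (hκb q.1)
  have hκint : Integrable κ (D.prod D) := by
    refine Integrable.of_bound (C := b) hκ.aestronglyMeasurable
      (Filter.Eventually.of_forall fun q => ?_)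
    rw [Real.norm_of_nonneg (hκ0 _)]
    exact hκb _
  rw [integral_prod _ hint, ← integral_const_mul]
  refine integral_mono hint.integral_prod_left (hκint.const_mul p) fun z => ?_
  simp only []
  rw [integral_const_mul, mul_comm p]
  refine mul_le_mul_of_nonneg_left ?_ (hκ0 z)
  have hAz : MeasurableSet {w | (z, w) ∈ A} := measurable_prodMk_left hA
  calc ∫ w, A.indicator (1 : (X × X) × X → ℝ) (z, w) ∂D = ∫ w, {w | (z, w) ∈ A}.indicator 1 w ∂D := rfl
    _ = D.real {w | (z, w) ∈ A} := integral_indicator_one hAz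
    _ ≤ p := hp z

/-- The hypotheses on a kernel that is concentrated on a sparse set of pairs. -/
structure IsSparseKernel {X : Type*} [MeasurableSpace X] (D : Measure X) (κ : X × X → ℝ)
    (C : Set (X × X)) (p : ℝ) : Prop where
  measurable : Measurable κ
  nonneg : ∀ z, 0 ≤ κ z
  measurableSet : MeasurableSet C
  le_two : ∀ z, κ z ≤ 2 * C.indicator 1 z
  left_le : ∀ x, D.real {y | (x, y) ∈ C} ≤ p
  right_le : ∀ y, D.real {x | (x, y) ∈ C} ≤ p

variable {X : Type*} [MeasurableSpace X] {D : Measure X} {κ : X × X → ℝ} {C : Set (X × X)} {p : ℝ} {ι : Type*} [Fintype ι]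

namespace IsSparseKernel

theorem le_two' (h : IsSparseKernel D κ C p) (z : X × X) : κ z ≤ 2 := by
  refine (h.le_two z).trans ?_
  by_cases hz : z ∈ C
  · simp [hz]
  · simp [hz]

theorem memLp [IsProbabilityMeasure D] (h : IsSparseKernel D κ C p) (i j : ι) :
    MemLp (fun x : ι → X => κ (x i, x j)) 2 (Measure.pi fun _ => D) := by
  have := h.measurable
  refine MemLp.of_bound (C := 2) (Measurable.aestronglyMeasurable (by fun_prop))
    (Filter.Eventually.of_forall fun q => ?_)
  rw [Real.norm_of_nonneg (h.nonneg _)]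
  exact h.le_two' _

theorem integral_pi [IsProbabilityMeasure D] (h : IsSparseKernel D κ C p) {i j : ι} (hij : i ≠ j) :
    ∫ x : ι → X, κ (x i, x j) ∂(Measure.pi fun _ => D) = ∫ z, κ z ∂(D.prod D) := by
  rw [← (measurePreserving_eval_pair D hij).map_eq, integral_map (by fun_prop)
    h.measurable.aestronglyMeasurable]

theorem integral_sq_le [IsProbabilityMeasure D] (h : IsSparseKernel D κ C p) {i j : ι} (hij : i ≠ j) :
    ∫ x : ι → X, κ (x i, x j) * κ (x i, x j) ∂(Measure.pi fun _ => D) ≤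
      2 * ∫ z, κ z ∂(D.prod D) := by
  rw [← h.integral_pi hij, ← integral_const_mul]
  have h1 := h.memLp (D := D) i j
  refine integral_mono (h1.integrable_mul h1) ((h1.integrable (by norm_num)).const_mul 2) ?_
  intro x
  exact mul_le_mul_of_nonneg_right (h.le_two' _) (h.nonneg _)

/-- The second kernel is bounded by twice the indicator of `C`. -/
theorem integral_mul_left_le [IsProbabilityMeasure D] (h : IsSparseKernel D κ C p) {i j k : ι} (hij : i ≠ j)
    (hik : i ≠ k) (hjk : j ≠ k) :
    ∫ x : ι → X, κ (x i, x j) * κ (x i, x k) ∂(Measure.pi fun _ => D) ≤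
      2 * p * ∫ z, κ z ∂(D.prod D) := by
  have hA : MeasurableSet {q : (X × X) × X | (q.1.1, q.2) ∈ C} :=
    (by fun_prop : Measurable fun q : (X × X) × X => (q.1.1, q.2)) h.measurableSet
  have key := integral_kernel_mul_indicator_le D h.measurable h.nonneg h.le_two' hA
    (p := p) fun z => h.left_le z.1
  rw [← (measurePreserving_eval_triple D hij hik hjk).map_eq, integral_map (by fun_prop)
    (f := fun q : (X × X) × X => κ q.1 * {q : (X × X) × X | (q.1.1, q.2) ∈ C}.indicator 1 q)
    (((h.measurable.comp measurable_fst).mul (measurable_one.indicator hA)).aestronglyMeasurable)]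
    at key
  rw [mul_assoc]
  refine le_trans ?_ (mul_le_mul_of_nonneg_left key (by norm_num))
  rw [← integral_const_mul]
  have h1 := h.memLp (D := D) i j
  have h2 := h.memLp (D := D) i k
  have hm := h.measurable
  refine integral_mono (h1.integrable_mul h2) (Integrable.const_mul ?_ 2) ?_
  · refine Integrable.of_bound (C := 2) (Measurable.aestronglyMeasurable
      (Measurable.mul (by fun_prop) ((measurable_one.indicator hA).comp (by fun_prop))))
      (Filter.Eventually.of_forall fun x => ?_)
    by_cases hq : (x i, x k) ∈ C
    · rw [Set.indicator_of_mem (by exact hq), Pi.one_apply, mul_one,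
        Real.norm_of_nonneg (h.nonneg _)]
      exact h.le_two' _
    · rw [Set.indicator_of_notMem (by exact hq), mul_zero, norm_zero]
      norm_num
  · intro x
    have e : {q : (X × X) × X | (q.1.1, q.2) ∈ C}.indicator (1 : (X × X) × X → ℝ) ((x i, x j), x k) =
        C.indicator 1 (x i, x k) := rfl
    simp only [e]
    nlinarith [h.le_two (x i, x k), h.nonneg (x i, x j)]

theorem swap (h : IsSparseKernel D κ C p) :
    IsSparseKernel D (fun z => κ z.swap) (Prod.swap ⁻¹' C) p where
  measurable := h.measurable.comp measurable_swap
  nonneg _ := h.nonneg _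
  measurableSet := measurable_swap h.measurableSet
  le_two z := h.le_two z.swap
  left_le := h.right_le
  right_le := h.left_le

theorem integral_mul_right_le [IsProbabilityMeasure D] (h : IsSparseKernel D κ C p) {i j k : ι} (hij : i ≠ j)
    (hik : i ≠ k) (hjk : j ≠ k) :
    ∫ x : ι → X, κ (x j, x i) * κ (x k, x i) ∂(Measure.pi fun _ => D) ≤
      2 * p * ∫ z, κ z ∂(D.prod D) := by
  rw [← integral_prod_swap]
  exact h.swap.integral_mul_left_le hij hik hjk

/-- Pairs without common points are uncorrelated. A pair contributes at most twice the mean with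
itself, and at most `2 * p` times the mean with each of the `b` pairs having the same left point and
the `b` pairs having the same right point. No pair joins different batches, so `b` appears here and
not `m * b`. -/
theorem variance_sum_le [IsProbabilityMeasure D] (h : IsSparseKernel D κ C p) {m b : ℕ} {L R : Fin m × Fin b → ι}
    (hL : L.Injective) (hR : R.Injective) (hLR : ∀ v w, L v ≠ R w) :
    ProbabilityTheory.variance (∑ e : Fin m × Fin b × Fin b,
      fun x : ι → X => κ (x (L (e.1, e.2.1)), x (R (e.1, e.2.2)))) (Measure.pi fun _ => D) ≤
      m * b ^ 2 * (2 + 4 * b * p) * ∫ z, κ z ∂(D.prod D) := by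
  classical
  set μ := ∫ z, κ z ∂(D.prod D) with hμ
  have hμ0 : 0 ≤ μ := integral_nonneg h.nonneg
  have hp0 : 0 ≤ p := by
    have : Nonempty X := nonempty_of_isProbabilityMeasure D
    exact measureReal_nonneg.trans (h.left_le (Classical.arbitrary X))
  have hcov : ∀ e e' : Fin m × Fin b × Fin b,
      ProbabilityTheory.covariance (fun x : ι → X => κ (x (L (e.1, e.2.1)), x (R (e.1, e.2.2))))
        (fun x : ι → X => κ (x (L (e'.1, e'.2.1)), x (R (e'.1, e'.2.2)))) (Measure.pi fun _ => D)
      ≤ (if e = e' then 2 * μ else 0) +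
        ((if (e.1, e.2.1) = (e'.1, e'.2.1) then 2 * p * μ else 0) +
        (if (e.1, e.2.2) = (e'.1, e'.2.2) then 2 * p * μ else 0)) := by
    intro e e'
    have hpμ : 0 ≤ 2 * p * μ := by positivity
    have hsub : ProbabilityTheory.covariance
        (fun x : ι → X => κ (x (L (e.1, e.2.1)), x (R (e.1, e.2.2))))
        (fun x : ι → X => κ (x (L (e'.1, e'.2.1)), x (R (e'.1, e'.2.2)))) (Measure.pi fun _ => D)
        ≤ ∫ x : ι → X, κ (x (L (e.1, e.2.1)), x (R (e.1, e.2.2))) *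
          κ (x (L (e'.1, e'.2.1)), x (R (e'.1, e'.2.2))) ∂(Measure.pi fun _ => D) := by
      rw [ProbabilityTheory.covariance_eq_sub (h.memLp _ _) (h.memLp _ _),
        h.integral_pi (hLR _ _), h.integral_pi (hLR _ _)]
      have : 0 ≤ μ * μ := by positivity
      exact sub_le_self _ this
    by_cases h1 : (e.1, e.2.1) = (e'.1, e'.2.1)
    · by_cases h2 : (e.1, e.2.2) = (e'.1, e'.2.2)
      · have hee : e = e' := by
          simp only [Prod.mk.injEq] at h1 h2
          exact Prod.ext h1.1 (Prod.ext h1.2 h2.2)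
        rw [if_pos hee, if_pos h1, if_pos h2]
        refine hsub.trans ?_
        rw [hee]
        have := h.integral_sq_le (D := D) (hLR (e'.1, e'.2.1) (e'.1, e'.2.2))
        linarith
      · rw [if_pos h1, if_neg h2]
        refine hsub.trans ?_
        rw [← h1]
        have := h.integral_mul_left_le (D := D) (hLR (e.1, e.2.1) (e.1, e.2.2))
          (hLR (e.1, e.2.1) (e'.1, e'.2.2)) (hR.ne h2)
        split_ifs <;> linarith
    · by_cases h2 : (e.1, e.2.2) = (e'.1, e'.2.2)
      · rw [if_neg h1, if_pos h2]
        refine hsub.trans ?_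
        rw [← h2]
        have := h.integral_mul_right_le (D := D) (hLR (e.1, e.2.1) (e.1, e.2.2)).symm
          (hLR (e'.1, e'.2.1) (e.1, e.2.2)).symm (hL.ne h1)
        split_ifs <;> linarith
      · rw [if_neg h1, if_neg h2]
        have hind := ProbabilityTheory.iIndepFun_pi (μ := fun _ : ι => D) (X := fun _ x => x)
          fun i => aemeasurable_id
        have hind2 := hind.indepFun_prodMk_prodMk (fun i => measurable_pi_apply i)
          (L (e.1, e.2.1)) (R (e.1, e.2.2)) (L (e'.1, e'.2.1)) (R (e'.1, e'.2.2))
          (hL.ne h1) (hLR _ _) (hLR _ _).symm (hR.ne h2)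
        have hind3 := hind2.comp h.measurable h.measurable
        have := hind3.covariance_eq_zero (h.memLp _ _) (h.memLp _ _)
        refine le_trans (le_of_eq this) ?_
        split_ifs <;> linarith
  rw [ProbabilityTheory.variance_sum' fun e _ => h.memLp _ _]
  refine (Finset.sum_le_sum fun e _ => Finset.sum_le_sum fun e' _ => hcov e e').trans (le_of_eq ?_)
  have hin : ∀ e : Fin m × Fin b × Fin b, ∑ e' : Fin m × Fin b × Fin b,
      ((if e = e' then 2 * μ else 0) +
        ((if (e.1, e.2.1) = (e'.1, e'.2.1) then 2 * p * μ else 0) +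
        (if (e.1, e.2.2) = (e'.1, e'.2.2) then 2 * p * μ else 0))) =
      2 * μ + (b * (2 * p * μ) + b * (2 * p * μ)) := by
    intro e
    rw [Finset.sum_add_distrib, Finset.sum_add_distrib, Finset.sum_ite_eq, if_pos (Finset.mem_univ _)]
    congr 2
    · simp only [Fintype.sum_prod_type, Prod.mk.injEq, ite_and, Finset.sum_ite_irrel,
        Finset.sum_const_zero, Finset.sum_ite_eq, Finset.mem_univ, if_true]
      rw [Finset.sum_comm]
      simp
    · simp only [Fintype.sum_prod_type, Prod.mk.injEq, ite_and, Finset.sum_ite_irrel,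
        Finset.sum_const_zero, Finset.sum_ite_eq, Finset.mem_univ, if_true]
      simp
  rw [Finset.sum_congr rfl fun e _ => hin e, Finset.sum_const, nsmul_eq_mul]
  simp
  ring

end IsSparseKernel

end PairStatistic

/-! ### The kernel on pairs of points whose mean is the ascent integral. -/

section AscentKernel

/-- Whether `y` lies to the right of `x` at distance at most `δ`, and whether `y` is at distance
at most `δ` from the reflection of `x` at `0`. -/
noncomputable def closeness (δ : ℝ) (x y : I) : Bool × Bool :=
  (decide (x < y ∧ (y : ℝ) ≤ x + δ), decide ((x : ℝ) + y ≤ δ))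

/-- The number of ascents seen in a pair of points of closeness `r` with the labels `a` and `b`,
where all labels outside of the unit interval are `false`. -/
def ascentScore (r : Bool × Bool) (a b : Bool) : ℝ :=
  (if r.1 && (!a && b) then 1 else 0) + (if r.2 && b then 1 else 0)

/-- The ascents of `f` at scale `δ` seen in a pair of points. -/
noncomputable def ascentKernel (δ : ℝ) (f : I → Bool) (z : I × I) : ℝ :=
  ascentScore (closeness δ z.1 z.2) (f z.1) (f z.2)

/-- The pairs of points that contribute to the count of ascents at scale `δ`. -/
def closePairs (δ : ℝ) : Set (I × I) := {z | closeness δ z.1 z.2 ≠ (false, false)}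

theorem ascentScore_nonneg (r : Bool × Bool) (a b : Bool) : 0 ≤ ascentScore r a b := by
  unfold ascentScore
  split_ifs <;> norm_num

theorem ascentScore_le_two (r : Bool × Bool) (a b : Bool) : ascentScore r a b ≤ 2 := by
  unfold ascentScore
  split_ifs <;> norm_num

theorem ascentScore_false_false (a b : Bool) : ascentScore (false, false) a b = 0 := by
  simp [ascentScore]

theorem measurable_closeness (δ : ℝ) : Measurable fun z : I × I => closeness δ z.1 z.2 := by
  refine Measurable.prodMk ?_ ?_
  · refine measurable_to_bool ?_
    have : (fun z : I × I => decide (z.1 < z.2 ∧ (z.2 : ℝ) ≤ z.1 + δ)) ⁻¹' {true} =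
        {z : I × I | z.1 < z.2} ∩ {z : I × I | (z.2 : ℝ) ≤ z.1 + δ} := by
      ext z; simp
    rw [this]
    exact (measurableSet_lt measurable_fst measurable_snd).inter
      (measurableSet_le (by fun_prop) (by fun_prop))
  · refine measurable_to_bool ?_
    have : (fun z : I × I => decide ((z.1 : ℝ) + z.2 ≤ δ)) ⁻¹' {true} =
        {z : I × I | (z.1 : ℝ) + z.2 ≤ δ} := by
      ext z; simp
    rw [this]
    exact measurableSet_le (by fun_prop) (by fun_prop)

theorem measurable_ascentKernel (δ : ℝ) {f : I → Bool} (hf : Measurable f) :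
    Measurable (ascentKernel δ f) := by
  have h : Measurable fun p : (Bool × Bool) × Bool × Bool => ascentScore p.1 p.2.1 p.2.2 :=
    measurable_of_countable _
  exact h.comp ((measurable_closeness δ).prodMk
    ((hf.comp measurable_fst).prodMk (hf.comp measurable_snd)))

theorem dist_le_of_mem_closePairs {δ : ℝ} {x y : I} (h : (x, y) ∈ closePairs δ) :
    (x : ℝ) - δ ≤ y ∧ (y : ℝ) ≤ x + δ := by
  have hx := x.2.1
  have hy := y.2.1
  have h : (x < y ∧ (y : ℝ) ≤ x + δ) ∨ (x : ℝ) + y ≤ δ := by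
    by_contra hc
    rw [not_or] at hc
    exact h (Prod.ext (decide_eq_false hc.1) (decide_eq_false hc.2))
  rcases h with ⟨h1, h2⟩ | h
  · have h1' : (x : ℝ) < y := h1
    constructor <;> linarith
  · constructor <;> linarith

theorem volume_real_Icc_le {δ : ℝ} (hδ : 0 ≤ δ) (x : I) {A : Set I}
    (hA : ∀ y ∈ A, (x : ℝ) - δ ≤ y ∧ (y : ℝ) ≤ x + δ) : (volume : Measure I).real A ≤ 2 * δ := by
  refine ENNReal.toReal_le_of_le_ofReal (by positivity) ?_
  rw [unitInterval.volume_apply]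
  have : Subtype.val '' A ⊆ Set.Icc ((x : ℝ) - δ) (x + δ) := by
    rintro _ ⟨y, hy, rfl⟩
    exact hA y hy
  refine (measure_mono this).trans (le_of_eq ?_)
  rw [Real.volume_Icc]
  congr 1
  ring

theorem isSparseKernel_ascentKernel {δ : ℝ} (hδ : 0 ≤ δ) {f : I → Bool} (hf : Measurable f) :
    IsSparseKernel volume (ascentKernel δ f) (closePairs δ) (2 * δ) where
  measurable := measurable_ascentKernel δ hf
  nonneg z := ascentScore_nonneg _ _ _
  measurableSet := measurable_closeness δ (MeasurableSet.of_discrete (s := {r | r ≠ (false, false)}))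
  le_two z := by
    by_cases hz : z ∈ closePairs δ
    · rw [Set.indicator_of_mem hz]
      rw [Pi.one_apply, mul_one]
      exact ascentScore_le_two _ _ _
    · rw [Set.indicator_of_notMem hz]
      have : closeness δ z.1 z.2 = (false, false) := by simpa [closePairs] using hz
      simp [ascentKernel, this, ascentScore_false_false]
  left_le x := volume_real_Icc_le hδ x fun y hy => dist_le_of_mem_closePairs hy
  right_le y := volume_real_Icc_le hδ y fun x hx => by
    have := dist_le_of_mem_closePairs hx
    constructor <;> linarith [this.1, this.2]

theorem measurableSet_ascents_into (δ : ℝ) {f : I → Bool} (hf : Measurable f) (y : I) :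
    MeasurableSet {x : I | x < y ∧ (y : ℝ) ≤ x + δ ∧ f x = false} := by
  have h1 : MeasurableSet {x : I | (y : ℝ) ≤ x + δ} :=
    measurableSet_le (by fun_prop) (by fun_prop)
  exact measurableSet_Iio.inter (h1.inter (hf (measurableSet_singleton false)))

/-- Steps that stay in the unit interval correspond to `x = y - t`. The steps with `y < t ≤ δ` pass
`0` and always leave the set; their measure equals that of the points `x ≤ δ - y`. Reflection thus
lets a uniform `x` account exactly for the ascents at the boundary. -/
theorem volume_ascents_into {δ : ℝ} (hδ : δ ≤ 1) {f : I → Bool} (hf : Measurable f) (y : I) :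
    volume {x : I | x < y ∧ (y : ℝ) ≤ x + δ ∧ f x = false} + volume {x : I | (x : ℝ) + y ≤ δ} =
      volume {t : ℝ | t ∈ Set.Ioc 0 δ ∧ (y : ℝ) - t ∉ trueSet f} := by
  have hy := y.2
  have hS := measurableSet_trueSet hf
  have h2 : volume {x : I | (x : ℝ) + y ≤ δ} = ENNReal.ofReal (δ - y) := by
    have := volume_setOf_mul_mem_Icc (c := 1) (a := 0) (b := δ - y) one_pos le_rfl
      (by linarith [hy.1])
    rw [sub_zero, div_one] at this
    rw [← this]
    congr 1
    ext x
    simp only [Set.mem_ofPred_eq]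
    constructor
    · exact fun h => ⟨by linarith [x.2.1], by linarith⟩
    · exact fun h => by linarith [h.2]
  have h1 : volume {x : I | x < y ∧ (y : ℝ) ≤ x + δ ∧ f x = false} =
      volume ({t : ℝ | t ∈ Set.Ioc 0 δ ∧ (y : ℝ) - t ∉ trueSet f} ∩ Set.Iic (y : ℝ)) := by
    have hm := measurableSet_ascents_into δ hf y
    rw [unitInterval.volume_apply, ← (Measure.measurePreserving_sub_left volume (y : ℝ)).measure_preimage
      (measurableSet_Icc.subtype_image hm).nullMeasurableSet]
    congr 1
    ext t
    simp only [Set.mem_preimage, Set.mem_image, Set.mem_ofPred_eq, Set.mem_inter_iff, Set.mem_Ioc,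
      Set.mem_Iic]
    constructor
    · rintro ⟨x, ⟨h3, h4, h5⟩, h6⟩
      have h3' : (x : ℝ) < y := h3
      refine ⟨⟨⟨by linarith, by linarith⟩, ?_⟩, by linarith [x.2.1]⟩
      rw [← h6, coe_mem_trueSet, h5]
      simp
    · rintro ⟨⟨⟨h3, h4⟩, h5⟩, h6⟩
      refine ⟨⟨y - t, by linarith, by linarith [hy.2]⟩, ⟨?_, by simp only []; linarith, ?_⟩, rfl⟩
      · show (y : ℝ) - t < y
        linarith
      · rw [← Bool.not_eq_true, ← coe_mem_trueSet]
        exact h5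
  have h3 : volume ({t : ℝ | t ∈ Set.Ioc 0 δ ∧ (y : ℝ) - t ∉ trueSet f} \ Set.Iic (y : ℝ)) =
      ENNReal.ofReal (δ - y) := by
    rw [← Real.volume_Ioc]
    congr 1
    ext t
    simp only [Set.mem_sdiff, Set.mem_ofPred_eq, Set.mem_Ioc, Set.mem_Iic, not_le]
    constructor
    · exact fun h => ⟨h.2, h.1.1.2⟩
    · refine fun h => ⟨⟨⟨by linarith [hy.1, h.1], h.2⟩, fun hc => ?_⟩, h.1⟩
      have := (trueSet_subset f hc).1
      linarith [h.1]
  rw [h1, h2, ← h3, measure_inter_add_sdiff _ measurableSet_Iic]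

/-- Tonelli's theorem with `y` outside; for `f y = true` the inner integrals agree by
`volume_ascents_into`, otherwise both vanish. -/
theorem lintegral_ascentKernel {δ : ℝ} (hδ : δ ≤ 1) {f : I → Bool} (hf : Measurable f) :
    ∫⁻ z, ENNReal.ofReal (ascentKernel δ f z) ∂((volume : Measure I).prod volume) =
      ∫⁻ t in Set.Ioc 0 δ, volume (upSteps (trueSet f) t) := by
  have hS := measurableSet_trueSet hf
  set S := trueSet f with hSdef
  let φ : ℝ → ℝ≥0∞ := fun y => volume {t : ℝ | t ∈ Set.Ioc 0 δ ∧ y ∈ upSteps S t}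
  have hQ : MeasurableSet {p : ℝ × ℝ | p.1 ∈ Set.Ioc 0 δ ∧ p.2 ∈ upSteps S p.1} :=
    (measurable_fst measurableSet_Ioc).inter (measurableSet_upSteps_prod hS)
  have hrhs : ∫⁻ t in Set.Ioc 0 δ, volume (upSteps S t) = ∫⁻ y, φ y := by
    have e1 := Measure.prod_apply (μ := (volume : Measure ℝ)) (ν := (volume : Measure ℝ)) hQ
    have e2 := Measure.prod_apply_symm (μ := (volume : Measure ℝ)) (ν := (volume : Measure ℝ)) hQ
    rw [e1] at e2
    rw [← lintegral_indicator measurableSet_Ioc]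
    refine Eq.trans (lintegral_congr fun t => ?_) e2
    by_cases ht : t ∈ Set.Ioc 0 δ
    · rw [Set.indicator_of_mem ht]
      congr 1
      ext y
      exact (and_iff_right ht).symm
    · rw [Set.indicator_of_notMem ht]
      have : Prod.mk t ⁻¹' {p : ℝ × ℝ | p.1 ∈ Set.Ioc 0 δ ∧ p.2 ∈ upSteps S p.1} = ∅ := by
        ext y
        simp only [Set.mem_preimage, Set.mem_ofPred_eq, ht, false_and, Set.mem_empty_iff_false]
      rw [this, measure_empty]
  have hφm : Measurable φ := measurable_measure_prodMk_right hQ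
  have hφI : ∫⁻ y : I, φ y = ∫⁻ y, φ y := by
    rw [unitInterval.measurePreserving_coe.lintegral_comp hφm]
    refine setLIntegral_eq_of_support_subset ?_
    intro y hy
    by_contra hc
    apply hy
    have : {t : ℝ | t ∈ Set.Ioc 0 δ ∧ y ∈ upSteps S t} = ∅ := by
      ext t
      simp only [Set.mem_ofPred_eq, Set.mem_empty_iff_false, iff_false, not_and]
      exact fun _ h => hc (trueSet_subset f h.1)
    simp only [φ, this, measure_empty]
  rw [hrhs, ← hφI]
  rw [lintegral_prod_symm _ (measurable_ascentKernel δ hf).ennreal_ofReal.aemeasurable]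
  refine lintegral_congr fun y => ?_
  by_cases hy : f y = true
  · have hyS : (y : ℝ) ∈ S := coe_mem_trueSet.2 hy
    have e1 : φ y = volume {t : ℝ | t ∈ Set.Ioc 0 δ ∧ (y : ℝ) - t ∉ S} := by
      simp only [φ, upSteps, Set.mem_ofPred_eq, hyS, true_and]
    rw [e1, hSdef, ← volume_ascents_into hδ hf y]
    have hm1 := measurableSet_ascents_into δ hf y
    have hm2 : MeasurableSet {x : I | (x : ℝ) + y ≤ δ} :=
      measurableSet_le (by fun_prop) (by fun_prop)
    rw [← lintegral_indicator_one hm1, ← lintegral_indicator_one hm2,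
      ← lintegral_add_left (measurable_one.indicator hm1)]
    refine lintegral_congr fun x => ?_
    rw [ascentKernel, ascentScore, ENNReal.ofReal_add (by split_ifs <;> norm_num)
      (by split_ifs <;> norm_num)]
    congr 1
    · by_cases hx : x ∈ {x : I | x < y ∧ (y : ℝ) ≤ x + δ ∧ f x = false}
      · rw [Set.indicator_of_mem hx]
        obtain ⟨h1, h2, h3⟩ := hx
        simp [closeness, hy, h1, h2, h3]
      · rw [Set.indicator_of_notMem hx, if_neg, ENNReal.ofReal_zero]
        intro hc
        apply hx
        simp only [closeness, hy, Bool.and_true, Bool.and_eq_true, decide_eq_true_eq,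
          Bool.not_eq_true'] at hc
        exact ⟨hc.1.1, hc.1.2, hc.2⟩
    · by_cases hx : x ∈ {x : I | (x : ℝ) + y ≤ δ}
      · rw [Set.indicator_of_mem hx]
        have h1 : (x : ℝ) + y ≤ δ := hx
        simp [closeness, hy, h1]
      · rw [Set.indicator_of_notMem hx]
        have h1 : ¬(x : ℝ) + y ≤ δ := hx
        simp [closeness, hy, h1]
  · have e1 : φ y = 0 := by
      have : {t : ℝ | t ∈ Set.Ioc 0 δ ∧ (y : ℝ) ∈ upSteps S t} = ∅ := by
        ext t
        simp only [Set.mem_ofPred_eq, Set.mem_empty_iff_false, iff_false, not_and]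
        exact fun _ h => hy (coe_mem_trueSet.1 h.1)
      simp only [φ, this, measure_empty]
    rw [e1, ← lintegral_zero]
    refine lintegral_congr fun x => ?_
    simp [ascentKernel, ascentScore, hy]

/-- The ascent rate of `f` at scale `δ`. -/
noncomputable def ascentRate (δ : ℝ) (f : I → Bool) : ℝ :=
  ∫ z, ascentKernel δ f z ∂((volume : Measure I).prod volume)

theorem ofReal_ascentRate {δ : ℝ} (hδ0 : 0 ≤ δ) (hδ : δ ≤ 1) {f : I → Bool} (hf : Measurable f) :
    ENNReal.ofReal (ascentRate δ f) = ∫⁻ t in Set.Ioc 0 δ, volume (upSteps (trueSet f) t) := by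
  have h := isSparseKernel_ascentKernel hδ0 hf
  rw [← lintegral_ascentKernel hδ hf, ascentRate, ofReal_integral_eq_lintegral_ofReal]
  · refine Integrable.of_bound (C := 2) h.measurable.aestronglyMeasurable
      (Filter.Eventually.of_forall fun q => ?_)
    rw [Real.norm_of_nonneg (h.nonneg _)]
    exact h.le_two' _
  · exact Filter.Eventually.of_forall h.nonneg

theorem ascentRate_nonneg (δ : ℝ) (f : I → Bool) : 0 ≤ ascentRate δ f :=
  integral_nonneg fun _ => ascentScore_nonneg _ _ _

/-- The unions of `d` arbitrary intervals. -/
def unionsOfOrdConnected (d : ℕ) : Set (I → Bool) :=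
  {f | ∃ J : Fin d → Set I, (∀ i, (J i).OrdConnected) ∧ ∀ x, f x = true ↔ ∃ i, x ∈ J i}

theorem unionsOfIntervals_subset (d : ℕ) : unionsOfIntervals d ⊆ unionsOfOrdConnected d := by
  rintro f ⟨k, hk, ℓ, u, -, -, hf⟩
  refine ⟨fun i => if h : (i : ℕ) < k then Set.Icc (ℓ ⟨i, h⟩) (u ⟨i, h⟩) else ∅, fun i => ?_,
    fun x => ?_⟩
  · dsimp only
    split_ifs
    · exact Set.ordConnected_Icc
    · exact Set.ordConnected_empty
  · rw [hf]
    constructor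
    · rintro ⟨i, hi⟩
      refine ⟨⟨i, i.2.trans_le hk⟩, ?_⟩
      dsimp only
      rw [dif_pos i.2]
      exact hi
    · rintro ⟨i, hi⟩
      dsimp only at hi
      split_ifs at hi with h
      · exact ⟨⟨i, h⟩, hi⟩
      · exact hi.elim

/-- Arbitrary intervals are allowed because composition with a sample quantile function does not
keep intervals closed. -/
theorem ascentRate_le {d : ℕ} {δ : ℝ} (hδ0 : 0 < δ) (hδ : δ ≤ 1) {f : I → Bool}
    (hf : Measurable f) (hfd : f ∈ unionsOfOrdConnected d) :
    ascentRate δ f ≤ d * δ ^ 2 / 2 := by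
  obtain ⟨J, hJ, hfJ⟩ := hfd
  have hS : trueSet f = ⋃ i, Subtype.val '' (J i) := by
    rw [← Set.image_iUnion, trueSet]
    congr 1
    ext x
    simp [hfJ]
  have hJ' : ∀ i, (Subtype.val '' (J i) : Set ℝ).OrdConnected := by
    intro i
    refine ⟨?_⟩
    rintro _ ⟨a, ha, rfl⟩ _ ⟨b, hb, rfl⟩ z hz
    exact ⟨⟨z, a.2.1.trans hz.1, hz.2.trans b.2.2⟩, (hJ i).out ha hb hz, rfl⟩
  rw [← ENNReal.ofReal_le_ofReal_iff (by positivity), ofReal_ascentRate hδ0.le hδ hf, hS]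
  exact setLIntegral_volume_upSteps_iUnion_le hJ' hδ0

/-- Contrapositive of `exists_close_of_upSteps_le`. As `d * δ = ε ^ 2 / 64`, the choice `l = 4 / ε`
makes the rounding term a factor `1 + ε / 8`. Then `(1 + ε / 4) * (1 + ε / 8)` is below `K = 1 + ε /
2`, and the distance obtained, `(1 + ε / 2) * ε / 4 + ε / 2`, is below `ε`. -/
theorem le_ascentRate_of_far {d : ℕ} (hd : 1 ≤ d) {ε : ℝ} (hε : 0 < ε) (hε1 : ε ≤ 1) {f : I → Bool}
    (hf : Measurable f)
    (hfar : ENNReal.ofReal ε ≤ distToProperty volume (unionsOfIntervals d) f) :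
    (1 + ε / 4) * (d * (ε ^ 2 / (64 * d)) ^ 2 / 2) ≤ ascentRate (ε ^ 2 / (64 * d)) f := by
  have hd0 : (0 : ℝ) < d := by exact_mod_cast hd
  have hd1 : (1 : ℝ) ≤ d := by exact_mod_cast hd
  set δ : ℝ := ε ^ 2 / (64 * d) with hδdef
  have hδ0 : 0 < δ := by positivity
  have hdδ : d * δ = ε ^ 2 / 64 := by rw [hδdef]; field_simp
  have hδ1 : δ ≤ 1 := by
    rw [hδdef, div_le_one (by positivity)]
    nlinarith
  by_contra! hcon
  obtain ⟨g, hg, hv⟩ := exists_close_of_upSteps_le hf hd (l := 4 / ε) (K := 1 + ε / 2)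
    (a := (1 + ε / 4) * (d * δ ^ 2 / 2)) hδ0 (by positivity) (by positivity) (by linarith)
    (by rw [← ofReal_ascentRate hδ0.le hδ1 hf]; exact ENNReal.ofReal_le_ofReal hcon.le)
    (by
      have e : (1 + ε / 4) * (d * δ ^ 2 / 2) / d + 2 * (4 / ε) * δ * ((1 + ε / 4) * (d * δ ^ 2 / 2)) =
          (1 + ε / 4) * (1 + 8 / ε * (d * δ)) * δ ^ 2 / 2 := by
        field_simp
        ring
      rw [e, hdδ]
      have e2 : (1 + ε / 4) * (1 + 8 / ε * (ε ^ 2 / 64)) = (1 + ε / 4) * (1 + ε / 8) := by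
        field_simp
        ring
      rw [e2]
      gcongr
      nlinarith)
  have h1 : ENNReal.ofReal ε ≤ ENNReal.ofReal ((1 + ε / 2) / (4 / ε) + (1 + ε / 2 - 1)) :=
    hfar.trans ((iInf₂_le g hg).trans hv)
  have hpos : 0 ≤ (1 + ε / 2) / (4 / ε) + (1 + ε / 2 - 1) := by
    have : 0 ≤ (1 + ε / 2) / (4 / ε) := by positivity
    linarith
  rw [ENNReal.ofReal_le_ofReal_iff hpos] at h1
  have e3 : (1 + ε / 2) / (4 / ε) = (1 + ε / 2) * ε / 4 := by
    field_simp
  rw [e3] at h1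
  nlinarith

end AscentKernel

/-! ### Nonadaptive testers and their active and passive forms. -/

section QueryRules

/-- A non-adaptive tester: the indices of the sample points that are queried depend only on a
summary, with countably many values, of the internal randomness and the unlabeled sample, and the
decision depends only on this summary and on the queried labels. -/
structure QueryRule (X : Type*) [MeasurableSpace X] (s q : ℕ) where
  Ω : Type
  [measurableSpace : MeasurableSpace Ω]
  ν : Measure Ω
  [isProbabilityMeasure : IsProbabilityMeasure ν]
  T : Type
  [measurableSpaceT : MeasurableSpace T]
  [countable : Countable T]
  [measurableSingletonClass : MeasurableSingletonClass T]
  summary : Ω × (Fin s → X) → T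
  query : T → Fin q → Fin s
  decide : T → (Fin s → Bool) → Bool
  measurable_summary : Measurable summary
  decide_congr : ∀ t l l', (∀ i, l (query t i) = l' (query t i)) → decide t l = decide t l'

namespace QueryRule

attribute [instance] measurableSpace isProbabilityMeasure measurableSpaceT countable
  measurableSingletonClass

variable {X : Type*} [MeasurableSpace X] {s q : ℕ}

/-- The decision of the tester on the function `f`. -/
def verdict (R : QueryRule X s q) (f : X → Bool) (p : R.Ω × (Fin s → X)) : Bool :=
  R.decide (R.summary p) fun v => f (p.2 v)

theorem measurable_verdict (R : QueryRule X s q) {f : X → Bool} (hf : Measurable f) :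
    Measurable (R.verdict f) := by
  have h : Measurable fun r : R.T × (Fin s → Bool) => R.decide r.1 r.2 := measurable_of_countable _
  exact h.comp (R.measurable_summary.prodMk (by fun_prop))

/-- The passive tester that ignores the labels that are not queried. -/
noncomputable def toPassive (R : QueryRule X s q) : PassiveTester X s where
  Ω := R.Ω
  ν := R.ν
  decision ω x l := R.decide (R.summary (ω, x)) l
  measurable_decision l := (measurable_of_countable fun t => R.decide t l).comp R.measurable_summary

open Classical in
/-- The labels of the sample points as far as they are known from the answers to the queries. -/
noncomputable def knownLabels (R : QueryRule X s q) (t : R.T) (ans : List Bool) (v : Fin s) : Bool :=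
  if h : ∃ i, R.query t i = v then ans.getD h.choose false else false

/-- The active tester that asks all the queries of the rule. -/
noncomputable def toActive (R : QueryRule X s q) : ActiveTester X s q where
  Ω := R.Ω
  ν := R.ν
  query i ω x _ := R.query (R.summary (ω, x)) i
  decision ω x ans := R.decide (R.summary (ω, x)) (R.knownLabels (R.summary (ω, x)) ans)
  measurable_query i _ := (measurable_of_countable fun t => R.query t i).comp R.measurable_summary
  measurable_decision ans :=
    (measurable_of_countable fun t => R.decide t (R.knownLabels t ans)).comp R.measurable_summary

theorem toActive_answers (R : QueryRule X s q) (f : X → Bool) (ω : R.Ω) (x : Fin s → X) :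
    R.toActive.answers f ω x = List.ofFn fun i => f (x (R.query (R.summary (ω, x)) i)) := by
  have key : ∀ (g : Fin q → Bool) (l : List (Fin q)) (a : List Bool),
      l.foldl (fun ans i => ans ++ [g i]) a = a ++ l.map g := by
    intro g l
    induction l with
    | nil => simp
    | cons i l ih => intro a; simp [ih]
  rw [List.ofFn_eq_map]
  exact key (fun i => f (x (R.query (R.summary (ω, x)) i))) (List.finRange q) []

theorem toActive_run (R : QueryRule X s q) (f : X → Bool) (ω : R.Ω) (x : Fin s → X) :
    R.toActive.run f ω x = R.verdict f (ω, x) := by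
  refine R.decide_congr _ _ _ fun i => ?_
  have h : ∃ j, R.query (R.summary (ω, x)) j = R.query (R.summary (ω, x)) i := ⟨i, rfl⟩
  rw [knownLabels, dif_pos h, toActive_answers]
  -- The chosen index may differ from `i`, but it queries the same sample point.
  have := h.choose_spec
  simp only [List.getD_eq_getElem?_getD, List.getElem?_ofFn, Fin.is_lt, dite_true, Fin.eta,
    Option.getD_some, this]

theorem toActive_isTester (R : QueryRule X s q) {P : Set (X → Bool)} {D : Measure X} {ε : ℝ}
    (h : ∀ f : X → Bool, Measurable f →
      (f ∈ P → 2 / 3 ≤ (R.ν.prod (Measure.pi fun _ => D)) {p | R.verdict f p = true}) ∧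
      (ENNReal.ofReal ε ≤ distToProperty D P f →
        2 / 3 ≤ (R.ν.prod (Measure.pi fun _ => D)) {p | R.verdict f p = false})) :
    R.toActive.IsTester P D ε := by
  intro f hf
  have e : ∀ b, {p : R.toActive.Ω × (Fin s → X) | R.toActive.run f p.1 p.2 = b} =
      {p | R.verdict f p = b} := fun b => Set.ext fun p =>
    iff_of_eq (congrArg (· = b) (R.toActive_run f p.1 p.2))
  rw [e, e]
  exact h f hf

theorem toPassive_isTester (R : QueryRule X s q) {P : Set (X → Bool)} {D : Measure X} {ε : ℝ}
    (h : ∀ f : X → Bool, Measurable f →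
      (f ∈ P → 2 / 3 ≤ (R.ν.prod (Measure.pi fun _ => D)) {p | R.verdict f p = true}) ∧
      (ENNReal.ofReal ε ≤ distToProperty D P f →
        2 / 3 ≤ (R.ν.prod (Measure.pi fun _ => D)) {p | R.verdict f p = false})) :
    R.toPassive.IsTester P D ε := h

end QueryRule

end QueryRules

/-! ### Chebyshev and Markov bounds for the pair statistic. -/

section Concentration

namespace IsSparseKernel

variable {X : Type*} [MeasurableSpace X] {D : Measure X} {κ : X × X → ℝ} {C : Set (X × X)} {p : ℝ}
  {ι : Type*} [Fintype ι]

theorem measure_deviation_le [IsProbabilityMeasure D] (h : IsSparseKernel D κ C p) {m b : ℕ}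
    {L R : Fin m × Fin b → ι} (hL : L.Injective) (hR : R.Injective) (hLR : ∀ v w, L v ≠ R w)
    {t : ℝ} (ht : 0 < t) :
    (Measure.pi fun _ : ι => D) {x | t ≤ |∑ e : Fin m × Fin b × Fin b,
        κ (x (L (e.1, e.2.1)), x (R (e.1, e.2.2))) - m * b ^ 2 * ∫ z, κ z ∂(D.prod D)|} ≤
      ENNReal.ofReal (m * b ^ 2 * (2 + 4 * b * p) * (∫ z, κ z ∂(D.prod D)) / t ^ 2) := by
  have hmem : MemLp (∑ e : Fin m × Fin b × Fin b,
      fun x : ι → X => κ (x (L (e.1, e.2.1)), x (R (e.1, e.2.2)))) 2 (Measure.pi fun _ => D) :=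
    memLp_finsetSum' _ fun e _ => h.memLp _ _
  have hmean : ∫ x : ι → X, (∑ e : Fin m × Fin b × Fin b,
      fun x : ι → X => κ (x (L (e.1, e.2.1)), x (R (e.1, e.2.2)))) x ∂(Measure.pi fun _ => D) =
      m * b ^ 2 * ∫ z, κ z ∂(D.prod D) := by
    simp only [Finset.sum_apply]
    rw [integral_finsetSum _ fun e _ => (h.memLp _ _).integrable (by norm_num),
      Finset.sum_congr rfl fun e _ => h.integral_pi (hLR _ _), Finset.sum_const, nsmul_eq_mul]
    simp only [Finset.card_univ, Fintype.card_prod, Fintype.card_fin]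
    push_cast
    ring
  have hch := ProbabilityTheory.meas_ge_le_variance_div_sq hmem ht
  rw [hmean] at hch
  simp only [Finset.sum_apply] at hch
  refine hch.trans (ENNReal.ofReal_le_ofReal ?_)
  gcongr
  exact h.variance_sum_le hL hR hLR

open Classical in
theorem measure_card_close_le [IsProbabilityMeasure D] (h : IsSparseKernel D κ C p) {m b : ℕ}
    {L R : Fin m × Fin b → ι} (hLR : ∀ v w, L v ≠ R w) {c : ℕ} (hc : 0 < c) :
    (Measure.pi fun _ : ι => D) {x | c ≤ (Finset.univ.filter fun e : Fin m × Fin b × Fin b =>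
        (x (L (e.1, e.2.1)), x (R (e.1, e.2.2))) ∈ C).card} ≤
      ENNReal.ofReal (m * b ^ 2 * p / c) := by
  have hprob : ∀ e : Fin m × Fin b × Fin b, (Measure.pi fun _ : ι => D)
      {x | (x (L (e.1, e.2.1)), x (R (e.1, e.2.2))) ∈ C} ≤ ENNReal.ofReal p := by
    intro e
    have h1 := (measurePreserving_eval_pair D (hLR (e.1, e.2.1) (e.1, e.2.2))).measure_preimage
      h.measurableSet.nullMeasurableSet
    refine (le_of_eq h1).trans ?_
    rw [Measure.prod_apply h.measurableSet]
    refine (lintegral_mono (g := fun _ => ENNReal.ofReal p) fun x => ?_).trans (by simp)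
    rw [← ENNReal.ofReal_toReal (measure_ne_top D (Prod.mk x ⁻¹' C))]
    exact ENNReal.ofReal_le_ofReal (h.left_le x)
  have hm : ∀ e : Fin m × Fin b × Fin b,
      MeasurableSet {x : ι → X | (x (L (e.1, e.2.1)), x (R (e.1, e.2.2))) ∈ C} := fun e =>
    (by fun_prop : Measurable fun x : ι → X => (x (L (e.1, e.2.1)), x (R (e.1, e.2.2))))
      h.measurableSet
  let N : (ι → X) → ℝ≥0∞ := fun x => ∑ e : Fin m × Fin b × Fin b,
    {x : ι → X | (x (L (e.1, e.2.1)), x (R (e.1, e.2.2))) ∈ C}.indicator 1 x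
  have hN : ∀ x, N x = ((Finset.univ.filter fun e : Fin m × Fin b × Fin b =>
        (x (L (e.1, e.2.1)), x (R (e.1, e.2.2))) ∈ C).card : ℝ≥0∞) := by
    intro x
    simp only [N, Set.indicator_apply, Set.mem_ofPred_eq, Pi.one_apply]
    simp
  have hNm : Measurable N := Finset.measurable_sum _ fun e _ => measurable_one.indicator (hm e)
  have hNint : ∫⁻ x, N x ∂(Measure.pi fun _ : ι => D) ≤ ENNReal.ofReal (m * b ^ 2 * p) := by
    rw [lintegral_finsetSum _ fun e _ => measurable_one.indicator (hm e)]
    calc _ ≤ ∑ e : Fin m × Fin b × Fin b, ENNReal.ofReal p :=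
          Finset.sum_le_sum fun e _ => by
            rw [lintegral_indicator_one (hm e)]
            exact hprob e
      _ = _ := by
          rw [Finset.sum_const, nsmul_eq_mul, ENNReal.ofReal_mul (by positivity),
            ENNReal.ofReal_mul (by positivity), ENNReal.ofReal_pow (by positivity)]
          simp
          ring
  have hmk := meas_ge_le_lintegral_div (μ := Measure.pi fun _ : ι => D) hNm.aemeasurable
    (ε := (c : ℝ≥0∞)) (by simp; omega) (by simp)
  have e : {x | (c : ℝ≥0∞) ≤ N x} = {x : ι → X | c ≤ (Finset.univ.filter
      fun e : Fin m × Fin b × Fin b => (x (L (e.1, e.2.1)), x (R (e.1, e.2.2))) ∈ C).card} := by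
    ext x
    simp only [Set.mem_ofPred_eq, hN, Nat.cast_le]
  rw [e] at hmk
  refine hmk.trans ?_
  rw [ENNReal.ofReal_div_of_pos (by exact_mod_cast hc), ENNReal.ofReal_natCast]
  gcongr

end IsSparseKernel

end Concentration

/-! ### The tester for the uniform distribution. -/

section AscentRule

/-- The enumeration of the sample points, which come in two groups of `m` batches of size `b`. -/
noncomputable def sampleIndex (m b : ℕ) : Bool × Fin m × Fin b ≃ Fin (2 * (m * b)) :=
  Fintype.equivFinOfCardEq (by simp)

/-- The left end point of a pair of sample points of the same batch. -/
noncomputable def leftIndex {m b : ℕ} (e : Fin m × Fin b) : Fin (2 * (m * b)) :=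
  sampleIndex m b (false, e)

/-- The right end point of a pair of sample points of the same batch. -/
noncomputable def rightIndex {m b : ℕ} (e : Fin m × Fin b) : Fin (2 * (m * b)) :=
  sampleIndex m b (true, e)

theorem leftIndex_injective (m b : ℕ) : (leftIndex (m := m) (b := b)).Injective :=
  fun _ _ h => (Prod.ext_iff.1 ((sampleIndex m b).injective h)).2

theorem rightIndex_injective (m b : ℕ) : (rightIndex (m := m) (b := b)).Injective :=
  fun _ _ h => (Prod.ext_iff.1 ((sampleIndex m b).injective h)).2

theorem leftIndex_ne_rightIndex {m b : ℕ} (v w : Fin m × Fin b) : leftIndex v ≠ rightIndex w :=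
  fun h => by simpa using (Prod.ext_iff.1 ((sampleIndex m b).injective h)).1

/-- The pairs that are close according to a table of closenesses. -/
def closeEdges {m b : ℕ} (t : Fin m × Fin b × Fin b → Bool × Bool) :
    Finset (Fin m × Fin b × Fin b) :=
  Finset.univ.filter fun e => t e ≠ (false, false)

/-- The end points of the close pairs. -/
noncomputable def closeVertices {m b : ℕ} (t : Fin m × Fin b × Fin b → Bool × Bool) :
    Finset (Fin (2 * (m * b))) :=
  (closeEdges t).image (fun e => leftIndex (e.1, e.2.1)) ∪
    (closeEdges t).image (fun e => rightIndex (e.1, e.2.2))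

theorem card_closeVertices_le {m b : ℕ} (t : Fin m × Fin b × Fin b → Bool × Bool) :
    (closeVertices t).card ≤ 2 * (closeEdges t).card := by
  refine (Finset.card_union_le _ _).trans ?_
  rw [two_mul (closeEdges t).card]
  exact add_le_add Finset.card_image_le Finset.card_image_le

/-- The number of ascents seen in the pairs of sample points of the same batch. -/
noncomputable def totalScore {m b : ℕ} (t : Fin m × Fin b × Fin b → Bool × Bool)
    (l : Fin (2 * (m * b)) → Bool) : ℝ :=
  ∑ e, ascentScore (t e) (l (leftIndex (e.1, e.2.1))) (l (rightIndex (e.1, e.2.2)))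

theorem totalScore_congr {m b : ℕ} {t : Fin m × Fin b × Fin b → Bool × Bool}
    {l l' : Fin (2 * (m * b)) → Bool} (h : ∀ v ∈ closeVertices t, l v = l' v) :
    totalScore t l = totalScore t l' := by
  refine Finset.sum_congr rfl fun e _ => ?_
  by_cases he : t e = (false, false)
  · rw [he, ascentScore_false_false, ascentScore_false_false]
  · have hmem : e ∈ closeEdges t := by simp [closeEdges, he]
    rw [h _ (Finset.mem_union_left _ (Finset.mem_image_of_mem _ hmem)),
      h _ (Finset.mem_union_right _ (Finset.mem_image_of_mem _ hmem))]

/-- The tester that queries the end points of all close pairs, if there are at most `c` of these,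
and then accepts if it has seen at most `θ` ascents. -/
noncomputable def ascentRule {m b : ℕ} (hm : 0 < m) (hb : 0 < b) (c : ℕ) (δ θ : ℝ) :
    QueryRule I (2 * (m * b)) (2 * c) where
  Ω := Unit
  ν := Measure.dirac ()
  T := Fin m × Fin b × Fin b → Bool × Bool
  summary p e := closeness δ (p.2 (leftIndex (e.1, e.2.1))) (p.2 (rightIndex (e.1, e.2.2)))
  -- Surplus queries repeat one fixed point. Vertices beyond the first `2 * c` exist only if there
  -- are more than `c` close pairs, and then labels are ignored.
  query t i := (closeVertices t).toList.getD i (leftIndex (⟨0, hm⟩, ⟨0, hb⟩))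
  -- Accepting on overflow means that a rejection always comes from a large score.
  decide t l := if c < (closeEdges t).card then true else decide (totalScore t l ≤ θ)
  measurable_summary := measurable_pi_lambda _ fun e =>
    (measurable_closeness δ).comp (by fun_prop : Measurable fun p : Unit × (Fin (2 * (m * b)) → I) =>
      (p.2 (leftIndex (e.1, e.2.1)), p.2 (rightIndex (e.1, e.2.2))))
  decide_congr t l l' h := by
    split_ifs with hc
    · rfl
    · rw [totalScore_congr]
      intro v hv
      obtain ⟨i, hi, hiv⟩ := List.getElem_of_mem (Finset.mem_toList.2 hv)
      have hlt : i < 2 * c := by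
        rw [Finset.length_toList] at hi
        have := card_closeVertices_le t
        omega
      have := h ⟨i, hlt⟩
      simp only [List.getD_eq_getElem?_getD, List.getElem?_eq_getElem hi, Option.getD_some, hiv]
        at this
      exact this

theorem ascentRule_measure {m b : ℕ} (hm : 0 < m) (hb : 0 < b) (c : ℕ) (δ θ : ℝ) {f : I → Bool}
    (hf : Measurable f) (a : Bool) :
    ((ascentRule hm hb c δ θ).ν.prod (Measure.pi fun _ => (volume : Measure I)))
      {p | (ascentRule hm hb c δ θ).verdict f p = a} =
    (Measure.pi fun _ => (volume : Measure I))
      {x | (ascentRule hm hb c δ θ).verdict f ((() : Unit), x) = a} := by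
  have hms : MeasurableSet {x : Fin (2 * (m * b)) → I |
      (ascentRule hm hb c δ θ).verdict f ((() : Unit), x) = a} :=
    ((ascentRule hm hb c δ θ).measurable_verdict hf).comp
      (measurable_prodMk_left (x := (() : Unit))) (measurableSet_singleton a)
  have hν : IsProbabilityMeasure (ascentRule hm hb c δ θ).ν := QueryRule.isProbabilityMeasure _
  have := (measurePreserving_snd (μ := (ascentRule hm hb c δ θ).ν)
    (ν := Measure.pi fun _ : Fin (2 * (m * b)) => (volume : Measure I))).measure_preimage
    hms.nullMeasurableSet
  exact this

theorem ascentRule_verdict_eq_false {m b : ℕ} {hm : 0 < m} {hb : 0 < b} {c : ℕ} {δ θ : ℝ}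
    {f : I → Bool} {x : Fin (2 * (m * b)) → I}
    (h : (ascentRule hm hb c δ θ).verdict f ((() : Unit), x) = false) :
    θ < ∑ e : Fin m × Fin b × Fin b,
      ascentKernel δ f (x (leftIndex (e.1, e.2.1)), x (rightIndex (e.1, e.2.2))) := by
  simp only [ascentRule, QueryRule.verdict] at h
  split_ifs at h with hc
  rw [decide_eq_false_iff_not, not_le] at h
  exact h

theorem ascentRule_verdict_eq_true {m b : ℕ} {hm : 0 < m} {hb : 0 < b} {c : ℕ} {δ θ : ℝ}
    {f : I → Bool} {x : Fin (2 * (m * b)) → I}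
    (h : (ascentRule hm hb c δ θ).verdict f ((() : Unit), x) = true) :
    ∑ e : Fin m × Fin b × Fin b,
      ascentKernel δ f (x (leftIndex (e.1, e.2.1)), x (rightIndex (e.1, e.2.2))) ≤ θ ∨
    c ≤ (closeEdges fun e : Fin m × Fin b × Fin b =>
      closeness δ (x (leftIndex (e.1, e.2.1))) (x (rightIndex (e.1, e.2.2)))).card := by
  simp only [ascentRule, QueryRule.verdict] at h
  split_ifs at h with hc
  · exact Or.inr hc.le
  · exact Or.inl (of_decide_eq_true h)

/-- Chebyshev's inequality, with variance at most `4 * m * b ^ 2 * τ` because `b * δ ≤ 1 / 4`. -/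
theorem ascentRule_reject_le {m b : ℕ} (hm : 0 < m) (hb : 0 < b) (c : ℕ) {δ τ η : ℝ} (hδ : 0 ≤ δ)
    (hbδ : b * δ ≤ 1 / 4) (hτ : 0 < τ) (hη : 0 < η)
    (hlarge : 1280 ≤ m * b ^ 2 * τ * η ^ 2) {f : I → Bool} (hf : Measurable f)
    (hμ : ascentRate δ f ≤ τ) :
    ((ascentRule hm hb c δ (m * b ^ 2 * τ * (1 + η / 2))).ν.prod
      (Measure.pi fun _ => (volume : Measure I)))
      {p | (ascentRule hm hb c δ (m * b ^ 2 * τ * (1 + η / 2))).verdict f p = false} ≤ 1 / 10 := by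
  rw [ascentRule_measure hm hb c δ _ hf]
  have hk := isSparseKernel_ascentKernel hδ hf
  have hm' : (0 : ℝ) < m := by exact_mod_cast hm
  have hb' : (0 : ℝ) < b := by exact_mod_cast hb
  have hM : (0 : ℝ) < m * b ^ 2 := by positivity
  have hμ0 := ascentRate_nonneg δ f
  have hdev := hk.measure_deviation_le (leftIndex_injective m b) (rightIndex_injective m b)
    leftIndex_ne_rightIndex (t := m * b ^ 2 * τ * (η / 2)) (by positivity)
  refine (measure_mono fun x hx => ?_).trans (hdev.trans ?_)
  · have h1 := ascentRule_verdict_eq_false hx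
    rw [Set.mem_ofPred_eq]
    refine le_trans ?_ (le_abs_self _)
    have h2 : (m : ℝ) * b ^ 2 * ascentRate δ f ≤ m * b ^ 2 * τ := by gcongr
    rw [ascentRate] at h2
    linarith
  · rw [show (1 : ℝ≥0∞) / 10 = ENNReal.ofReal (1 / 10) by
      rw [ENNReal.ofReal_div_of_pos (by norm_num)]; simp]
    refine ENNReal.ofReal_le_ofReal ?_
    change m * b ^ 2 * (2 + 4 * b * (2 * δ)) * ascentRate δ f / _ ≤ _
    rw [div_le_iff₀ (by positivity)]
    calc m * b ^ 2 * (2 + 4 * b * (2 * δ)) * ascentRate δ f ≤ m * b ^ 2 * 4 * τ := by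
          gcongr
          linarith
      _ ≤ 1 / 10 * (m * b ^ 2 * τ * (η / 2)) ^ 2 := by
          have : 0 ≤ m * b ^ 2 * τ := by positivity
          nlinarith

/-- The deviation is taken relative to the true rate, which may far exceed `τ`, since the variance
bound grows only linearly in it. The threshold is low enough because `(1 + η) * (1 - η / 4) ≥ 1 + η
/ 2`. Chebyshev's inequality needs `1280 = 4 * 20 * 4 ^ 2` for its share `1 / 20`; overflow gets the
other `1 / 20`. -/
theorem ascentRule_accept_le {m b : ℕ} (hm : 0 < m) (hb : 0 < b) {c : ℕ} {δ τ η : ℝ} (hδ : 0 ≤ δ)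
    (hbδ : b * δ ≤ 1 / 4) (hτ : 0 < τ) (hη : 0 < η) (hη1 : η ≤ 1)
    (hlarge : 1280 ≤ m * b ^ 2 * τ * η ^ 2) (hc : 0 < c) (hcl : m * b ^ 2 * (2 * δ) ≤ c / 20)
    {f : I → Bool} (hf : Measurable f) (hμ : (1 + η) * τ ≤ ascentRate δ f) :
    ((ascentRule hm hb c δ (m * b ^ 2 * τ * (1 + η / 2))).ν.prod
      (Measure.pi fun _ => (volume : Measure I)))
      {p | (ascentRule hm hb c δ (m * b ^ 2 * τ * (1 + η / 2))).verdict f p = true} ≤ 1 / 10 := by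
  rw [ascentRule_measure hm hb c δ _ hf]
  have hk := isSparseKernel_ascentKernel hδ hf
  have hm' : (0 : ℝ) < m := by exact_mod_cast hm
  have hb' : (0 : ℝ) < b := by exact_mod_cast hb
  have hM : (0 : ℝ) < m * b ^ 2 := by positivity
  have hμ0 : 0 < ascentRate δ f := lt_of_lt_of_le (by positivity) hμ
  have hdev := hk.measure_deviation_le (leftIndex_injective m b) (rightIndex_injective m b)
    leftIndex_ne_rightIndex (t := m * b ^ 2 * ascentRate δ f * (η / 4)) (by positivity)
  have hcard := hk.measure_card_close_le (m := m) (b := b) leftIndex_ne_rightIndex hc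
  have hsplit : (1 : ℝ≥0∞) / 10 = ENNReal.ofReal (1 / 20) + ENNReal.ofReal (1 / 20) := by
    rw [← ENNReal.ofReal_add (by norm_num) (by norm_num), show (1 / 20 + 1 / 20 : ℝ) = 1 / 10 by norm_num,
      ENNReal.ofReal_div_of_pos (by norm_num)]
    simp
  rw [hsplit]
  refine (measure_mono fun x hx => ?_).trans ((measure_union_le _ _).trans
    (add_le_add (hdev.trans ?_) (hcard.trans ?_)))
  · rcases ascentRule_verdict_eq_true hx with h1 | h1
    · left
      rw [Set.mem_ofPred_eq, abs_sub_comm]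
      refine le_trans ?_ (le_abs_self _)
      change _ ≤ m * b ^ 2 * ascentRate δ f - _
      have h2 : τ * (1 + η / 2) ≤ ascentRate δ f * (1 - η / 4) := by
        have : (1 + η) * τ * (1 - η / 4) ≤ ascentRate δ f * (1 - η / 4) :=
          mul_le_mul_of_nonneg_right hμ (by linarith)
        nlinarith [mul_pos hτ hη]
      have h3 : (m : ℝ) * b ^ 2 * (τ * (1 + η / 2)) ≤ m * b ^ 2 * (ascentRate δ f * (1 - η / 4)) := by
        gcongr
      linarith
    · right
      rw [Set.mem_ofPred_eq]
      classical
      refine h1.trans (Finset.card_le_card fun e he => ?_)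
      exact Finset.mem_filter.2 ⟨Finset.mem_univ _, (Finset.mem_filter.1 he).2⟩
  · refine ENNReal.ofReal_le_ofReal ?_
    change m * b ^ 2 * (2 + 4 * b * (2 * δ)) * ascentRate δ f / _ ≤ _
    rw [div_le_iff₀ (by positivity)]
    have h4 : (m : ℝ) * b ^ 2 * τ * η ^ 2 ≤ m * b ^ 2 * ascentRate δ f * η ^ 2 := by
      gcongr
      nlinarith [mul_pos hτ hη]
    calc m * b ^ 2 * (2 + 4 * b * (2 * δ)) * ascentRate δ f ≤ m * b ^ 2 * 4 * ascentRate δ f := by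
          gcongr
          linarith
      _ ≤ 1 / 20 * (m * b ^ 2 * ascentRate δ f * (η / 4)) ^ 2 := by
          have : 0 ≤ m * b ^ 2 * ascentRate δ f := by positivity
          nlinarith
  · refine ENNReal.ofReal_le_ofReal ?_
    rw [div_le_iff₀ (by exact_mod_cast hc)]
    linarith

/-- With probability at least `9/10` over a sample from the uniform distribution, the rule accepts
all unions of `d` intervals and rejects all functions at distance at least `ε` from these. -/
def QueryRule.IsReliable {s q : ℕ} (R : QueryRule I s q) (d : ℕ) (ε : ℝ) : Prop :=
  ∀ f : I → Bool, Measurable f →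
    (f ∈ unionsOfOrdConnected d →
      (R.ν.prod (Measure.pi fun _ => (volume : Measure I))) {p | R.verdict f p = false} ≤ 1 / 10) ∧
    (ENNReal.ofReal ε ≤ distToProperty volume (unionsOfIntervals d) f →
      (R.ν.prod (Measure.pi fun _ => (volume : Measure I))) {p | R.verdict f p = true} ≤ 1 / 10)

/-- Taking `b` about `1 / √δ` keeps `b ^ 2 * δ` between `1` and `4`. The threshold score per batch
is then of order `d * δ`, that is `ε ^ 2`, and detecting a relative excess of `ε / 4` takes order `1
/ ε ^ 4` batches. -/
theorem exists_isReliable {d : ℕ} (hd : 1 ≤ d) {ε : ℝ} (hε : 0 < ε) (hε1 : ε ≤ 1) :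
    ∃ s q : ℕ, (s : ℝ) ≤ 10 ^ 9 * √(d : ℝ) / ε ^ 5 ∧ (q : ℝ) ≤ 10 ^ 9 / ε ^ 4 ∧
      ∃ R : QueryRule I s q, R.IsReliable d ε := by
  have hd0 : (0 : ℝ) < d := by exact_mod_cast hd
  have hd1 : (1 : ℝ) ≤ d := by exact_mod_cast hd
  set δ : ℝ := ε ^ 2 / (64 * d) with hδdef
  have hδ0 : 0 < δ := by positivity
  have hdδ : d * δ = ε ^ 2 / 64 := by rw [hδdef]; field_simp
  have hε2 : ε ^ 2 ≤ 1 := pow_le_one₀ hε.le hε1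
  have hδ64 : δ ≤ 1 / 64 := by
    rw [hδdef, div_le_iff₀ (by positivity)]
    linarith
  set r : ℝ := ε / (8 * √(d : ℝ)) with hr
  have hsd : 0 < √(d : ℝ) := Real.sqrt_pos.2 hd0
  have hr0 : 0 < r := by positivity
  have hrδ : r ^ 2 = δ := by
    rw [hr, hδdef, div_pow, mul_pow, Real.sq_sqrt hd0.le]
    norm_num
  have hr8 : r ≤ 1 / 8 := by nlinarith
  set b : ℕ := ⌈1 / r⌉₊ with hbdef
  -- `2621440 = 1280 * 64 * 32`, where `64` comes from `d * δ = ε ^ 2 / 64` and `32` from `(ε / 4) ^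
  -- 2 / 2`.
  set m : ℕ := ⌈2621440 / ε ^ 4⌉₊ with hmdef
  have hb1 : 1 / r ≤ b := Nat.le_ceil _
  have hb2 : (b : ℝ) ≤ 2 / r := by
    have := (Nat.ceil_lt_add_one (by positivity : 0 ≤ 1 / r)).le
    have h1 : 1 ≤ 1 / r := by rw [le_div_iff₀ hr0]; linarith
    calc (b : ℝ) ≤ 1 / r + 1 := this
      _ ≤ 1 / r + 1 / r := by linarith
      _ = 2 / r := by ring
  have hm1 : 2621440 / ε ^ 4 ≤ m := Nat.le_ceil _
  have hm2 : (m : ℝ) ≤ 2621441 / ε ^ 4 := by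
    have := (Nat.ceil_lt_add_one (by positivity : 0 ≤ 2621440 / ε ^ 4)).le
    have h1 : 1 ≤ 1 / ε ^ 4 := by
      rw [le_div_iff₀ (by positivity)]
      have := pow_le_one₀ (n := 4) hε.le hε1
      linarith
    calc (m : ℝ) ≤ 2621440 / ε ^ 4 + 1 := this
      _ ≤ 2621440 / ε ^ 4 + 1 / ε ^ 4 := by linarith
      _ = 2621441 / ε ^ 4 := by ring
  have hb0' : (0 : ℝ) < b := lt_of_lt_of_le (by positivity) hb1
  have hm0' : (0 : ℝ) < m := lt_of_lt_of_le (by positivity) hm1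
  have hb0 : 0 < b := by exact_mod_cast hb0'
  have hm0 : 0 < m := by exact_mod_cast hm0'
  have hbr1 : 1 ≤ b * r := by rwa [div_le_iff₀ hr0] at hb1
  have hbr2 : b * r ≤ 2 := by rwa [le_div_iff₀ hr0] at hb2
  have hbδ : b * δ ≤ 1 / 4 := by
    rw [← hrδ]
    nlinarith
  have hb2δ1 : 1 ≤ (b : ℝ) ^ 2 * δ := by
    rw [← hrδ, ← mul_pow]
    exact one_le_pow₀ hbr1
  have hb2δ2 : (b : ℝ) ^ 2 * δ ≤ 4 := by
    rw [← hrδ, ← mul_pow]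
    nlinarith
  have hmε : 2621440 ≤ m * ε ^ 4 := by rwa [div_le_iff₀ (by positivity)] at hm1
  have hτ : 0 < d * δ ^ 2 / 2 := by positivity
  have hlarge : 1280 ≤ m * b ^ 2 * (d * δ ^ 2 / 2) * (ε / 4) ^ 2 := by
    have e : m * b ^ 2 * (d * δ ^ 2 / 2) * (ε / 4) ^ 2 =
        (b ^ 2 * δ) * (m * ε ^ 2 * (d * δ) / 32) := by ring
    rw [e, hdδ]
    have h1 : 1280 ≤ m * ε ^ 2 * (ε ^ 2 / 64) / 32 := by
      have : m * ε ^ 2 * (ε ^ 2 / 64) / 32 = m * ε ^ 4 / 2048 := by ring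
      rw [this]
      linarith
    nlinarith
  -- At most `8 * m` close pairs are expected; the cap `160 * m` is twenty times as large.
  have hcl : m * b ^ 2 * (2 * δ) ≤ ((160 * m : ℕ) : ℝ) / 20 := by
    push_cast
    nlinarith
  refine ⟨2 * (m * b), 2 * (160 * m), ?_, ?_,
    ascentRule hm0 hb0 (160 * m) δ (m * b ^ 2 * (d * δ ^ 2 / 2) * (1 + ε / 4 / 2)), ?_⟩
  · push_cast
    have h1 : (m : ℝ) * b ≤ 2621441 / ε ^ 4 * (2 / r) := by gcongr
    have h2 : 2621441 / ε ^ 4 * (2 / r) = 41943056 * √(d : ℝ) / ε ^ 5 := by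
      rw [hr]
      field_simp
      norm_num
    rw [h2] at h1
    have h3 : 0 ≤ √(d : ℝ) / ε ^ 5 := by positivity
    have e1 : 41943056 * √(d : ℝ) / ε ^ 5 = 41943056 * (√(d : ℝ) / ε ^ 5) := by ring
    have e2 : 10 ^ 9 * √(d : ℝ) / ε ^ 5 = 10 ^ 9 * (√(d : ℝ) / ε ^ 5) := by ring
    rw [e1] at h1
    rw [e2]
    linarith
  · push_cast
    have h3 : 0 ≤ 1 / ε ^ 4 := by positivity
    have e1 : 2621441 / ε ^ 4 = 2621441 * (1 / ε ^ 4) := by ring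
    have e2 : 10 ^ 9 / ε ^ 4 = 10 ^ 9 * (1 / ε ^ 4) := by ring
    rw [e1] at hm2
    rw [e2]
    linarith
  · intro f hf
    constructor
    · intro hfd
      exact ascentRule_reject_le hm0 hb0 _ hδ0.le hbδ hτ (by positivity) hlarge hf
        (ascentRate_le hδ0 (by linarith) hf hfd)
    · intro hfar
      exact ascentRule_accept_le hm0 hb0 hδ0.le hbδ hτ (by positivity) (by linarith) hlarge
        (by omega) hcl hf (le_ascentRate_of_far hd hε hε1 hf hfar)

end AscentRule

/-! ### Pushing unions of intervals forward along a monotone map. -/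

section Transfer

/-- Each value `v` of `φ` gets a representative `τ v` in its fibre, one where `G` agrees with `f v`
if there is any. Fibres of a monotone map are ordered, so `τ` is monotone and `v ↦ G (τ v)` is again
given by at most `d` intervals. A disagreement at `v` then means that `G` disagrees on the whole
fibre. Finiteness of the range provides closed intervals, from least to greatest value. -/
theorem exists_transfer {d : ℕ} {φ : I → I} (hφ : Monotone φ) (hfin : (Set.range φ).Finite)
    (f : I → Bool) {G : I → Bool} (hG : G ∈ unionsOfIntervals d) :
    ∃ g ∈ unionsOfIntervals d, ∀ t, f (φ t) ≠ g (φ t) → f (φ t) ≠ G t := by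
  classical
  obtain ⟨k, hk, ℓ, u, hle, hdisj, hG⟩ := hG
  have hτ : ∀ v ∈ Set.range φ, ∃ t, φ t = v ∧ ∀ t', φ t' = v → f v = G t' → f v = G t := by
    rintro _ ⟨t0, rfl⟩
    by_cases h : ∃ t, φ t = φ t0 ∧ f (φ t0) = G t
    · obtain ⟨t, h1, h2⟩ := h
      exact ⟨t, h1, fun _ _ _ => h2⟩
    · exact ⟨t0, rfl, fun t' h1 h2 => absurd ⟨t', h1, h2⟩ h⟩
  choose! τ hτ1 hτ2 using hτ
  have hτmono : ∀ v ∈ Set.range φ, ∀ w ∈ Set.range φ, v ≤ w → τ v ≤ τ w := by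
    intro v hv w hw hvw
    rcases hvw.eq_or_lt with rfl | hlt
    · exact le_rfl
    · by_contra! hc
      have := hφ hc.le
      rw [hτ1 v hv, hτ1 w hw] at this
      exact absurd hlt (not_lt.2 this)
  let V : Fin k → Finset I := fun i => hfin.toFinset.filter fun v => ℓ i ≤ τ v ∧ τ v ≤ u i
  have hV : ∀ i v, v ∈ V i ↔ v ∈ Set.range φ ∧ ℓ i ≤ τ v ∧ τ v ≤ u i := by
    intro i v
    simp only [V, Finset.mem_filter, Set.Finite.mem_toFinset]
  let ℓ' : {i : Fin k // (V i).Nonempty} → I := fun i => (V i).min' i.2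
  let u' : {i : Fin k // (V i).Nonempty} → I := fun i => (V i).max' i.2
  have hℓ' : ∀ i : {i : Fin k // (V i).Nonempty}, ℓ' i ∈ V i := fun i => Finset.min'_mem _ _
  have hu' : ∀ i : {i : Fin k // (V i).Nonempty}, u' i ∈ V i := fun i => Finset.max'_mem _ _
  have hmem : ∀ i : {i : Fin k // (V i).Nonempty}, ∀ v ∈ Set.range φ, ℓ' i ≤ v → v ≤ u' i →
      v ∈ V i := by
    intro i v hv h1 h2
    have h3 := (hV _ _).1 (hℓ' i)
    have h4 := (hV _ _).1 (hu' i)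
    exact (hV _ _).2 ⟨hv, h3.2.1.trans (hτmono _ h3.1 _ hv h1), (hτmono _ hv _ h4.1 h2).trans h4.2.2⟩
  have huniq : ∀ i j v, v ∈ V i → v ∈ V j → i = j := by
    intro i j v hi hj
    by_contra hij
    exact Set.disjoint_left.1 (hdisj hij) ((hV _ _).1 hi).2 ((hV _ _).1 hj).2
  let g : I → Bool := fun x => decide (∃ i, ℓ' i ≤ x ∧ x ≤ u' i)
  refine ⟨g, mem_unionsOfIntervals_of_fintype (ι := {i : Fin k // (V i).Nonempty})
    ((Fintype.card_subtype_le _).trans (by simpa using hk)) ℓ' u' (fun i => Finset.min'_le _ _ (hu' i))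
    ?_ (fun x => by simp only [g, decide_eq_true_eq]), ?_⟩
  · intro i j hij
    refine Set.disjoint_left.2 fun x hx hy => hij (Subtype.ext ?_)
    rcases le_total (ℓ' i) (ℓ' j) with h | h
    · exact huniq _ _ (ℓ' j) (hmem i _ ((hV _ _).1 (hℓ' j)).1 h (hy.1.trans hx.2)) (hℓ' j)
    · exact huniq _ _ (ℓ' i) (hℓ' i) (hmem j _ ((hV _ _).1 (hℓ' i)).1 h (hx.1.trans hy.2))
  · intro t hne heq
    apply hne
    have hv : φ t ∈ Set.range φ := ⟨t, rfl⟩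
    rw [hτ2 _ hv t rfl heq, Bool.eq_iff_iff, hG]
    simp only [g, decide_eq_true_eq]
    constructor
    · rintro ⟨i, hi⟩
      have : φ t ∈ V i := (hV _ _).2 ⟨hv, hi⟩
      exact ⟨⟨i, _, this⟩, Finset.min'_le _ _ this, Finset.le_max' _ _ this⟩
    · rintro ⟨i, h1, h2⟩
      exact ⟨i, ((hV _ _).1 (hmem i _ hv h1 h2)).2⟩

end Transfer

/-! ### Uniform convergence on initial segments. -/

section UniformDeviation

/-- An atom may make the distribution function jump over `c`, hence one bound with the point and one
without. The infimum works by continuity of the measure from above and below. -/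
theorem exists_quantile (D : Measure I) [IsProbabilityMeasure D] {c : ℝ≥0∞} (hc : c ≤ 1) :
    ∃ z : I, c ≤ D (Set.Iic z) ∧ D (Set.Iio z) ≤ c := by
  set s : Set I := {t | c ≤ D (Set.Iic t)}
  have hne : s.Nonempty := ⟨⊤, by simpa [s] using hc⟩
  have hglb : IsGLB s (sInf s) := isGLB_sInf s
  refine ⟨sInf s, ?_, ?_⟩
  · obtain ⟨w, hw, hwle, htend, hws⟩ := hglb.exists_seq_antitone_tendsto hne
    have e : Set.Iic (sInf s) = ⋂ n, Set.Iic (w n) := by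
      ext x
      simp only [Set.mem_Iic, Set.mem_iInter]
      exact ⟨fun h n => h.trans (hwle n), fun h => ge_of_tendsto' htend h⟩
    rw [e, Antitone.measure_iInter (fun a b hab => Set.Iic_subset_Iic.2 (hw hab))
      (fun n => measurableSet_Iic.nullMeasurableSet) ⟨0, measure_ne_top _ _⟩]
    exact le_iInf hws
  · rcases eq_or_ne (sInf s) ⊥ with h | h
    · rw [h]
      simp
    · obtain ⟨w, hw, hwlt, htend⟩ := exists_seq_strictMono_tendsto' (bot_lt_iff_ne_bot.2 h)
      have e : Set.Iio (sInf s) = ⋃ n, Set.Iic (w n) := by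
        ext x
        simp only [Set.mem_Iio, Set.mem_Iic, Set.mem_iUnion]
        exact ⟨fun h => ((htend.eventually (lt_mem_nhds h)).exists).imp fun _ h => h.le,
          fun ⟨n, h⟩ => h.trans_lt (hwlt n).2⟩
      rw [e, Monotone.measure_iUnion (fun a b hab => Set.Iic_subset_Iic.2 (hw.monotone hab))]
      refine iSup_le fun n => ?_
      by_contra! hc'
      exact absurd (sInf_le (show w n ∈ s from hc'.le)) (not_le.2 (hwlt n).2)

/-- The brackets run between consecutive quantiles of level `k / N`. Closed rays inside and open
rays outside keep atoms at the quantiles out of the gap. -/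
theorem exists_bracketing (D : Measure I) [IsProbabilityMeasure D] {N : ℕ} (hN : 0 < N) :
    ∃ P Q : Fin (N + 1) → Set I, (∀ k, MeasurableSet (P k)) ∧ (∀ k, MeasurableSet (Q k)) ∧
      (∀ k, D.real (Q k) ≤ D.real (P k) + 1 / N) ∧
      ∀ L : Set I, IsLowerSet L → ∃ k, P k ⊆ L ∧ L ⊆ Q k := by
  classical
  have hN0 : (0 : ℝ) < N := by exact_mod_cast hN
  have hq : ∀ k : ℕ, ∃ z : I, k ≤ N → (k : ℝ) / N ≤ D.real (Set.Iic z) ∧ D.real (Set.Iio z) ≤ k / N := by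
    intro k
    by_cases hk : k ≤ N
    · have hkN : (k : ℝ) / N ≤ 1 := by
        rw [div_le_one hN0]
        exact_mod_cast hk
      obtain ⟨z, h1, h2⟩ := exists_quantile D (c := ENNReal.ofReal (k / N))
        (by rw [← ENNReal.ofReal_one]; exact ENNReal.ofReal_le_ofReal hkN)
      refine ⟨z, fun _ => ⟨?_, ?_⟩⟩
      · exact (ENNReal.ofReal_le_iff_le_toReal (measure_ne_top _ _)).1 h1
      · exact ENNReal.toReal_le_of_le_ofReal (by positivity) h2
    · exact ⟨0, fun h => absurd h hk⟩
  choose z hz using hq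
  let P : ℕ → Set I := fun k => if k = 0 then ∅ else Set.Iic (z k)
  let Q : ℕ → Set I := fun k => if k = N then Set.univ else Set.Iio (z (k + 1))
  have hP : ∀ k, k ≤ N → (k : ℝ) / N ≤ D.real (P k) := by
    intro k hk
    by_cases h : k = 0
    · simp [h]
    · simp only [P, if_neg h]
      exact (hz k hk).1
  have hQ : ∀ k, k ≤ N → D.real (Q k) ≤ ((k : ℝ) + 1) / N := by
    intro k hk
    by_cases h : k = N
    · simp only [Q, if_pos h, probReal_univ]
      rw [le_div_iff₀ hN0, h]
      linarith
    · simp only [Q, if_neg h]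
      have := (hz (k + 1) (by omega)).2
      push_cast at this
      exact this
  refine ⟨fun k => P k, fun k => Q k, fun k => ?_, fun k => ?_, fun k => ?_, fun L hL => ?_⟩
  · simp only [P]
    split_ifs
    · exact MeasurableSet.empty
    · exact measurableSet_Iic
  · simp only [Q]
    split_ifs
    · exact MeasurableSet.univ
    · exact measurableSet_Iio
  · have h1 := hP k (by omega)
    have h2 := hQ k (by omega)
    rw [add_div] at h2
    linarith
  · have h0 : P 0 ⊆ L := by simp [P]
    set k := Nat.findGreatest (fun k => P k ⊆ L) N with hk
    have hkN : k ≤ N := Nat.findGreatest_le N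
    have hPk : P k ⊆ L := Nat.findGreatest_spec (P := fun k => P k ⊆ L) (Nat.zero_le N) h0
    refine ⟨⟨k, by omega⟩, hPk, ?_⟩
    by_cases h : k = N
    · simp [Q, h]
    · have hnot : ¬P (k + 1) ⊆ L :=
        Nat.findGreatest_is_greatest (P := fun k => P k ⊆ L) (Nat.lt_succ_self k) (by omega)
      simp only [P, if_neg (Nat.succ_ne_zero k)] at hnot
      have hzL : z (k + 1) ∉ L := fun hc => hnot fun x hx => hL hx hc
      simp only [Q, if_neg h]
      intro x hx
      by_contra hc
      exact hzL (hL (not_lt.1 hc) hx)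

theorem abs_sub_le_of_bracketing {D E : Measure I} [IsProbabilityMeasure D]
    [IsProbabilityMeasure E] {B P Q L : Set I} (hP : MeasurableSet P)
    (hL : MeasurableSet L) (hPL : P ⊆ L) (hLQ : L ⊆ Q) {a κ : ℝ}
    (hPQ : D.real Q ≤ D.real P + a) (h1 : |E.real (B ∩ P) - D.real (B ∩ P)| ≤ κ)
    (h2 : |E.real (B ∩ Q) - D.real (B ∩ Q)| ≤ κ) :
    |E.real (B ∩ L) - D.real (B ∩ L)| ≤ κ + a := by
  have key : ∀ S T : Set I, MeasurableSet S → S ⊆ T →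
      D.real (B ∩ T) ≤ D.real (B ∩ S) + (D.real T - D.real S) := by
    intro S T hS hST
    have e1 := measureReal_sdiff (μ := D) hST hS
    have e2 : B ∩ T ⊆ (B ∩ S) ∪ (T \ S) := by
      rintro x ⟨hx, hxT⟩
      by_cases hxS : x ∈ S
      · exact Or.inl ⟨hx, hxS⟩
      · exact Or.inr ⟨hxT, hxS⟩
    have e3 := (measureReal_mono (μ := D) e2).trans (measureReal_union_le _ _)
    linarith
  have k1 := key P L hP hPL
  have k2 := key L Q hL hLQ
  have m1 := measureReal_mono (μ := D) hPL
  have m2 := measureReal_mono (μ := D) hLQ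
  have m3 := measureReal_mono (μ := E) (Set.inter_subset_inter_right B hPL)
  have m4 := measureReal_mono (μ := E) (Set.inter_subset_inter_right B hLQ)
  rw [abs_le] at h1 h2 ⊢
  constructor <;> linarith [h1.1, h1.2, h2.1, h2.2]

/-- An interval is a difference of two initial segments, so the error is a signed sum of masses of
initial segments within level sets of `f`. -/
theorem measureReal_ne_eq {D : Measure I} [IsProbabilityMeasure D] {f g : I → Bool}
    (hf : Measurable f) {k : ℕ} {ℓ u : Fin k → I} (hle : ∀ i, ℓ i ≤ u i)
    (hdisj : Pairwise fun i j => Disjoint (Set.Icc (ℓ i) (u i)) (Set.Icc (ℓ j) (u j)))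
    (hg : ∀ x, g x = true ↔ ∃ i, ℓ i ≤ x ∧ x ≤ u i) :
    D.real {x | f x ≠ g x} = D.real (f ⁻¹' {true} ∩ Set.univ) +
      ∑ i, ((D.real (f ⁻¹' {false} ∩ Set.Iic (u i)) - D.real (f ⁻¹' {false} ∩ Set.Iio (ℓ i))) -
        (D.real (f ⁻¹' {true} ∩ Set.Iic (u i)) - D.real (f ⁻¹' {true} ∩ Set.Iio (ℓ i)))) := by
  have hB : ∀ b, MeasurableSet (f ⁻¹' {b}) := fun b => hf (measurableSet_singleton b)
  set U : Set I := ⋃ i, Set.Icc (ℓ i) (u i)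
  have hU : MeasurableSet U := MeasurableSet.iUnion fun i => measurableSet_Icc
  have hBU : ∀ b, D.real (f ⁻¹' {b} ∩ U) = ∑ i, (D.real (f ⁻¹' {b} ∩ Set.Iic (u i)) -
      D.real (f ⁻¹' {b} ∩ Set.Iio (ℓ i))) := by
    intro b
    rw [Set.inter_iUnion, measureReal_iUnion_fintype]
    · refine Finset.sum_congr rfl fun i _ => ?_
      rw [← measureReal_sdiff]
      · congr 1
        ext x
        simp only [Set.mem_inter_iff, Set.mem_Icc, Set.mem_sdiff, Set.mem_Iic, Set.mem_Iio]
        constructor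
        · rintro ⟨h1, h2, h3⟩
          exact ⟨⟨h1, h3⟩, fun h => absurd h.2 (not_lt.2 h2)⟩
        · rintro ⟨⟨h1, h3⟩, h⟩
          exact ⟨h1, not_lt.1 fun hc => h ⟨h1, hc⟩, h3⟩
      · exact Set.inter_subset_inter_right _ fun x hx => (le_of_lt hx).trans (hle i)
      · exact (hB b).inter measurableSet_Iio
    · intro i j hij
      exact (hdisj hij).mono Set.inter_subset_right Set.inter_subset_right
    · exact fun i => (hB b).inter measurableSet_Icc
  have hset : {x | f x ≠ g x} = (f ⁻¹' {true} \ U) ∪ (f ⁻¹' {false} ∩ U) := by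
    ext x
    have hxU : x ∈ U ↔ g x = true := by
      rw [hg]
      simp [U]
    simp only [Set.mem_ofPred_eq, Set.mem_union, Set.mem_sdiff, Set.mem_inter_iff, hxU,
      Set.mem_preimage, Set.mem_singleton_iff]
    cases f x <;> cases g x <;> simp
  have h1 := measureReal_inter_add_sdiff (μ := D) (s := f ⁻¹' {true}) hU
  rw [hset, measureReal_union _ ((hB false).inter hU), Finset.sum_sub_distrib, ← hBU, ← hBU,
    Set.inter_univ]
  · linarith
  · exact Set.disjoint_left.2 fun x hx hy => hx.2 hy.2

/-- One term for the whole space and four per interval, and `1 + 4 * d ≤ 5 * d`. -/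
theorem measureReal_ne_le_of_close {D E : Measure I} [IsProbabilityMeasure D]
    [IsProbabilityMeasure E] {f g : I → Bool} (hf : Measurable f) {d : ℕ} (hd : 1 ≤ d)
    (hg : g ∈ unionsOfIntervals d) {γ : ℝ} (hγ : ∀ b, ∀ L : Set I, MeasurableSet L → IsLowerSet L →
      |E.real (f ⁻¹' {b} ∩ L) - D.real (f ⁻¹' {b} ∩ L)| ≤ γ) :
    D.real {x | f x ≠ g x} ≤ E.real {x | f x ≠ g x} + 5 * d * γ := by
  obtain ⟨k, hk, ℓ, u, hle, hdisj, hg⟩ := hg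
  have hγ0 : 0 ≤ γ := (abs_nonneg _).trans (hγ true Set.univ MeasurableSet.univ isLowerSet_univ)
  rw [measureReal_ne_eq hf hle hdisj hg, measureReal_ne_eq hf hle hdisj hg]
  have h0 := abs_le.1 (hγ true Set.univ MeasurableSet.univ isLowerSet_univ)
  have hsum : ∑ i : Fin k, ((D.real (f ⁻¹' {false} ∩ Set.Iic (u i)) -
      D.real (f ⁻¹' {false} ∩ Set.Iio (ℓ i))) - (D.real (f ⁻¹' {true} ∩ Set.Iic (u i)) -
      D.real (f ⁻¹' {true} ∩ Set.Iio (ℓ i)))) ≤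
    ∑ i : Fin k, (((E.real (f ⁻¹' {false} ∩ Set.Iic (u i)) -
      E.real (f ⁻¹' {false} ∩ Set.Iio (ℓ i))) - (E.real (f ⁻¹' {true} ∩ Set.Iic (u i)) -
      E.real (f ⁻¹' {true} ∩ Set.Iio (ℓ i)))) + 4 * γ) := by
    refine Finset.sum_le_sum fun i _ => ?_
    have a1 := abs_le.1 (hγ true _ measurableSet_Iic (isLowerSet_Iic (u i)))
    have a2 := abs_le.1 (hγ false _ measurableSet_Iic (isLowerSet_Iic (u i)))
    have a3 := abs_le.1 (hγ true _ measurableSet_Iio (isLowerSet_Iio (ℓ i)))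
    have a4 := abs_le.1 (hγ false _ measurableSet_Iio (isLowerSet_Iio (ℓ i)))
    linarith [a1.1, a1.2, a2.1, a2.2, a3.1, a3.2, a4.1, a4.2]
  rw [Finset.sum_add_distrib, Finset.sum_const, nsmul_eq_mul, Finset.card_univ,
    Fintype.card_fin] at hsum
  have hkd : (k : ℝ) ≤ d := by exact_mod_cast hk
  have hd1 : (1 : ℝ) ≤ d := by exact_mod_cast hd
  nlinarith [h0.1, h0.2]

theorem measure_empirical_deviation_le {X : Type*} [MeasurableSpace X] (D : Measure X)
    [IsProbabilityMeasure D] {n : ℕ} (hn : 0 < n) {A : Set X} (hA : MeasurableSet A) {κ : ℝ}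
    (hκ : 0 < κ) :
    (Measure.pi fun _ : Fin n => D)
      {x | κ ≤ |(∑ i, A.indicator 1 (x i)) / n - D.real A|} ≤ ENNReal.ofReal (1 / (n * κ ^ 2)) := by
  have hn0 : (0 : ℝ) < n := by exact_mod_cast hn
  have hAm : Measurable (A.indicator (1 : X → ℝ)) := measurable_one.indicator hA
  have h01 : ∀ x, 0 ≤ A.indicator (1 : X → ℝ) x ∧ A.indicator (1 : X → ℝ) x ≤ 1 := by
    intro x
    by_cases hx : x ∈ A <;> simp [hx]
  have hmem : ∀ i : Fin n, MemLp (fun x : Fin n → X => A.indicator (1 : X → ℝ) (x i)) 2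
      (Measure.pi fun _ => D) := fun i => by
    refine MemLp.of_bound (C := 1) (hAm.comp (measurable_pi_apply i)).aestronglyMeasurable
      (Filter.Eventually.of_forall fun x => ?_)
    rw [Real.norm_of_nonneg (h01 _).1]
    exact (h01 _).2
  have hmeas : ∀ i : Fin n, ∫ x : Fin n → X, A.indicator (1 : X → ℝ) (x i) ∂(Measure.pi fun _ => D) =
      D.real A := fun i => by
    have := integral_map (μ := Measure.pi fun _ : Fin n => D)
      (measurable_pi_apply i).aemeasurable (f := A.indicator (1 : X → ℝ)) hAm.aestronglyMeasurable
    rw [← this, ← integral_indicator_one hA]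
    congr 1
    exact (measurePreserving_eval (fun _ : Fin n => D) i).map_eq
  have hvar : ProbabilityTheory.variance (∑ i : Fin n, fun x : Fin n → X =>
      A.indicator (1 : X → ℝ) (x i)) (Measure.pi fun _ => D) ≤ n := by
    rw [ProbabilityTheory.IndepFun.variance_sum fun i _ => hmem i]
    · refine (Finset.sum_le_sum (g := fun _ => 1) fun i _ => ?_).trans (by simp)
      refine (ProbabilityTheory.variance_le_expectation_sq (hmem i).aestronglyMeasurable).trans ?_
      refine (integral_mono (g := fun _ => (1 : ℝ)) (hmem i).integrable_sq (integrable_const _)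
        fun x => ?_).trans (by simp)
      exact pow_le_one₀ (h01 _).1 (h01 _).2
    · intro i _ j _ hij
      have hind := ProbabilityTheory.iIndepFun_pi (μ := fun _ : Fin n => D) (X := fun _ x => x)
        fun i => aemeasurable_id
      exact (hind.indepFun hij).comp hAm hAm
  have hch := ProbabilityTheory.meas_ge_le_variance_div_sq
    (memLp_finsetSum' Finset.univ fun i _ => hmem i) (c := n * κ) (by positivity)
  simp only [Finset.sum_apply] at hch
  rw [integral_finsetSum _ fun i _ => (hmem i).integrable (by norm_num),
    Finset.sum_congr rfl fun i _ => hmeas i, Finset.sum_const, nsmul_eq_mul, Finset.card_univ,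
    Fintype.card_fin] at hch
  refine (measure_mono fun x hx => ?_).trans (hch.trans (ENNReal.ofReal_le_ofReal ?_))
  · rw [Set.mem_ofPred_eq] at hx ⊢
    have e : ∑ i, A.indicator (1 : X → ℝ) (x i) - n * D.real A =
        n * ((∑ i, A.indicator (1 : X → ℝ) (x i)) / n - D.real A) := by
      field_simp
    rw [e, abs_mul, abs_of_pos hn0]
    exact mul_le_mul_of_nonneg_left hx hn0.le
  · rw [div_le_div_iff₀ (by positivity) (by positivity)]
    calc _ ≤ (n : ℝ) * (n * κ ^ 2) := by gcongr
      _ = _ := by ring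

end UniformDeviation

/-! ### Running a uniform tester on an empirical distribution. -/

section Simulation

/-- The index of the cell that contains `t`, for `n` equal cells of the unit interval. -/
noncomputable def cellIndex {n : ℕ} (hn : 0 < n) (t : I) : Fin n :=
  -- The truncation matters only at `t = 1`.
  ⟨min ⌊(n : ℝ) * t⌋₊ (n - 1), by omega⟩

theorem cellIndex_monotone {n : ℕ} (hn : 0 < n) : Monotone (cellIndex hn) := by
  intro a b hab
  have hab' : (a : ℝ) ≤ b := hab
  refine Fin.mk_le_mk.2 (min_le_min_right _ (Nat.floor_mono ?_))
  gcongr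

theorem measurable_cellIndex {n : ℕ} (hn : 0 < n) : Measurable (cellIndex hn) := by
  have h : Measurable fun t : I => ⌊(n : ℝ) * t⌋₊ := by fun_prop
  exact (measurable_of_countable fun k : ℕ => (⟨min k (n - 1), by omega⟩ : Fin n)).comp h

theorem volume_cellIndex_preimage {n : ℕ} (hn : 0 < n) (k : Fin n) :
    (volume : Measure I).real (cellIndex hn ⁻¹' {k}) = 1 / n := by
  have hn0 : (0 : ℝ) < n := by exact_mod_cast hn
  have hkn : ((k : ℕ) : ℝ) + 1 ≤ n := by exact_mod_cast k.2
  have hfl : ∀ t : I, 0 ≤ (n : ℝ) * t := fun t => mul_nonneg hn0.le t.2.1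
  have hv : volume (cellIndex hn ⁻¹' {k}) = ENNReal.ofReal (1 / n) := by
    by_cases hk : (k : ℕ) + 1 = n
    · have hk' : ((k : ℕ) : ℝ) + 1 = n := by exact_mod_cast hk
      have := volume_setOf_mul_mem_Icc (c := n) (a := (k : ℕ)) (b := n) hn0 (by positivity) le_rfl
      rw [show (n : ℝ) - (k : ℕ) = 1 by linarith] at this
      rw [← this]
      congr 1
      ext t
      simp only [Set.mem_preimage, Set.mem_singleton_iff, cellIndex, Set.mem_ofPred_eq, Fin.ext_iff]
      have h1 : (n : ℝ) * t ≤ n := by nlinarith [t.2.2]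
      rw [and_iff_left h1, ← Nat.le_floor_iff (hfl t)]
      omega
    · have := volume_setOf_mul_mem_Ico (c := n) (a := (k : ℕ)) (b := (k : ℕ) + 1) hn0
        (by positivity) hkn
      rw [add_sub_cancel_left] at this
      rw [← this]
      congr 1
      ext t
      simp only [Set.mem_preimage, Set.mem_singleton_iff, cellIndex, Set.mem_ofPred_eq, Fin.ext_iff]
      rw [← Nat.floor_eq_iff (hfl t)]
      have := k.2
      omega
  rw [Measure.real, hv, ENNReal.toReal_ofReal (by positivity)]

/-- The quantile function of the empirical distribution of a sample. -/
noncomputable def sampleQuantile {n : ℕ} (hn : 0 < n) (x : Fin n → I) (t : I) : I :=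
  x (Tuple.sort x (cellIndex hn t))

theorem sampleQuantile_monotone {n : ℕ} (hn : 0 < n) (x : Fin n → I) :
    Monotone (sampleQuantile hn x) :=
  (Tuple.monotone_sort x).comp (cellIndex_monotone hn)

theorem finite_range_sampleQuantile {n : ℕ} (hn : 0 < n) (x : Fin n → I) :
    (Set.range (sampleQuantile hn x)).Finite :=
  (Set.finite_range x).subset (by rintro _ ⟨t, rfl⟩; exact ⟨_, rfl⟩)

theorem measurable_sampleQuantile {n : ℕ} (hn : 0 < n) (x : Fin n → I) :
    Measurable (sampleQuantile hn x) :=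
  (measurable_of_countable fun k => x (Tuple.sort x k)).comp (measurable_cellIndex hn)

/-- Each cell has measure `1 / n` and is sent to one order statistic, so uniform measure is pushed
to the empirical distribution. -/
theorem map_sampleQuantile_real {n : ℕ} (hn : 0 < n) (x : Fin n → I) {A : Set I}
    (hA : MeasurableSet A) :
    ((volume : Measure I).map (sampleQuantile hn x)).real A =
      (∑ i, A.indicator (1 : I → ℝ) (x i)) / n := by
  classical
  rw [map_measureReal_apply (measurable_sampleQuantile hn x) hA]
  let K : Finset (Fin n) := Finset.univ.filter fun k => x (Tuple.sort x k) ∈ A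
  have e : sampleQuantile hn x ⁻¹' A = ⋃ k ∈ K, cellIndex hn ⁻¹' {k} := by
    ext t
    simp [K, sampleQuantile]
  rw [e, measureReal_biUnion_finset, Finset.sum_congr rfl fun k _ => volume_cellIndex_preimage hn k]
  · rw [← Equiv.sum_comp (Tuple.sort x), Finset.sum_const, nsmul_eq_mul]
    simp only [Set.indicator_apply, Pi.one_apply, Finset.sum_boole, K]
    ring
  · intro i _ j _ hij
    exact Disjoint.preimage _ (Set.disjoint_singleton.2 hij)
  · exact fun k _ => measurable_cellIndex hn (measurableSet_singleton k)

/-- The sorting permutation breaks ties by index, so it is determined by finitely many comparisons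
of coordinates. -/
theorem measurableSet_sort_eq {n : ℕ} (τ : Equiv.Perm (Fin n)) :
    MeasurableSet {x : Fin n → I | Tuple.sort x = τ} := by
  have e : {x : Fin n → I | Tuple.sort x = τ} =
      (⋂ (i : Fin n) (j : Fin n) (_ : i ≤ j), {x | x (τ i) ≤ x (τ j)}) ∩
      ⋂ (i : Fin n) (j : Fin n) (_ : i < j) (_ : ¬τ i < τ j), {x | x (τ i) = x (τ j)}ᶜ := by
    ext x
    simp only [Set.mem_ofPred_eq, Set.mem_inter_iff, Set.mem_iInter, Set.mem_compl_iff]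
    rw [eq_comm, Tuple.eq_sort_iff]
    refine and_congr Iff.rfl ⟨fun h i j hij hn he => hn (h i j hij he), fun h i j hij he => ?_⟩
    by_contra hc
    exact h i j hij hc he
  rw [e]
  refine MeasurableSet.inter ?_ ?_
  · exact MeasurableSet.iInter fun i => MeasurableSet.iInter fun j => MeasurableSet.iInter fun _ =>
      measurableSet_le (measurable_pi_apply _) (measurable_pi_apply _)
  · exact MeasurableSet.iInter fun i => MeasurableSet.iInter fun j => MeasurableSet.iInter fun _ =>
      MeasurableSet.iInter fun _ =>
        (measurableSet_eq_fun (measurable_pi_apply (τ i)) (measurable_pi_apply (τ j))).compl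

theorem measurable_sort_apply {n : ℕ} (k : Fin n) :
    Measurable fun x : Fin n → I => Tuple.sort x k := by
  refine measurable_to_countable' fun i => ?_
  have e : (fun x : Fin n → I => Tuple.sort x k) ⁻¹' {i} =
      ⋃ (τ : Equiv.Perm (Fin n)) (_ : τ k = i), {x : Fin n → I | Tuple.sort x = τ} := by
    ext x
    simp
  rw [e]
  exact MeasurableSet.iUnion fun τ => MeasurableSet.iUnion fun _ => measurableSet_sort_eq τ

/-- The tester that runs `R` on a sample from the empirical distribution of its own sample. -/
noncomputable def QueryRule.simulate {s q : ℕ} (R : QueryRule I s q) {n : ℕ} (hn : 0 < n) :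
    QueryRule I n q where
  Ω := R.Ω × (Fin s → I)
  ν := R.ν.prod (Measure.pi fun _ => (volume : Measure I))
  T := R.T × (Fin s → Fin n)
  summary p := (R.summary p.1, fun v => Tuple.sort p.2 (cellIndex hn (p.1.2 v)))
  query t i := t.2 (R.query t.1 i)
  decide t l := R.decide t.1 fun v => l (t.2 v)
  measurable_summary := by
    refine (R.measurable_summary.comp measurable_fst).prodMk (measurable_pi_lambda _ fun v => ?_)
    have h1 : Measurable fun p : (R.Ω × (Fin s → I)) × (Fin n → I) => cellIndex hn (p.1.2 v) :=
      (measurable_cellIndex hn).comp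
        ((measurable_pi_apply v).comp (measurable_snd.comp measurable_fst))
    exact measurable_of_finite_param (F := fun k (p : (R.Ω × (Fin s → I)) × (Fin n → I)) =>
      Tuple.sort p.2 k) h1 fun k => (measurable_sort_apply k).comp measurable_snd
  decide_congr t l l' h := R.decide_congr _ _ _ fun i => h i

/-- Fubini over the sample: for fixed `x` the simulation is `R` on uniform points, applied to `f ∘
sampleQuantile hn x`. No measurability of `B` is assumed, hence the passage to a measurable hull. -/
theorem QueryRule.simulate_measure_le {s q : ℕ} (R : QueryRule I s q) {n : ℕ} (hn : 0 < n)
    (D : Measure I) [IsProbabilityMeasure D] {f : I → Bool} (hf : Measurable f) (a : Bool)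
    {B : Set (Fin n → I)} {r : ℝ≥0∞}
    (h : ∀ x ∉ B, (R.ν.prod (Measure.pi fun _ => (volume : Measure I)))
      {p | R.verdict (f ∘ sampleQuantile hn x) p = a} ≤ r) :
    ((R.simulate hn).ν.prod (Measure.pi fun _ => D)) {p | (R.simulate hn).verdict f p = a} ≤
      r + (Measure.pi fun _ : Fin n => D) B := by
  have hν : IsProbabilityMeasure (R.simulate hn).ν := QueryRule.isProbabilityMeasure _
  have hm : MeasurableSet {p | (R.simulate hn).verdict f p = a} :=
    (R.simulate hn).measurable_verdict hf (measurableSet_singleton a)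
  rw [Measure.prod_apply_symm hm, ← measure_toMeasurable B]
  set B' := toMeasurable (Measure.pi fun _ : Fin n => D) B
  have hB' : MeasurableSet B' := measurableSet_toMeasurable _ _
  calc ∫⁻ x, (R.simulate hn).ν ((fun w => (w, x)) ⁻¹' {p | (R.simulate hn).verdict f p = a})
        ∂(Measure.pi fun _ : Fin n => D)
      ≤ ∫⁻ x, (r + B'.indicator 1 x) ∂(Measure.pi fun _ : Fin n => D) := by
        refine lintegral_mono fun x => ?_
        by_cases hx : x ∈ B'
        · rw [Set.indicator_of_mem hx]
          exact prob_le_one.trans (by simp)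
        · rw [Set.indicator_of_notMem hx, add_zero]
          exact h x fun hc => hx (subset_toMeasurable _ _ hc)
    _ = _ := by
        rw [lintegral_add_left measurable_const, lintegral_const, measure_univ, mul_one,
          lintegral_indicator_one hB']

end Simulation

/-! ### The tester for unknown distributions, and large `ε`. -/

section DistributionFree

theorem comp_mem_unionsOfOrdConnected {d : ℕ} {f : I → Bool} (hf : f ∈ unionsOfOrdConnected d)
    {φ : I → I} (hφ : Monotone φ) : f ∘ φ ∈ unionsOfOrdConnected d := by
  obtain ⟨J, hJ, hfJ⟩ := hf
  exact ⟨fun i => φ ⁻¹' J i, fun i => (hJ i).preimage_mono hφ, fun x => hfJ (φ x)⟩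

/-- The samples whose empirical distribution approximates `D` badly on the bracketing sets. -/
def badSamples (D : Measure I) (f : I → Bool) {N : ℕ} (P Q : Fin (N + 1) → Set I) (n : ℕ) :
    Set (Fin n → I) :=
  ⋃ j : (Bool × Bool) × Fin (N + 1), {x | 1 / (N : ℝ) ≤
    |(∑ i, (f ⁻¹' {j.1.1} ∩ bif j.1.2 then P j.2 else Q j.2).indicator (1 : I → ℝ) (x i)) / n -
      D.real (f ⁻¹' {j.1.1} ∩ bif j.1.2 then P j.2 else Q j.2)|}

/-- Each of the `4 * (N + 1)` sets fails with probability at most `1 / (80 * N)`, and `N + 1 ≤ 2 *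
N`. -/
theorem measure_badSamples_le (D : Measure I) [IsProbabilityMeasure D] {f : I → Bool}
    (hf : Measurable f) {N : ℕ} (hN : 0 < N) {P Q : Fin (N + 1) → Set I}
    (hP : ∀ k, MeasurableSet (P k)) (hQ : ∀ k, MeasurableSet (Q k)) :
    (Measure.pi fun _ => D) (badSamples D f P Q (80 * N ^ 3)) ≤ 1 / 10 := by
  have hN0 : (0 : ℝ) < N := by exact_mod_cast hN
  have hN1 : (1 : ℝ) ≤ N := by exact_mod_cast hN
  refine (measure_iUnion_fintype_le _ _).trans ((Finset.sum_le_sum fun j _ =>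
    measure_empirical_deviation_le D (by positivity) ?_ (by positivity)).trans ?_)
  · refine (hf (measurableSet_singleton _)).inter ?_
    cases j.1.2
    · exact hQ _
    · exact hP _
  · rw [Finset.sum_const, nsmul_eq_mul, ← ENNReal.ofReal_natCast, ← ENNReal.ofReal_mul (by positivity),
      show (1 : ℝ≥0∞) / 10 = ENNReal.ofReal (1 / 10) by
        rw [ENNReal.ofReal_div_of_pos (by norm_num)]; simp]
    refine ENNReal.ofReal_le_ofReal ?_
    simp only [Finset.card_univ, Fintype.card_prod, Fintype.card_bool, Fintype.card_fin]
    push_cast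
    have e : (80 * (N : ℝ) ^ 3 * (1 / N) ^ 2) = 80 * N := by
      field_simp
    rw [e, mul_one_div, div_le_div_iff₀ (by positivity) (by norm_num)]
    linarith

/-- A union of intervals near the composed function transfers to one near `f` under the empirical
distribution, hence under `D`. The uniform deviation `2 / N` costs `5 * d * (2 / N) ≤ ε / 2`. -/
theorem far_comp_sampleQuantile {D : Measure I} [IsProbabilityMeasure D] {f : I → Bool}
    (hf : Measurable f) {d : ℕ} (hd : 1 ≤ d) {N : ℕ} (hN : 0 < N) {P Q : Fin (N + 1) → Set I}
    (hP : ∀ k, MeasurableSet (P k)) (hQ : ∀ k, MeasurableSet (Q k))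
    (hPQ : ∀ k, D.real (Q k) ≤ D.real (P k) + 1 / N)
    (hL : ∀ L : Set I, IsLowerSet L → ∃ k, P k ⊆ L ∧ L ⊆ Q k) {ε : ℝ}
    (hNε : 20 * d ≤ ε * N) (hfar : ENNReal.ofReal ε ≤ distToProperty D (unionsOfIntervals d) f)
    {n : ℕ} (hn : 0 < n) {x : Fin n → I} (hx : x ∉ badSamples D f P Q n) :
    ENNReal.ofReal (ε / 2) ≤
      distToProperty volume (unionsOfIntervals d) (f ∘ sampleQuantile hn x) := by
  have hN0 : (0 : ℝ) < N := by exact_mod_cast hN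
  refine le_iInf₂ fun G hG => ?_
  obtain ⟨g, hg, hgG⟩ := exists_transfer (sampleQuantile_monotone hn x)
    (finite_range_sampleQuantile hn x) f hG
  have hgm := measurable_of_mem_unionsOfIntervals hg
  set E := (volume : Measure I).map (sampleQuantile hn x) with hE
  have hEp : IsProbabilityMeasure E :=
    Measure.isProbabilityMeasure_map (measurable_sampleQuantile hn x).aemeasurable
  have hclose : ∀ b, ∀ L : Set I, MeasurableSet L → IsLowerSet L →
      |E.real (f ⁻¹' {b} ∩ L) - D.real (f ⁻¹' {b} ∩ L)| ≤ 1 / N + 1 / N := by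
    intro b L hLm hLl
    obtain ⟨k, hk1, hk2⟩ := hL L hLl
    have hb := hf (measurableSet_singleton b)
    simp only [badSamples, Set.mem_iUnion, not_exists] at hx
    have h1 := hx ((b, true), k)
    have h2 := hx ((b, false), k)
    simp only [cond_true, cond_false, Set.mem_ofPred_eq, not_le] at h1 h2
    rw [← map_sampleQuantile_real hn x (hb.inter (hP k))] at h1
    rw [← map_sampleQuantile_real hn x (hb.inter (hQ k))] at h2
    exact abs_sub_le_of_bracketing (hP k) hLm hk1 hk2 (hPQ k) h1.le h2.le
  have hmain := measureReal_ne_le_of_close hf hd hg hclose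
  have hεD : ε ≤ D.real {y | f y ≠ g y} :=
    (ENNReal.ofReal_le_iff_le_toReal (measure_ne_top _ _)).1 (hfar.trans (iInf₂_le g hg))
  have hEle : E.real {y | f y ≠ g y} ≤
      (volume : Measure I).real {t | (f ∘ sampleQuantile hn x) t ≠ G t} := by
    have hm : MeasurableSet {y | f y ≠ g y} := (measurableSet_eq_fun hf hgm).compl
    rw [hE, map_measureReal_apply (measurable_sampleQuantile hn x) hm]
    exact measureReal_mono fun t ht => hgG t ht
  have h5 : 5 * d * (1 / N + 1 / N) ≤ ε / 2 := by
    have e : 5 * d * (1 / (N : ℝ) + 1 / N) = 10 * d / N := by ring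
    rw [e, div_le_iff₀ hN0]
    linarith
  exact (ENNReal.ofReal_le_iff_le_toReal (measure_ne_top _ _)).2 (by
    change ε / 2 ≤ (volume : Measure I).real {t | (f ∘ sampleQuantile hn x) t ≠ G t}
    linarith)

theorem QueryRule.two_thirds_le {X : Type*} [MeasurableSpace X] {s q : ℕ} (R : QueryRule X s q)
    (D : Measure X) [IsProbabilityMeasure D] {f : X → Bool} (hf : Measurable f) {a b : Bool}
    (hab : a ≠ b) (h : (R.ν.prod (Measure.pi fun _ => D)) {p | R.verdict f p = b} ≤ 1 / 3) :
    2 / 3 ≤ (R.ν.prod (Measure.pi fun _ => D)) {p | R.verdict f p = a} := by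
  have hm : MeasurableSet {p | R.verdict f p = b} :=
    R.measurable_verdict hf (measurableSet_singleton b)
  have e : {p | R.verdict f p = a} = {p | R.verdict f p = b}ᶜ := by
    ext p
    simp only [Set.mem_ofPred_eq, Set.mem_compl_iff]
    revert hab
    cases a <;> cases b <;> simp
  rw [e, prob_compl_eq_one_sub hm]
  have h3 : (1 : ℝ≥0∞) = 2 / 3 + 1 / 3 := by
    rw [ENNReal.div_add_div_same]
    norm_num
    rw [ENNReal.div_self] <;> simp
  refine le_trans (le_of_eq ?_) (tsub_le_tsub_left h 1)
  calc (2 / 3 : ℝ≥0∞) = 2 / 3 + 1 / 3 - 1 / 3 :=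
        (ENNReal.add_sub_cancel_right (by finiteness)).symm
    _ = 1 - 1 / 3 := congrArg (· - 1 / 3) h3.symm

theorem one_tenth_add_le : (1 : ℝ≥0∞) / 10 + 1 / 10 ≤ 1 / 3 := by
  have : (1 : ℝ≥0∞) / 10 = ENNReal.ofReal (1 / 10) := by
    rw [ENNReal.ofReal_div_of_pos (by norm_num)]; simp
  have h3 : (1 : ℝ≥0∞) / 3 = ENNReal.ofReal (1 / 3) := by
    rw [ENNReal.ofReal_div_of_pos (by norm_num)]; simp
  rw [this, h3, ← ENNReal.ofReal_add (by norm_num) (by norm_num)]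
  exact ENNReal.ofReal_le_ofReal (by norm_num)

theorem QueryRule.IsReliable.spec {s q d : ℕ} {ε : ℝ} {R : QueryRule I s q}
    (hR : R.IsReliable d ε) (f : I → Bool) (hf : Measurable f) :
    (f ∈ unionsOfIntervals d →
      2 / 3 ≤ (R.ν.prod (Measure.pi fun _ => (volume : Measure I))) {p | R.verdict f p = true}) ∧
    (ENNReal.ofReal ε ≤ distToProperty volume (unionsOfIntervals d) f →
      2 / 3 ≤ (R.ν.prod (Measure.pi fun _ => (volume : Measure I))) {p | R.verdict f p = false}) := by
  have h13 : (1 : ℝ≥0∞) / 10 ≤ 1 / 3 := le_self_add.trans one_tenth_add_le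
  exact ⟨fun h => R.two_thirds_le _ hf (by simp)
      (((hR f hf).1 (unionsOfIntervals_subset d h)).trans h13),
    fun h => R.two_thirds_le _ hf (by simp) (((hR f hf).2 h).trans h13)⟩

/-- Completeness holds conditionally on every sample. Soundness fails through a bad sample or an
error of `R`, each with probability at most `1 / 10`. The brackets depend on `D` but enter only the
analysis. -/
theorem QueryRule.IsReliable.simulate_spec {s q d : ℕ} {ε : ℝ} {R : QueryRule I s q}
    (hR : R.IsReliable d (ε / 2)) (hd : 1 ≤ d) {N : ℕ} (hN : 0 < N) (hNε : 20 * d ≤ ε * N)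
    (hn : 0 < 80 * N ^ 3) (D : Measure I) [IsProbabilityMeasure D] (f : I → Bool)
    (hf : Measurable f) :
    (f ∈ unionsOfIntervals d → 2 / 3 ≤ ((R.simulate hn).ν.prod (Measure.pi fun _ => D))
      {p | (R.simulate hn).verdict f p = true}) ∧
    (ENNReal.ofReal ε ≤ distToProperty D (unionsOfIntervals d) f →
      2 / 3 ≤ ((R.simulate hn).ν.prod (Measure.pi fun _ => D))
        {p | (R.simulate hn).verdict f p = false}) := by
  constructor
  · intro hfd
    refine (R.simulate hn).two_thirds_le _ hf (b := false) (by simp) ?_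
    refine (R.simulate_measure_le hn D hf false (B := ∅) (r := 1 / 10) fun x _ => ?_).trans ?_
    · exact (hR _ (hf.comp (measurable_sampleQuantile hn x))).1
        (comp_mem_unionsOfOrdConnected (unionsOfIntervals_subset d hfd)
          (sampleQuantile_monotone hn x))
    · rw [measure_empty, add_zero]
      exact le_self_add.trans one_tenth_add_le
  · intro hfar
    obtain ⟨P, Q, hP, hQ, hPQ, hL⟩ := exists_bracketing D hN
    refine (R.simulate hn).two_thirds_le _ hf (b := true) (by simp) ?_
    refine (R.simulate_measure_le hn D hf true (B := badSamples D f P Q (80 * N ^ 3)) (r := 1 / 10)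
      fun x hx => ?_).trans ?_
    · exact (hR _ (hf.comp (measurable_sampleQuantile hn x))).2
        (far_comp_sampleQuantile hf hd hN hP hQ hPQ hL hNε hfar hn hx)
    · exact le_trans (add_le_add le_rfl (measure_badSamples_le D hf hN hP hQ)) one_tenth_add_le

/-- The tester that accepts without looking at the sample. -/
noncomputable def acceptRule : QueryRule I 0 0 where
  Ω := Unit
  ν := Measure.dirac ()
  T := Unit
  summary _ := ()
  query _ i := i
  decide _ _ := true
  measurable_summary := measurable_const
  decide_congr _ _ _ _ := rfl

/-- The empty union is within distance `1` of everything, so nothing has to be rejected. For large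
`ε` the bounds may not leave room for even one sample. -/
theorem acceptRule_spec {d : ℕ} {ε : ℝ} (hε : 1 < ε) (D : Measure I) [IsProbabilityMeasure D]
    (f : I → Bool) (_hf : Measurable f) :
    (f ∈ unionsOfIntervals d → 2 / 3 ≤ (acceptRule.ν.prod (Measure.pi fun _ => D))
      {p | acceptRule.verdict f p = true}) ∧
    (ENNReal.ofReal ε ≤ distToProperty D (unionsOfIntervals d) f →
      2 / 3 ≤ (acceptRule.ν.prod (Measure.pi fun _ => D))
        {p | acceptRule.verdict f p = false}) := by
  have hν : IsProbabilityMeasure acceptRule.ν := QueryRule.isProbabilityMeasure _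
  constructor
  · intro _
    have e : {p : acceptRule.Ω × (Fin 0 → I) | acceptRule.verdict f p = true} = Set.univ :=
      Set.eq_univ_of_forall fun p => rfl
    rw [e, measure_univ]
    exact ENNReal.div_le_of_le_mul (by norm_num)
  · intro h
    exfalso
    have h0 : (fun _ : I => false) ∈ unionsOfIntervals d :=
      ⟨0, Nat.zero_le d, fun i => i.elim0, fun i => i.elim0, fun i => i.elim0, fun i => i.elim0,
        fun x => ⟨fun h => by simp at h, fun ⟨i, _⟩ => i.elim0⟩⟩
    have h1 : ENNReal.ofReal ε ≤ 1 := h.trans ((iInf₂_le _ h0).trans prob_le_one)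
    rw [ENNReal.ofReal_le_one] at h1
    linarith

theorem exists_distributionFree {d : ℕ} (hd : 1 ≤ d) {ε : ℝ} (hε : 0 < ε) (hε1 : ε ≤ 1) :
    ∃ s q : ℕ, (s : ℝ) ≤ 80 * (22 * (d * (1 / ε))) ^ 3 ∧ (q : ℝ) ≤ 16 * 10 ^ 9 / ε ^ 4 ∧
      ∃ A : ActiveTester I s q, ∀ (D : Measure I) [IsProbabilityMeasure D],
        A.IsTester (unionsOfIntervals d) D ε := by
  have hd1 : (1 : ℝ) ≤ d := by exact_mod_cast hd
  obtain ⟨s, q, -, hq, R, hR⟩ := exists_isReliable hd (half_pos hε) (by linarith)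
  set N : ℕ := ⌈20 * (d * (1 / ε))⌉₊ + 1 with hNdef
  have hN : 0 < N := Nat.succ_pos _
  have hn : 0 < 80 * N ^ 3 := by positivity
  have hde : 1 ≤ d * (1 / ε) := by
    rw [mul_one_div, le_div_iff₀ hε]
    linarith
  have hN1 : 20 * (d * (1 / ε)) ≤ N := by
    rw [hNdef]
    push_cast
    linarith [Nat.le_ceil (20 * (d * (1 / ε)))]
  have hN2 : (N : ℝ) ≤ 22 * (d * (1 / ε)) := by
    rw [hNdef]
    push_cast
    linarith [Nat.ceil_lt_add_one (by positivity : 0 ≤ 20 * (d * (1 / ε)))]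
  have hNε : 20 * d ≤ ε * N := by
    calc (20 : ℝ) * d = ε * (20 * (d * (1 / ε))) := by field_simp
      _ ≤ ε * N := by gcongr
  refine ⟨80 * N ^ 3, q, ?_, ?_, (R.simulate hn).toActive, fun D _ =>
    (R.simulate hn).toActive_isTester fun f hf => hR.simulate_spec hd hN hNε hn D f hf⟩
  · push_cast
    gcongr
  · refine hq.trans (le_of_eq ?_)
    field_simp
    norm_num

end DistributionFree

theorem mainTheorem1 :
    ∃ C : ℝ, 0 < C ∧
      -- one tester for all distributions `D`, so `D` need not be known
      (∃ p : MvPolynomial (Fin 2) ℝ, ∀ d : ℕ, 1 ≤ d → ∀ ε : ℝ, 0 < ε →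
        ∃ s q : ℕ, (s : ℝ) ≤ MvPolynomial.eval ![(d : ℝ), 1 / ε] p ∧ (q : ℝ) ≤ C / ε ^ 4 ∧
          ∃ A : ActiveTester I s q, ∀ (D : Measure I) [IsProbabilityMeasure D],
            A.IsTester (unionsOfIntervals d) D ε) ∧
      -- the uniform distribution, active testing
      (∀ d : ℕ, 1 ≤ d → ∀ ε : ℝ, 0 < ε →
        ∃ s q : ℕ, (s : ℝ) ≤ C * √(d : ℝ) / ε ^ 5 ∧ (q : ℝ) ≤ C / ε ^ 4 ∧
          ∃ A : ActiveTester I s q, A.IsTester (unionsOfIntervals d) (volume : Measure I) ε) ∧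
      -- the uniform distribution, passive testing
      (∀ d : ℕ, 1 ≤ d → ∀ ε : ℝ, 0 < ε →
        ∃ q : ℕ, (q : ℝ) ≤ C * √(d : ℝ) / ε ^ 5 ∧
          ∃ A : PassiveTester I q, A.IsTester (unionsOfIntervals d) (volume : Measure I) ε) ∧
      -- optimality of the passive tester in `d`
      (∃ c ε₀ : ℝ, 0 < c ∧ 0 < ε₀ ∧ ∀ d : ℕ, 1 ≤ d → ∀ ε : ℝ, 0 < ε → ε ≤ ε₀ →
        ∀ (q : ℕ) (A : PassiveTester I q),
          A.IsTester (unionsOfIntervals d) (volume : Measure I) ε → c * √(d : ℝ) ≤ q) := by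
  -- The factor `16 = 2 ^ 4` comes from running the uniform tester at `ε / 2` in the
  -- distribution-free case.
  refine ⟨16 * 10 ^ 9, by norm_num, ⟨MvPolynomial.C 80 * (MvPolynomial.C 22 *
    (MvPolynomial.X 0 * MvPolynomial.X 1)) ^ 3, fun d hd ε hε => ?_⟩, fun d hd ε hε => ?_,
    fun d hd ε hε => ?_, 1 / 2, 1 / 8, by norm_num, by norm_num,
    fun d hd ε _ hε q A hA => sqrt_le_of_passive_isTester hd hε A hA⟩
  · have e : MvPolynomial.eval ![(d : ℝ), 1 / ε] (MvPolynomial.C 80 * (MvPolynomial.C 22 *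
        (MvPolynomial.X 0 * MvPolynomial.X 1)) ^ 3) = 80 * (22 * (d * (1 / ε))) ^ 3 := by
      simp
    rw [e]
    rcases le_or_gt ε 1 with hε1 | hε1
    · exact exists_distributionFree hd hε hε1
    · refine ⟨0, 0, ?_, ?_, acceptRule.toActive, fun D _ =>
        acceptRule.toActive_isTester fun f hf => acceptRule_spec hε1 D f hf⟩
      · rw [Nat.cast_zero]
        positivity
      · rw [Nat.cast_zero]
        positivity
  · rcases le_or_gt ε 1 with hε1 | hε1
    · obtain ⟨s, q, hs, hq, R, hR⟩ := exists_isReliable hd hε hε1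
      refine ⟨s, q, hs.trans ?_, hq.trans ?_, R.toActive, R.toActive_isTester hR.spec⟩
      · gcongr
        norm_num
      · gcongr
        norm_num
    · refine ⟨0, 0, ?_, ?_, acceptRule.toActive,
        acceptRule.toActive_isTester fun f hf => acceptRule_spec hε1 _ f hf⟩
      · rw [Nat.cast_zero]
        positivity
      · rw [Nat.cast_zero]
        positivity
  · rcases le_or_gt ε 1 with hε1 | hε1
    · obtain ⟨s, q, hs, -, R, hR⟩ := exists_isReliable hd hε hε1
      refine ⟨s, hs.trans ?_, R.toPassive, R.toPassive_isTester hR.spec⟩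
      gcongr
      norm_num
    · refine ⟨0, ?_, acceptRule.toPassive,
        acceptRule.toPassive_isTester fun f hf => acceptRule_spec hε1 _ f hf⟩
      rw [Nat.cast_zero]
      positivity
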